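/- Let $\varepsilon>0$ with $1/\varepsilon\in\mathbb N$ and $K=(2/\varepsilon)^{1/\varepsilon}$. An instance of the geometric covering problem consists of the following. \textbf{Jobs.} There are $n$ jobs $1,\dots,n$ with processing times $p_j\in\mathbb N$ and pairwise distinct release times $r_1<\dots<r_n$ in $\mathbb N$. Let $P=\max_j p_j$ and $T=\max_j r_j+\sum_j p_j$. \textbf{Grid.} There is a hierarchical grid with levels $0,\dots,\ell_{\max}$. Level $0$ consists of a single cell $C_0=[0,\mathrm{len}(C_0))$ that contains $[0,T)$, with $\mathrm{len}(C_0)\le K^2nP$. Each cell of a level $\ell<\ell_{\max}$ has length greater than $K$ and is subdivided into $K$ cells of level $\ell+1$ of equal length (its children). The cells of level $\ell_{\max}$ have an integral length in $\{1,\dots,K\}$ and no children. \textbf{Segments.} For each job $j$ the interval $[r_j,\mathrm{end}(C_0))$ is partitioned, from left to right, by groups of segments, one for each of the levels $\ell=\ell_{\max},\dots,0$. The group of level $\ell_{\max}$ begins at $r_j$, and the group of level $\ell<\ell_{\max}$ begins where the group of level $\ell+1$ ends. If this point lies in $C_0$, let $C$ be the cell of level $\ell$ that contains it; the group is denoted $\mathrm{Seg}(j,C)$,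 it extends to $\mathrm{end}(C)$, and it consists of segments of equal length, namely of cells of level $\ell+2$ if $\ell\le\ell_{\max}-2$, and of intervals $[t,t+1)$ with $t\in\mathbb N$ if $\ell>\ell_{\max}-2$. (If $\mathrm{end}(C_0)$ is reached earlier, the remaining groups are empty. $\mathrm{Seg}(j,C)=\emptyset$ for all other cells $C$.) \textbf{Rectangles.} Each segment $S$ in $\mathrm{Seg}(j,C)$ yields a unit-height rectangle $R=[\mathrm{beg}(S),\mathrm{end}(S))\times[j,j+1)$ with capacity $p(R)=p_j$ and a cost $c(R)\in\mathbb N$. Let $\mathcal R(j,C)$ be the set of rectangles from $\mathrm{Seg}(j,C)$, and $\mathcal R$ the set of all rectangles. \textbf{Rays.} For all $s,t\in\mathbb N$ with $0\le s\le t\le T$ there is a ray $L[s,t]=\{t+\tfrac12\}\times[j(s)+\tfrac12,\infty)$, where $j(s)$ is the first job with $r_{j(s)}\ge s$ (if there is none, the ray intersects no rectangle), with demand $d([s,t])=\sum_{j:\,s\le r_j\le t}p_j-(t-s)$. \textbf{Solutions.} A set $\mathcal R'\subseteq\mathcal R$ is feasible if for each job $j$ and each cell $C$ the set $\mathcal R'\cap\mathcal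 R(j,C)$ is a (possibly empty) prefix of $\mathcal R(j,C)$ in the left-to-right order, and for each ray $L[s,t]$ the total capacity of the rectangles in $\mathcal R'$ that intersect $L[s,t]$ is at least $d([s,t])$. It is optimal if it is feasible and has minimum total cost $\sum_{R\in\mathcal R'}c(R)$ among all feasible sets. \textbf{Claim.} One can compute an optimal solution in time $(nP)^{O(K^2)}\le (nP)^{O_\varepsilon(1)}$. Precisely: there are a single program for a uniform-cost random access machine on the natural numbers (registers and arrays, with addition, truncated subtraction and tests for zero as operations) and an absolute constant $c\in\mathbb N$ such that for every $\varepsilon$ and every instance as above, given $n$, $K$, $\ell_{\max}$, the length of the cells of level $\ell_{\max}$, the pairs $(r_j,p_j)$ for all $j$, and the costs of all rectangles (ordered by job, and from left to right for each job), the program halts after at most $\max\{2,nP\}^{cK^2}$ steps and outputs an optimal solution, in the form of one flag for each rectangle, in the same order, that is nonzero exactly if the rectangle is selected. -/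

import Mathlib

/-! ## Machine model

A uniform-cost random access machine on natural numbers, programmed by structured
programs with registers and arrays.  The arithmetic operations are addition and truncated
subtraction only (there is no unit-cost multiplication), so that `t` steps can produce only numbers
whose binary length exceeds that of the input numbers and program constants by `O(t)`. -/

namespace RAM

/-- A memory state: registers `reg x` and arrays `arr a i`, all holding natural numbers. A program
is a finite object, so it mentions only finitely many registers and arrays. -/
structure State where
  reg : ℕ → ℕ
  arr : ℕ → ℕ → ℕ

/-- Expressions: constants, registers, array entries (the index may be computed), sum, and
truncated difference. -/
inductive Expr where
  | lit (n : ℕ)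
  | var (x : ℕ)
  | get (a : ℕ) (i : Expr)
  | add (e f : Expr)
  | sub (e f : Expr)

/-- The value of an expression in a state. -/
def Expr.eval (σ : State) : Expr → ℕ
  | .lit n => n
  | .var x => σ.reg x
  | .get a i => σ.arr a (i.eval σ)
  | .add e f => e.eval σ + f.eval σ
  | .sub e f => e.eval σ - f.eval σ

/-- The number of steps needed to evaluate an expression: one per operation. -/
def Expr.steps : Expr → ℕ
  | .lit _ => 1
  | .var _ => 1
  | .get _ i => i.steps + 1
  | .add e f => e.steps + f.steps + 1
  | .sub e f => e.steps + f.steps + 1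

/-- Programs. A test `e` succeeds when the value of `e` is nonzero. -/
inductive Cmd where
  | skip
  | assign (x : ℕ) (e : Expr)
  | put (a : ℕ) (i e : Expr)
  | seq (c d : Cmd)
  | branch (e : Expr) (c d : Cmd)
  | loop (e : Expr) (c : Cmd)

/-- `reg x := v`. -/
def State.setReg (σ : State) (x v : ℕ) : State :=
  { σ with reg := Function.update σ.reg x v }

/-- `arr a i := v`. -/
def State.setArr (σ : State) (a i v : ℕ) : State :=
  { σ with arr := Function.update σ.arr a (Function.update (σ.arr a) i v) }

/-- `Run c σ t τ`: started in the state `σ`, the program `c` halts in the state `τ` after exactly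
`t` steps. Every assignment, test and evaluation of an operation is charged. -/
inductive Run : Cmd → State → ℕ → State → Prop
  | skip (σ : State) : Run .skip σ 1 σ
  | assign (σ : State) (x : ℕ) (e : Expr) :
      Run (.assign x e) σ (e.steps + 1) (σ.setReg x (e.eval σ))
  | put (σ : State) (a : ℕ) (i e : Expr) :
      Run (.put a i e) σ (i.steps + e.steps + 1) (σ.setArr a (i.eval σ) (e.eval σ))
  | seq {c d : Cmd} {σ τ υ : State} {s t : ℕ} (hc : Run c σ s τ) (hd : Run d τ t υ) :
      Run (.seq c d) σ (s + t) υ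
  | branch_true {e : Expr} {c d : Cmd} {σ τ : State} {t : ℕ} (he : e.eval σ ≠ 0)
      (hc : Run c σ t τ) : Run (.branch e c d) σ (e.steps + 1 + t) τ
  | branch_false {e : Expr} {c d : Cmd} {σ τ : State} {t : ℕ} (he : e.eval σ = 0)
      (hd : Run d σ t τ) : Run (.branch e c d) σ (e.steps + 1 + t) τ
  | loop_true {e : Expr} {c : Cmd} {σ τ υ : State} {s t : ℕ} (he : e.eval σ ≠ 0)
      (hc : Run c σ s τ) (hl : Run (.loop e c) τ t υ) :
      Run (.loop e c) σ (e.steps + 1 + s + t) υ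
  | loop_false {e : Expr} {c : Cmd} {σ : State} (he : e.eval σ = 0) :
      Run (.loop e c) σ (e.steps + 1) σ

/-- The initial state on an input: the input is stored in array `0` from index `0` on, and
everything else is `0`. -/
def State.ofInput (input : List ℕ) : State where
  reg := fun _ => 0
  arr := fun a i => if a = 0 then input.getD i 0 else 0

end RAM

/-! ## The geometric covering problem -/

/-- The rectangle `[lo, hi) × [job, job + 1)` of unit height that belongs to the job `job`. -/
@[ext] structure Rect (n : ℕ) where
  job : Fin n
  lo : ℕ
  hi : ℕ

noncomputable instance (n : ℕ) : DecidableEq (Rect n) := Classical.decEq _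

/-- The region of the plane covered by a rectangle. -/
def Rect.region {n : ℕ} (R : Rect n) : Set (ℝ × ℝ) :=
  Set.Ico (R.lo : ℝ) (R.hi : ℝ) ×ˢ Set.Ico ((R.job : ℕ) : ℝ) (((R.job : ℕ) : ℝ) + 1)

/-- The data of an instance: `1 / ε`, the maximum level `depth` of the grid, the length `leafLen` of
the cells of maximum level, the jobs `0, …, n - 1` with processing times `p` and release times `r`,
and the costs of the rectangles. -/
structure CoverInstance where
  invEps : ℕ
  depth : ℕ
  leafLen : ℕ
  n : ℕ
  p : Fin n → ℕ
  r : Fin n → ℕ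
  cost : Rect n → ℕ

/-- A cell of the grid, given by its level and its position (from left to right, starting with `0`)
among the cells of that level. -/
structure GridCell where
  level : ℕ
  idx : ℕ

namespace CoverInstance

variable (I : CoverInstance)

/-- `K = (2 / ε) ^ (1 / ε)`. -/
def K : ℕ := (2 * I.invEps) ^ I.invEps

/-- `P`, the maximum processing time. -/
def P : ℕ := Finset.univ.sup I.p

/-- `T = max_j r_j + ∑_j p_j`. -/
def T : ℕ := Finset.univ.sup I.r + ∑ j, I.p j

/-! ### The hierarchical grid

Level `0` consists of the single cell `C₀ = [0, len 0)`, and each cell of a level `ℓ < depth` is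
subdivided into `K` cells of level `ℓ + 1` of equal length. -/

/-- The length of the cells of level `ℓ` (for `ℓ ≤ depth`). -/
def len (ℓ : ℕ) : ℕ := I.leafLen * I.K ^ (I.depth - ℓ)

/-- All cells of the grid, those of larger level first, and those of equal level from left to
right. -/
def cells : List GridCell :=
  (List.range (I.depth + 1)).reverse.flatMap fun ℓ =>
    (List.range (I.K ^ ℓ)).map fun i => ⟨ℓ, i⟩

/-- The left endpoint of a cell. -/
def cellBeg (C : GridCell) : ℕ := C.idx * I.len C.level

/-- The right endpoint of a cell. -/
def cellEnd (C : GridCell) : ℕ := (C.idx + 1) * I.len C.level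

/-! ### Segments

The interval `[r_j, end C₀)` is partitioned from left to right by groups of segments, one group for
each level, starting with the level `depth`. The group of level `ℓ` begins where the group of level
`ℓ + 1` ends (that of level `depth` begins at `r_j`); it belongs to the cell `C` of level `ℓ` that
contains this point, and it extends to the right endpoint of `C`. If `end C₀` is reached before
level `0`, then the remaining groups are empty. -/

/-- The left endpoint of the group of segments of level `depth - d` of the job `j`. -/
def front (j : Fin I.n) : ℕ → ℕ
  | 0 => I.r j
  | d + 1 =>
      min ((front j d / I.len (I.depth - d) + 1) * I.len (I.depth - d)) (I.len 0)

/-- The common length of the segments of a group of level `ℓ`: the length of the cells of level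
`ℓ + 2` if there are such cells, and `1` otherwise. -/
def segLen (ℓ : ℕ) : ℕ := if ℓ + 2 ≤ I.depth then I.len (ℓ + 2) else 1

/-- `ℛ(j, C)`: the rectangles of the job `j` that come from the segments in `Seg(j, C)`, from left
to right. -/
def rectsOf (j : Fin I.n) (C : GridCell) : List (Rect I.n) :=
  let x := I.front j (I.depth - C.level)
  let w := I.segLen C.level
  if I.cellBeg C ≤ x ∧ x < I.cellEnd C then
    (List.range ((I.cellEnd C - x) / w)).map fun i => ⟨j, x + i * w, x + (i + 1) * w⟩
  else []

/-- `ℛ`: all rectangles, ordered by their jobs, and from left to right for each job. -/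
def rects : List (Rect I.n) :=
  (List.finRange I.n).flatMap fun j => I.cells.flatMap fun C => I.rectsOf j C

/-! ### Rays -/

/-- `j(I)` for `I = [s, t]`: since the jobs are sorted by their distinct release times, the first job
released at time `s` or later is the one whose number is the number of jobs released before `s`
(if there is no such job this is `n`, and the ray lies beyond all rectangles). -/
def firstJob (s : ℕ) : ℕ := (Finset.univ.filter fun j => I.r j < s).card

/-- The ray `L[s, t]`. The second coordinate increases in downward direction. -/
def ray (s t : ℕ) : Set (ℝ × ℝ) :=
  {(t : ℝ) + 1 / 2} ×ˢ Set.Ici ((I.firstJob s : ℝ) + 1 / 2)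

/-- The demand `d([s, t])`. -/
def demand (s t : ℕ) : ℤ :=
  (∑ j ∈ Finset.univ.filter (fun j => s ≤ I.r j ∧ I.r j ≤ t), (I.p j : ℤ)) - ((t : ℤ) - (s : ℤ))

open Classical in
/-- The total capacity of those rectangles in `X` that intersect the ray `L[s, t]`. -/
noncomputable def covered (X : Finset (Rect I.n)) (s t : ℕ) : ℕ :=
  ∑ R ∈ X.filter (fun R => (R.region ∩ I.ray s t).Nonempty), I.p R.job

/-! ### Instances and solutions -/

/-- The conditions on the data of an instance. -/
structure Valid : Prop where
  /-- `1 / ε` is a positive integer -/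
  invEps_pos : 0 < I.invEps
  /-- the cells without children have a length in `{1, …, K}` -/
  leafLen_pos : 0 < I.leafLen
  leafLen_le : I.leafLen ≤ I.K
  /-- the cells with children have length greater than `K` -/
  lt_len : ∀ ℓ < I.depth, I.K < I.len ℓ
  /-- the jobs are sorted by their release times, which are pairwise distinct -/
  strictMono_r : StrictMono I.r
  /-- `C₀` contains `[0, T)` -/
  T_le : I.T ≤ I.len 0
  /-- `len C₀ ≤ K² n P` -/
  len_le : I.len 0 ≤ I.K ^ 2 * (I.n * I.P)

/-- Feasible solutions: sets of rectangles that contain, for each job and each cell, a (possibly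
empty) prefix of `ℛ(j, C)`, and that satisfy the demands of all rays. -/
structure IsFeasible (X : Finset (Rect I.n)) : Prop where
  subset : ∀ R ∈ X, R ∈ I.rects
  isPrefix : ∀ j, ∀ C ∈ I.cells, ∃ k : ℕ, ∀ R ∈ I.rectsOf j C, R ∈ X ↔ R ∈ (I.rectsOf j C).take k
  covers : ∀ s t : ℕ, s ≤ t → t ≤ I.T → I.demand s t ≤ (I.covered X s t : ℤ)

/-- Optimal solutions: feasible solutions of minimum total cost. -/
def IsOptimal (X : Finset (Rect I.n)) : Prop :=
  I.IsFeasible X ∧ ∀ Y, I.IsFeasible Y → ∑ R ∈ X, I.cost R ≤ ∑ R ∈ Y, I.cost R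

/-! ### Input and output of an algorithm -/

/-- The input: the numbers `n`, `K`, `depth`, `leafLen`, followed by `r_j`, `p_j` for all jobs `j`,
followed by the costs of all rectangles in the order of `rects`. -/
def encode : List ℕ :=
  [I.n, I.K, I.depth, I.leafLen] ++ ((List.finRange I.n).flatMap fun j => [I.r j, I.p j]) ++
    I.rects.map I.cost

/-- The set of rectangles that is described by an output: the `i`-th rectangle of `rects` is
selected if and only if the `i`-th number of the output is nonzero. -/
noncomputable def selected (out : ℕ → ℕ) : Finset (Rect I.n) :=
  (Finset.univ.filter fun i : Fin I.rects.length => out i ≠ 0).image fun i => I.rects.get i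

end CoverInstance

/-!
The choices of prefixes for the groups of segments are optimized by a dynamic program over the
cells of the grid, and the program is executed on the machine.

*Demands as completion times.* Fix a time `t` and a set of rectangles, and delay every job released
until `t` whose rectangle at `t` is selected. The demands of the rays `L[s, t]` for all `s ≤ t` hold
if and only if the remaining jobs, executed without idling in the order of their release times, are
all completed until `t` (`not_late_run_iff`): the completion time is the maximum of `release j` plus
the processing times of `j` and its successors, over the remaining jobs `j` (`fold_spec`). So one
number per time `t` decides whether the demands at `t` hold, and it is computed by a pass over
the jobs in which each job updates it by `upd`. The completion time is represented by a job `j₀` and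
an amount of work `a`, as the number `j₀ * Q + a`, so that there are at most `n (n P + 1)` states,
independently of the release times.

*The dynamic program.* Instead of levels the proof uses heights, where the cells of level `ℓ` have
height `depth - ℓ`, so that the groups of a job have the heights `0, 1, …, depth` from left to
right. At a given time the height of the group of a job does not increase with its release time
(`lt_of_unsel`). Hence the pass over the jobs may go through the heights from `depth` down to `0`,
and through all jobs for each height (`run_fold`). Going down from a cell to its children, the
state is the same for all times of a segment, since all segments of a cell are unions of segments of
its children; and a cell has at most `K ^ 2` segments (`slots_le`). So `val` is a recursion on
cells, jobs and vectors of at most `K ^ 2` states, with a number of vectors polynomial in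
`(n P) ^ K ^ 2` (`B_pow_le`). Late times are not forbidden but penalized; as
selecting everything is feasible, a penalty that exceeds the sum of all weights makes the minimum
the weight of an optimal solution (`exists_weight_eq_optVal`).

*The solution from the value.* Only optimal values are computed, for the costs `c`, and for the
weights `2 ^ R * c i + 2 ^ i`, where `R` is the number of rectangles. The difference of the second
value and `2 ^ R` times the first one is the number whose binary digits flag the rectangles of an
optimal solution (`exists_optimal`).

*Running time.* `Ctx.Comp` says that a function of the data represented in the memory can be
evaluated in time polynomial in a base, which is `max 2 (n P) ^ K ^ 2`. Such functions are closed
under arithmetic, branches, and iterations with a polynomial number of rounds (`Ctx.Small`). The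
entries of the table of `val` are computed in this way from the preceding ones (`Reads.comp_val`,
`reach_withArr`).
-/

/-! ### Running time calculus -/

namespace RAM

theorem add_le_pow_of_le {b x y m k : ℕ} (hb : 2 ≤ b) (hx : x ≤ b ^ m) (hy : y ≤ b ^ k) :
    x + y ≤ b ^ (m + k + 1) := by
  have h1 : b ^ m ≤ b ^ (m + k) := Nat.pow_le_pow_right (by omega) (by omega)
  have h2 : b ^ k ≤ b ^ (m + k) := Nat.pow_le_pow_right (by omega) (by omega)
  calc x + y ≤ b ^ (m + k) * 2 := by omega
    _ ≤ b ^ (m + k + 1) := by rw [pow_succ]; exact Nat.mul_le_mul_left _ hb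

theorem mul_le_pow_of_le {b x y m k : ℕ} (hx : x ≤ b ^ m) (hy : y ≤ b ^ k) :
    x * y ≤ b ^ (m + k) := by
  rw [pow_add]; exact Nat.mul_le_mul hx hy

theorem const_le_pow {b : ℕ} (hb : 2 ≤ b) (c : ℕ) : c ≤ b ^ c :=
  (Nat.lt_two_pow_self).le.trans (Nat.pow_le_pow_left hb c)

/-- A loop whose `i`-th iteration leads from the invariant `Inv i` to `Inv (i + 1)`. -/
theorem Run.loop_of_invariant {e : Expr} {c : Cmd} {N T : ℕ} (Inv : ℕ → State → Prop)
    (step : ∀ i < N, ∀ σ, Inv i σ → e.eval σ ≠ 0 ∧ ∃ t τ, Run c σ t τ ∧ Inv (i + 1) τ ∧ t ≤ T)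
    (hend : ∀ σ, Inv N σ → e.eval σ = 0) (σ : State) (h0 : Inv 0 σ) :
    ∃ t τ, Run (.loop e c) σ t τ ∧ Inv N τ ∧ t ≤ (N + 1) * (T + e.steps + 1) := by
  have key : ∀ k i, i + k = N → ∀ σ, Inv i σ →
      ∃ t τ, Run (.loop e c) σ t τ ∧ Inv N τ ∧ t ≤ (k + 1) * (T + e.steps + 1) := by
    intro k
    induction k with
    | zero =>
      intro i hi σ hσ
      obtain rfl : i = N := by omega
      exact ⟨_, _, .loop_false (hend σ hσ), hσ, by omega⟩
    | succ k ih =>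
      intro i hi σ hσ
      obtain ⟨he, t, τ, hr, hτ, ht⟩ := step i (by omega) σ hσ
      obtain ⟨t', υ, hr', hυ, ht'⟩ := ih (i + 1) (by omega) τ hτ
      refine ⟨_, _, .loop_true he hr hr', hυ, ?_⟩
      have : (k + 1 + 1) * (T + e.steps + 1) = (k + 1) * (T + e.steps + 1) + (T + e.steps + 1) := by
        ring
      omega
  exact key N 0 (by omega) σ h0

/-- Two states agree on the registers below `k` and on all arrays. -/
def Agree (k : ℕ) (σ τ : State) : Prop :=
  (∀ i < k, τ.reg i = σ.reg i) ∧ τ.arr = σ.arr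

theorem Agree.trans {k : ℕ} {σ τ υ : State} (h : Agree k σ τ) (h' : Agree k τ υ) : Agree k σ υ :=
  ⟨fun i hi => (h'.1 i hi).trans (h.1 i hi), h'.2.trans h.2⟩

theorem Agree.mono {k l : ℕ} {σ τ : State} (h : Agree k σ τ) (hl : l ≤ k) : Agree l σ τ :=
  ⟨fun i hi => h.1 i (by omega), h.2⟩

theorem agree_setReg {k x v : ℕ} {σ : State} (h : k ≤ x) : Agree k σ (σ.setReg x v) :=
  ⟨fun i hi => by simp [State.setReg, Function.update_of_ne (show i ≠ x by omega)], rfl⟩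

@[simp] theorem setReg_reg_self (σ : State) (x v : ℕ) : (σ.setReg x v).reg x = v := by
  simp [State.setReg]

theorem setReg_reg_of_ne (σ : State) {x y : ℕ} (v : ℕ) (h : y ≠ x) :
    (σ.setReg x v).reg y = σ.reg y := by
  simp [State.setReg, h]

/-- A context: what a piece of a program may assume about the state. The type `α` holds the
mathematical objects that the state represents (the instance, and the values of the loop variables),
`dom` restricts them, and `rel a σ` says that `σ` represents `a` in the registers below `size` and
in the arrays. Running times and ranges of loops are measured in powers of `base a`. -/
structure Ctx (α : Type) where
  size : ℕ
  dom : α → Prop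
  base : α → ℕ
  rel : α → State → Prop
  two_le : ∀ a, dom a → 2 ≤ base a
  stable : ∀ a σ τ, rel a σ → Agree size σ τ → rel a τ

namespace Ctx

variable {α β : Type}

/-- The function `f` of the objects of the context can be evaluated into any register `r` outside
the context in time polynomial in `Γ.base`, without changing the registers below `r` or the
arrays. -/
def Comp (Γ : Ctx α) (f : α → ℕ) : Prop :=
  ∀ r, Γ.size ≤ r → ∃ (c : Cmd) (e : ℕ), ∀ a σ, Γ.dom a → Γ.rel a σ →
    ∃ t τ, Run c σ t τ ∧ τ.reg r = f a ∧ Agree r σ τ ∧ t ≤ Γ.base a ^ e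

/-- `f` is bounded by a power of `Γ.base`. -/
def Bdd (Γ : Ctx α) (f : α → ℕ) : Prop :=
  ∃ e, ∀ a, Γ.dom a → f a ≤ Γ.base a ^ e

/-- Functions that can be evaluated and have polynomially bounded values, so that they can serve as
ranges of loops. -/
def Small (Γ : Ctx α) (f : α → ℕ) : Prop := Γ.Comp f ∧ Γ.Bdd f

/-- The context restricted by a condition on its objects. -/
def restrict (Γ : Ctx α) (P : α → Prop) : Ctx α where
  size := Γ.size
  dom a := Γ.dom a ∧ P a
  base := Γ.base
  rel := Γ.rel
  two_le a h := Γ.two_le a h.1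
  stable := Γ.stable

/-- The context extended by a variable, subject to the condition `P`, in the register
`Γ.size + s`. The offset `s` makes room for intermediate results of the surrounding program; the
programs for a body have to exist for every offset. -/
def ext (Γ : Ctx α) (s : ℕ) (P : α → ℕ → Prop) : Ctx (α × ℕ) where
  size := Γ.size + s + 1
  dom x := Γ.dom x.1 ∧ P x.1 x.2
  base x := Γ.base x.1
  rel x σ := Γ.rel x.1 σ ∧ σ.reg (Γ.size + s) = x.2
  two_le x h := Γ.two_le x.1 h.1
  stable x σ τ h ha := ⟨Γ.stable _ _ _ h.1 (ha.mono (by omega)), by rw [ha.1 _ (by omega), h.2]⟩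

/-- The context of the body of an iteration: the register `Γ.size + s` holds the accumulator and the
register `Γ.size + s + 2` the counter, both subject to the condition `P`. -/
def extIter (Γ : Ctx α) (s : ℕ) (P : α → ℕ → ℕ → Prop) : Ctx ((α × ℕ) × ℕ) where
  size := Γ.size + s + 3
  dom x := Γ.dom x.1.1 ∧ P x.1.1 x.1.2 x.2
  base x := Γ.base x.1.1
  rel x σ := Γ.rel x.1.1 σ ∧ σ.reg (Γ.size + s + 2) = x.1.2 ∧ σ.reg (Γ.size + s) = x.2
  two_le x h := Γ.two_le x.1.1 h.1
  stable x σ τ h ha := ⟨Γ.stable _ _ _ h.1 (ha.mono (by omega)),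
    by rw [ha.1 _ (by omega), h.2.1], by rw [ha.1 _ (by omega), h.2.2]⟩

variable {Γ : Ctx α} {Δ : Ctx β} {f g : α → ℕ}

theorem Comp.congr (hf : Γ.Comp f) (h : ∀ a, Γ.dom a → g a = f a) : Γ.Comp g := by
  intro r hr
  obtain ⟨c, e, H⟩ := hf r hr
  refine ⟨c, e, fun a σ ha hσ => ?_⟩
  rw [h a ha]; exact H a σ ha hσ

theorem Bdd.mono (hf : Γ.Bdd f) (h : ∀ a, Γ.dom a → g a ≤ f a) : Γ.Bdd g := by
  obtain ⟨e, H⟩ := hf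
  exact ⟨e, fun a ha => (h a ha).trans (H a ha)⟩

/-- A function that can be evaluated in `Γ` can be evaluated in every context `Δ` whose states
represent, among others, the objects of `Γ`. -/
theorem Comp.reindex (hf : Γ.Comp f) (h : β → α) (hs : Γ.size ≤ Δ.size)
    (hd : ∀ b, Δ.dom b → Γ.dom (h b)) (hb : ∀ b, Δ.base b = Γ.base (h b))
    (hr : ∀ b σ, Δ.rel b σ → Γ.rel (h b) σ) : Δ.Comp (fun b => f (h b)) := by
  intro r hr'
  obtain ⟨c, e, H⟩ := hf r (hs.trans hr')
  exact ⟨c, e, fun b σ hb' hσ => by rw [hb]; exact H (h b) σ (hd b hb') (hr b σ hσ)⟩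

theorem Bdd.reindex (hf : Γ.Bdd f) (h : β → α)
    (hd : ∀ b, Δ.dom b → Γ.dom (h b)) (hb : ∀ b, Δ.base b = Γ.base (h b)) :
    Δ.Bdd (fun b => f (h b)) := by
  obtain ⟨e, H⟩ := hf
  exact ⟨e, fun b hb' => by rw [hb]; exact H (h b) (hd b hb')⟩

theorem Small.reindex (hf : Γ.Small f) (h : β → α) (hs : Γ.size ≤ Δ.size)
    (hd : ∀ b, Δ.dom b → Γ.dom (h b)) (hb : ∀ b, Δ.base b = Γ.base (h b))
    (hr : ∀ b σ, Δ.rel b σ → Γ.rel (h b) σ) : Δ.Small (fun b => f (h b)) :=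
  ⟨hf.1.reindex h hs hd hb hr, hf.2.reindex h hd hb⟩

theorem Comp.restrict (hf : Γ.Comp f) (P : α → Prop) : (Γ.restrict P).Comp f :=
  hf.reindex id le_rfl (fun _ h => h.1) (fun _ => rfl) (fun _ _ h => h)

theorem Small.restrict (hf : Γ.Small f) (P : α → Prop) : (Γ.restrict P).Small f :=
  hf.reindex id le_rfl (fun _ h => h.1) (fun _ => rfl) (fun _ _ h => h)

theorem Comp.ext (hf : Γ.Comp f) {s : ℕ} {P : α → ℕ → Prop} :
    (Γ.ext s P).Comp (fun x => f x.1) :=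
  hf.reindex Prod.fst (by simp only [Ctx.ext]; omega) (fun _ h => h.1) (fun _ => rfl)
    (fun _ _ h => h.1)

theorem Small.ext (hf : Γ.Small f) {s : ℕ} {P : α → ℕ → Prop} :
    (Γ.ext s P).Small (fun x => f x.1) :=
  hf.reindex Prod.fst (by simp only [Ctx.ext]; omega) (fun _ h => h.1) (fun _ => rfl)
    (fun _ _ h => h.1)

theorem Comp.extIter (hf : Γ.Comp f) {s : ℕ} {P : α → ℕ → ℕ → Prop} :
    (Γ.extIter s P).Comp (fun x => f x.1.1) :=
  hf.reindex (fun x : (α × ℕ) × ℕ => x.1.1) (by simp only [Ctx.extIter]; omega)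
    (fun _ h => h.1) (fun _ => rfl) (fun _ _ h => h.1)

theorem comp_var {k : ℕ} (h : ∀ a σ, Γ.dom a → Γ.rel a σ → σ.reg k = f a) : Γ.Comp f := by
  intro r hr
  refine ⟨.assign r (.var k), 2, fun a σ ha hσ =>
    ⟨_, _, .assign σ r _, ?_, agree_setReg le_rfl, ?_⟩⟩
  · simp [Expr.eval, h a σ ha hσ]
  · simpa [Expr.steps] using const_le_pow (Γ.two_le a ha) 2

theorem comp_ext_var {s : ℕ} {P : α → ℕ → Prop} : (Γ.ext s P).Comp (fun x => x.2) :=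
  comp_var (k := Γ.size + s) fun _ _ _ h => h.2

theorem comp_extIter_acc {s : ℕ} {P : α → ℕ → ℕ → Prop} : (Γ.extIter s P).Comp (fun x => x.2) :=
  comp_var (k := Γ.size + s) fun _ _ _ h => h.2.2

theorem comp_const (n : ℕ) : Γ.Comp (fun _ => n) := by
  intro r hr
  refine ⟨.assign r (.lit n), 2, fun a σ ha hσ =>
    ⟨_, _, .assign σ r _, ?_, agree_setReg le_rfl, ?_⟩⟩
  · simp [Expr.eval]
  · simpa [Expr.steps] using const_le_pow (Γ.two_le a ha) 2

theorem small_const (n : ℕ) : Γ.Small (fun _ => n) :=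
  ⟨comp_const n, n, fun a ha => const_le_pow (Γ.two_le a ha) n⟩

/-- Evaluation of a unary operation that is given by an expression. -/
theorem Comp.op (hf : Γ.Comp f) {h : α → ℕ} (E : ℕ → Expr)
    (hE : ∀ r a σ, Γ.dom a → Γ.rel a σ → σ.reg r = f a → (E r).eval σ = h a) : Γ.Comp h := by
  intro r hr
  obtain ⟨c, e, H⟩ := hf r hr
  refine ⟨.seq c (.assign r (E r)), e + ((E r).steps + 1) + 1, fun a σ ha hσ => ?_⟩
  obtain ⟨t, τ, hrun, hv, hag, ht⟩ := H a σ ha hσ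
  refine ⟨_, _, .seq hrun (.assign τ r _), ?_, hag.trans (agree_setReg le_rfl),
    add_le_pow_of_le (Γ.two_le a ha) ht (const_le_pow (Γ.two_le a ha) _)⟩
  simpa using hE r a τ ha (Γ.stable _ _ _ hσ (hag.mono hr)) hv

/-- The function `F` of two arguments can be evaluated at the value of `g`, which is bound to a new
variable. -/
theorem Comp.bind {P : α → ℕ → Prop} {F : α × ℕ → ℕ} (hg : Γ.Comp g)
    (hF : ∀ s, (Γ.ext s P).Comp F) (hP : ∀ a, Γ.dom a → P a (g a)) :
    Γ.Comp (fun a => F (a, g a)) := by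
  intro r hr
  obtain ⟨c, e, H⟩ := hg r hr
  obtain ⟨s, rfl⟩ := Nat.exists_eq_add_of_le hr
  obtain ⟨c', e', H'⟩ := hF s (Γ.size + s + 1) le_rfl
  refine ⟨.seq c (.seq c' (.assign (Γ.size + s) (.var (Γ.size + s + 1)))),
    e + (e' + 2 + 1) + 1, fun a σ ha hσ => ?_⟩
  have hb := Γ.two_le a ha
  obtain ⟨t, τ, hrun, hv, hag, ht⟩ := H a σ ha hσ
  obtain ⟨t', τ', hrun', hv', hag', ht'⟩ := H' (a, g a) τ ⟨ha, hP a ha⟩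
    ⟨Γ.stable _ _ _ hσ (hag.mono hr), hv⟩
  refine ⟨_, _, .seq hrun (.seq hrun' (.assign τ' _ _)), ?_,
    (hag.trans (hag'.mono (by omega))).trans (agree_setReg le_rfl),
    add_le_pow_of_le hb ht (add_le_pow_of_le hb ht' (const_le_pow hb _))⟩
  simpa [Expr.eval] using hv'

theorem Comp.op₂ (hf : Γ.Comp f) (hg : Γ.Comp g) {h : α → ℕ} (E : ℕ → ℕ → Expr)
    (hE : ∀ r r' a σ, Γ.dom a → Γ.rel a σ → σ.reg r = f a → σ.reg r' = g a →
      (E r r').eval σ = h a) : Γ.Comp h := by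
  have : ∀ s, (Γ.ext s (fun a v => v = f a)).Comp (fun x => h x.1) := by
    intro s
    refine (hg.ext).op (fun r => E (Γ.size + s) r) fun r x σ hx hσ hr => ?_
    exact hE _ _ x.1 σ hx.1 hσ.1 (hσ.2.trans hx.2) hr
  exact hf.bind this fun _ _ => rfl

theorem Comp.add (hf : Γ.Comp f) (hg : Γ.Comp g) : Γ.Comp (fun a => f a + g a) :=
  hf.op₂ hg (fun r r' => .add (.var r) (.var r')) fun r r' a σ _ _ h h' => by
    simp [Expr.eval, h, h']

theorem Comp.sub (hf : Γ.Comp f) (hg : Γ.Comp g) : Γ.Comp (fun a => f a - g a) :=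
  hf.op₂ hg (fun r r' => .sub (.var r) (.var r')) fun r r' a σ _ _ h h' => by
    simp [Expr.eval, h, h']

/-- An entry of an array can be read if its index can be evaluated. -/
theorem Comp.get (b : ℕ) {A : α → ℕ → ℕ} (hf : Γ.Comp f)
    (h : ∀ a σ, Γ.dom a → Γ.rel a σ → σ.arr b (f a) = A a (f a)) :
    Γ.Comp (fun a => A a (f a)) :=
  hf.op (fun r => .get b (.var r)) fun r a σ ha hσ hr => by simp [Expr.eval, hr, h a σ ha hσ]

theorem Comp.ite_ne_zero {c : α → ℕ} (hc : Γ.Comp c) (hf : (Γ.restrict (fun a => c a ≠ 0)).Comp f)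
    (hg : (Γ.restrict (fun a => c a = 0)).Comp g) :
    Γ.Comp (fun a => if c a ≠ 0 then f a else g a) := by
  intro r hr
  obtain ⟨c0, e0, H0⟩ := hc r hr
  obtain ⟨c1, e1, H1⟩ := hf r hr
  obtain ⟨c2, e2, H2⟩ := hg r hr
  refine ⟨.seq c0 (.branch (.var r) c1 c2), e0 + (2 + (e1 + e2) + 1) + 1, fun a σ ha hσ => ?_⟩
  have hb := Γ.two_le a ha
  obtain ⟨t, τ, hrun, hv, hag, ht⟩ := H0 a σ ha hσ
  have hτ := Γ.stable _ _ _ hσ (hag.mono hr)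
  by_cases h : c a = 0
  · obtain ⟨t', τ', hrun', hv', hag', ht'⟩ := H2 a τ ⟨ha, h⟩ hτ
    refine ⟨_, _, .seq hrun (.branch_false (by simp [Expr.eval, hv, h]) hrun'), by simp [h, hv'],
      hag.trans hag', add_le_pow_of_le hb ht (add_le_pow_of_le hb (const_le_pow hb 2)
        (ht'.trans (Nat.pow_le_pow_right (by change 1 ≤ Γ.base a; omega) (by omega))))⟩
  · obtain ⟨t', τ', hrun', hv', hag', ht'⟩ := H1 a τ ⟨ha, h⟩ hτ
    refine ⟨_, _, .seq hrun (.branch_true (by simp [Expr.eval, hv, h]) hrun'), by simp [h, hv'],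
      hag.trans hag', add_le_pow_of_le hb ht (add_le_pow_of_le hb (const_le_pow hb 2)
        (ht'.trans (Nat.pow_le_pow_right (by change 1 ≤ Γ.base a; omega) (by omega))))⟩

/-- Bounded iteration. The body may assume that the accumulator is the result of the preceding
iterations, which is how bounds on the intermediate values become available to it. -/
theorem Comp.iter {z : α → ℕ} {body : α → ℕ → ℕ → ℕ} {cnt : α → ℕ} (hz : Γ.Comp z)
    (hcnt : Γ.Small cnt)
    (hbody : ∀ s, (Γ.extIter s (fun a i v => i < cnt a ∧ v = Nat.rec (z a) (body a) i)).Comp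
      (fun x => body x.1.1 x.1.2 x.2)) :
    Γ.Comp (fun a => Nat.rec (z a) (body a) (cnt a)) := by
  intro r hr
  obtain ⟨s, rfl⟩ := Nat.exists_eq_add_of_le hr
  obtain ⟨cz, ez, Hz⟩ := hz (Γ.size + s) hr
  obtain ⟨cc, ec, Hc⟩ := hcnt.1 (Γ.size + s + 1) (by omega)
  obtain ⟨cb, eb, Hb⟩ := hbody s (Γ.size + s + 3) le_rfl
  obtain ⟨en, Hn⟩ := hcnt.2
  set R := Γ.size + s with hR
  refine ⟨.seq cz (.seq cc (.seq (.assign (R + 2) (.lit 0))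
    (.loop (.sub (.var (R + 1)) (.var (R + 2)))
      (.seq cb (.seq (.assign R (.var (R + 3)))
        (.assign (R + 2) (.add (.var (R + 2)) (.lit 1)))))))),
    ez + (ec + (2 + (en + 1 + 1 + (eb + 6 + 1 + 3 + 1 + 1 + 1)) + 1) + 1) + 1, fun a σ ha hσ => ?_⟩
  have hb := Γ.two_le a ha
  obtain ⟨t, τ, hrun, hv, hag, ht⟩ := Hz a σ ha hσ
  have hτ := Γ.stable _ _ _ hσ (hag.mono hr)
  obtain ⟨t', τ', hrun', hv', hag', ht'⟩ := Hc a τ ha hτ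
  have hτ' := Γ.stable _ _ _ hτ (hag'.mono (by omega))
  let Inv : ℕ → State → Prop := fun i υ => Agree R σ υ ∧ υ.reg R = Nat.rec (z a) (body a) i ∧
    υ.reg (R + 1) = cnt a ∧ υ.reg (R + 2) = i
  have hT := add_le_pow_of_le hb (add_le_pow_of_le hb (le_refl (Γ.base a ^ (eb + 6 + 1)))
    (const_le_pow hb 3)) (const_le_pow hb 1)
  have hloop := Run.loop_of_invariant
    (e := .sub (.var (R + 1)) (.var (R + 2)))
    (c := .seq cb (.seq (.assign R (.var (R + 3)))
        (.assign (R + 2) (.add (.var (R + 2)) (.lit 1)))))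
    (N := cnt a) (T := Γ.base a ^ (eb + 6 + 1)) Inv
  obtain ⟨t'', τ'', hrun'', hI, ht''⟩ : ∃ t'' τ'',
      Run _ (τ'.setReg (R + 2) 0) t'' τ'' ∧ Inv (cnt a) τ'' ∧ _ := by
    refine hloop ?_ ?_ _ ?_
    · rintro i hi υ ⟨h1, h2, h3, h4⟩
      refine ⟨by simp only [Expr.eval, h3, h4]; omega, ?_⟩
      obtain ⟨tb, υ', hrb, hvb, hagb, htb⟩ := Hb ((a, i), υ.reg R) υ ⟨ha, hi, h2⟩
        ⟨Γ.stable _ _ _ hσ (h1.mono hr), h4, rfl⟩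
      refine ⟨_, _, .seq hrb (.seq (.assign _ _ _) (.assign _ _ _)), ⟨?_, ?_, ?_, ?_⟩, ?_⟩
      · exact ((h1.trans (hagb.mono (by omega))).trans (agree_setReg le_rfl)).trans
          (agree_setReg (by omega))
      · rw [setReg_reg_of_ne _ _ (by omega), setReg_reg_self]
        simp only [Expr.eval, hvb, h2]
      · rw [setReg_reg_of_ne _ _ (by omega), setReg_reg_of_ne _ _ (by omega),
          hagb.1 _ (by omega), h3]
      · rw [setReg_reg_self]
        simp only [Expr.eval]
        rw [setReg_reg_of_ne _ _ (by omega), hagb.1 _ (by omega), h4]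
      · exact add_le_pow_of_le hb htb (const_le_pow hb 6)
    · rintro υ ⟨-, -, h3, h4⟩
      simp only [Expr.eval, h3, h4]; omega
    · refine ⟨(hag.trans (hag'.mono (by omega))).trans (agree_setReg (by omega)), ?_, ?_,
        setReg_reg_self _ _ _⟩
      · rw [setReg_reg_of_ne _ _ (by omega), hag'.1 _ (by omega), hv]
        rfl
      · rw [setReg_reg_of_ne _ _ (by omega), hv']
  refine ⟨_, _, .seq hrun (.seq hrun' (.seq (.assign _ _ _) hrun'')), hI.2.1, hI.1,
    add_le_pow_of_le hb ht (add_le_pow_of_le hb ht' (add_le_pow_of_le hb (const_le_pow hb 2)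
      (ht''.trans (mul_le_pow_of_le (add_le_pow_of_le hb (Hn a ha) (const_le_pow hb 1))
        hT))))⟩

/-- The context of the body of a loop that fills the array `b` with the values of `A` from left to
right: the entries below the loop variable are already there. -/
def extFill (Γ : Ctx α) (b : ℕ) (A : α → ℕ → ℕ) (len : α → ℕ) : Ctx (α × ℕ) where
  size := Γ.size + 2
  dom x := Γ.dom x.1 ∧ x.2 < len x.1
  base x := Γ.base x.1
  rel x σ := Γ.rel x.1 σ ∧ σ.reg (Γ.size + 1) = x.2 ∧ ∀ i < x.2, σ.arr b i = A x.1 i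
  two_le x h := Γ.two_le x.1 h.1
  stable x σ τ h ha := ⟨Γ.stable _ _ _ h.1 (ha.mono (by omega)),
    by rw [ha.1 _ (by omega), h.2.1], by rw [ha.2]; exact h.2.2⟩

/-- The context extended by an array `b` that holds the values of `A`. -/
def withArr (Γ : Ctx α) (b : ℕ) (A : α → ℕ → ℕ) (len : α → ℕ) : Ctx α where
  size := Γ.size
  dom := Γ.dom
  base := Γ.base
  rel a σ := Γ.rel a σ ∧ ∀ i < len a, σ.arr b i = A a i
  two_le := Γ.two_le
  stable a σ τ h ha := ⟨Γ.stable _ _ _ h.1 ha, by rw [ha.2]; exact h.2⟩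

/-- The states of the context may hold anything in the array `b`, and in the registers from
`Γ.size` on. -/
def Indep (Γ : Ctx α) (b : ℕ) : Prop :=
  ∀ a σ τ, Γ.rel a σ → (∀ i < Γ.size, τ.reg i = σ.reg i) → (∀ b' ≠ b, τ.arr b' = σ.arr b') →
    Γ.rel a τ

/-- A program leads from the states of `Γ` to those of `Δ` in polynomial time. -/
def Reach (Γ Δ : Ctx α) : Prop :=
  ∃ (c : Cmd) (e : ℕ), ∀ a σ, Γ.dom a → Γ.rel a σ →
    ∃ t τ, Run c σ t τ ∧ Δ.rel a τ ∧ t ≤ Γ.base a ^ e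

theorem Reach.trans {Γ Δ Θ : Ctx α} (h : Γ.Reach Δ) (h' : Δ.Reach Θ) (hd : ∀ a, Γ.dom a → Δ.dom a)
    (hb : ∀ a, Δ.base a = Γ.base a) : Γ.Reach Θ := by
  obtain ⟨c, e, H⟩ := h
  obtain ⟨c', e', H'⟩ := h'
  refine ⟨.seq c c', e + e' + 1, fun a σ ha hσ => ?_⟩
  obtain ⟨t, τ, hrun, hτ, ht⟩ := H a σ ha hσ
  obtain ⟨t', τ', hrun', hτ', ht'⟩ := H' a τ (hd a ha) hτ
  rw [hb] at ht'
  exact ⟨_, _, .seq hrun hrun', hτ', add_le_pow_of_le (Γ.two_le a ha) ht ht'⟩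

/-- An array is filled from left to right if its entries can be evaluated from the preceding
ones. -/
theorem reach_withArr {b : ℕ} {A : α → ℕ → ℕ} {len : α → ℕ} (hi : Γ.Indep b) (hlen : Γ.Small len)
    (hA : (Γ.extFill b A len).Comp (fun x => A x.1 x.2)) : Γ.Reach (Γ.withArr b A len) := by
  obtain ⟨cc, ec, Hc⟩ := hlen.1 Γ.size le_rfl
  obtain ⟨cb, eb, Hb⟩ := hA (Γ.size + 2) le_rfl
  obtain ⟨en, Hn⟩ := hlen.2
  set R := Γ.size with hR
  refine ⟨.seq cc (.seq (.assign (R + 1) (.lit 0))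
    (.loop (.sub (.var R) (.var (R + 1)))
      (.seq cb (.seq (.put b (.var (R + 1)) (.var (R + 2)))
        (.assign (R + 1) (.add (.var (R + 1)) (.lit 1))))))),
    ec + (2 + (en + 1 + 1 + (eb + 7 + 1 + 3 + 1 + 1 + 1)) + 1) + 1, fun a σ ha hσ => ?_⟩
  have hb := Γ.two_le a ha
  obtain ⟨t, τ, hrun, hv, hag, ht⟩ := Hc a σ ha hσ
  have hτ := Γ.stable _ _ _ hσ hag
  let Inv : ℕ → State → Prop := fun i υ => Γ.rel a υ ∧ υ.reg R = len a ∧ υ.reg (R + 1) = i ∧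
    ∀ k < i, υ.arr b k = A a k
  have hT := add_le_pow_of_le hb (add_le_pow_of_le hb (le_refl (Γ.base a ^ (eb + 7 + 1)))
    (const_le_pow hb 3)) (const_le_pow hb 1)
  have hloop := Run.loop_of_invariant
    (e := .sub (.var R) (.var (R + 1)))
    (c := .seq cb (.seq (.put b (.var (R + 1)) (.var (R + 2)))
        (.assign (R + 1) (.add (.var (R + 1)) (.lit 1)))))
    (N := len a) (T := Γ.base a ^ (eb + 7 + 1)) Inv
  obtain ⟨t'', τ'', hrun'', hI, ht''⟩ : ∃ t'' τ'',
      Run _ (τ.setReg (R + 1) 0) t'' τ'' ∧ Inv (len a) τ'' ∧ _ := by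
    refine hloop ?_ ?_ _ ?_
    · rintro i hil υ ⟨h1, h2, h3, h4⟩
      refine ⟨by simp only [Expr.eval, h2, h3]; omega, ?_⟩
      obtain ⟨tb, υ', hrb, hvb, hagb, htb⟩ := Hb (a, i) υ ⟨ha, hil⟩ ⟨h1, h3, h4⟩
      refine ⟨_, _, .seq hrb (.seq (.put _ _ _ _) (.assign _ _ _)), ⟨?_, ?_, ?_, ?_⟩, ?_⟩
      · refine hi a υ _ h1 (fun k hk => ?_) (fun b' hb' => ?_)
        · rw [setReg_reg_of_ne _ _ (by omega)]
          exact hagb.1 k (by omega)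
        · simp [State.setReg, State.setArr, hb', hagb.2]
      · rw [setReg_reg_of_ne _ _ (by omega)]
        exact (hagb.1 _ (by omega)).trans h2
      · rw [setReg_reg_self]
        have : υ'.reg (R + 1) = i := (hagb.1 _ (by omega)).trans h3
        simp [Expr.eval, State.setArr, this]
      · intro k hk
        have h5 : υ'.reg (R + 1) = i := (hagb.1 _ (by omega)).trans h3
        simp only [State.setReg, State.setArr, Expr.eval, h5, hvb, Function.update_self]
        by_cases hki : k = i
        · subst hki; simp
        · rw [Function.update_of_ne hki, hagb.2]
          exact h4 k (by omega)
      · exact add_le_pow_of_le hb htb (const_le_pow hb 7)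
    · rintro υ ⟨-, h2, h3, -⟩
      simp only [Expr.eval, h2, h3]; omega
    · refine ⟨Γ.stable _ _ _ hτ (agree_setReg (by omega)), ?_, setReg_reg_self _ _ _,
        fun k hk => absurd hk (by omega)⟩
      rw [setReg_reg_of_ne _ _ (by omega), hv]
  exact ⟨_, _, .seq hrun (.seq (.assign _ _ _) hrun''), ⟨hI.1, hI.2.2.2⟩,
    add_le_pow_of_le hb ht (add_le_pow_of_le hb (const_le_pow hb 2)
      (ht''.trans (mul_le_pow_of_le (add_le_pow_of_le hb (Hn a ha) (const_le_pow hb 1))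
        hT)))⟩

end Ctx

end RAM

/-! ### Arithmetic on the machine -/

/-- The minimum of `f 0, …, f c`. -/
def minUpTo (f : ℕ → ℕ) (c : ℕ) : ℕ := Nat.rec (f 0) (fun i v => min v (f (i + 1))) c

theorem minUpTo_le {f : ℕ → ℕ} {c i : ℕ} (h : i ≤ c) : minUpTo f c ≤ f i := by
  induction c with
  | zero => obtain rfl : i = 0 := by omega
            exact le_rfl
  | succ c ih =>
    rcases Nat.lt_or_eq_of_le h with h | rfl
    · exact (min_le_left _ _).trans (ih (by omega))
    · exact min_le_right _ _

theorem exists_minUpTo_eq (f : ℕ → ℕ) (c : ℕ) : ∃ i ≤ c, minUpTo f c = f i := by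
  induction c with
  | zero => exact ⟨0, le_rfl, rfl⟩
  | succ c ih =>
    obtain ⟨i, hi, h⟩ := ih
    rcases min_choice (minUpTo f c) (f (c + 1)) with h' | h'
    · exact ⟨i, by omega, h'.trans h⟩
    · exact ⟨c + 1, le_rfl, h'⟩

namespace RAM.Ctx

variable {α β : Type} {Γ : Ctx α} {f g : α → ℕ}

theorem Bdd.add (hf : Γ.Bdd f) (hg : Γ.Bdd g) : Γ.Bdd (fun a => f a + g a) := by
  obtain ⟨m, hf⟩ := hf
  obtain ⟨k, hg⟩ := hg
  exact ⟨_, fun a ha => add_le_pow_of_le (Γ.two_le a ha) (hf a ha) (hg a ha)⟩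

theorem Bdd.mul (hf : Γ.Bdd f) (hg : Γ.Bdd g) : Γ.Bdd (fun a => f a * g a) := by
  obtain ⟨m, hf⟩ := hf
  obtain ⟨k, hg⟩ := hg
  exact ⟨_, fun a ha => mul_le_pow_of_le (hf a ha) (hg a ha)⟩

theorem Bdd.pow_const (hf : Γ.Bdd f) (n : ℕ) : Γ.Bdd (fun a => f a ^ n) := by
  obtain ⟨m, hf⟩ := hf
  refine ⟨m * n, fun a ha => ?_⟩
  rw [pow_mul]
  exact Nat.pow_le_pow_left (hf a ha) n

theorem Small.add (hf : Γ.Small f) (hg : Γ.Small g) : Γ.Small (fun a => f a + g a) :=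
  ⟨hf.1.add hg.1, hf.2.add hg.2⟩

theorem Small.sub (hf : Γ.Small f) (hg : Γ.Small g) : Γ.Small (fun a => f a - g a) :=
  ⟨hf.1.sub hg.1, hf.2.mono fun _ _ => Nat.sub_le _ _⟩

theorem Comp.ite {p : α → Prop} [DecidablePred p] {c : α → ℕ} (hc : Γ.Comp c)
    (hp : ∀ a, Γ.dom a → (p a ↔ c a ≠ 0)) (hf : (Γ.restrict p).Comp f)
    (hg : (Γ.restrict fun a => ¬ p a).Comp g) : Γ.Comp (fun a => if p a then f a else g a) := by
  refine (hc.ite_ne_zero (hf.reindex id le_rfl ?_ (fun _ => rfl) fun _ _ h => h)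
    (hg.reindex id le_rfl ?_ (fun _ => rfl) fun _ _ h => h)).congr ?_
  · exact fun a h => ⟨h.1, (hp a h.1).2 h.2⟩
  · exact fun a h => ⟨h.1, fun h' => (hp a h.1).1 h' h.2⟩
  · intro a ha
    simp only [hp a ha]
    rfl

theorem Comp.ite_le {x y : α → ℕ} (hx : Γ.Comp x) (hy : Γ.Comp y)
    (hf : (Γ.restrict fun a => x a ≤ y a).Comp f) (hg : (Γ.restrict fun a => ¬ x a ≤ y a).Comp g) :
    Γ.Comp (fun a => if x a ≤ y a then f a else g a) :=
  Comp.ite ((hy.add (comp_const 1)).sub hx) (fun a _ => by omega) hf hg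

theorem Comp.ite_lt {x y : α → ℕ} (hx : Γ.Comp x) (hy : Γ.Comp y)
    (hf : (Γ.restrict fun a => x a < y a).Comp f) (hg : (Γ.restrict fun a => ¬ x a < y a).Comp g) :
    Γ.Comp (fun a => if x a < y a then f a else g a) :=
  Comp.ite (hy.sub hx) (fun a _ => by omega) hf hg

theorem Comp.ite_eq {x y : α → ℕ} (hx : Γ.Comp x) (hy : Γ.Comp y)
    (hf : (Γ.restrict fun a => x a = y a).Comp f) (hg : (Γ.restrict fun a => ¬ x a = y a).Comp g) :
    Γ.Comp (fun a => if x a = y a then f a else g a) :=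
  Comp.ite ((comp_const 1).sub ((hx.sub hy).add (hy.sub hx))) (fun a _ => by omega) hf hg

theorem Bdd.ite {p : α → Prop} [DecidablePred p] (hf : (Γ.restrict p).Bdd f)
    (hg : (Γ.restrict fun a => ¬ p a).Bdd g) : Γ.Bdd (fun a => if p a then f a else g a) := by
  obtain ⟨m, hf⟩ := hf
  obtain ⟨k, hg⟩ := hg
  refine ⟨m + k, fun a ha => ?_⟩
  have hb : 1 ≤ Γ.base a := (Γ.two_le a ha).trans' (by omega)
  by_cases h : p a
  · simpa [h] using (hf a ⟨ha, h⟩).trans (Nat.pow_le_pow_right hb (by omega))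
  · simpa [h] using (hg a ⟨ha, h⟩).trans (Nat.pow_le_pow_right hb (by omega))

theorem Small.ite_le {x y : α → ℕ} (hx : Γ.Comp x) (hy : Γ.Comp y)
    (hf : (Γ.restrict fun a => x a ≤ y a).Small f)
    (hg : (Γ.restrict fun a => ¬ x a ≤ y a).Small g) :
    Γ.Small (fun a => if x a ≤ y a then f a else g a) :=
  ⟨.ite_le hx hy hf.1 hg.1, .ite hf.2 hg.2⟩

theorem Small.ite_lt {x y : α → ℕ} (hx : Γ.Comp x) (hy : Γ.Comp y)
    (hf : (Γ.restrict fun a => x a < y a).Small f)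
    (hg : (Γ.restrict fun a => ¬ x a < y a).Small g) :
    Γ.Small (fun a => if x a < y a then f a else g a) :=
  ⟨.ite_lt hx hy hf.1 hg.1, .ite hf.2 hg.2⟩

theorem Comp.min (hf : Γ.Comp f) (hg : Γ.Comp g) : Γ.Comp (fun a => Min.min (f a) (g a)) :=
  (Comp.ite_le hf hg (hf.restrict _) (hg.restrict _)).congr fun _ _ => min_def _ _

theorem Small.min (hf : Γ.Small f) (hg : Γ.Small g) : Γ.Small (fun a => Min.min (f a) (g a)) :=
  ⟨hf.1.min hg.1, hf.2.mono fun _ _ => min_le_left _ _⟩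

theorem small_ext_var {s : ℕ} {P : α → ℕ → Prop} (hg : Γ.Bdd g)
    (h : ∀ a i, Γ.dom a → P a i → i ≤ g a) : (Γ.ext s P).Small (fun x => x.2) := by
  obtain ⟨e, he⟩ := hg
  exact ⟨comp_ext_var, e, fun x hx => (h _ _ hx.1 hx.2).trans (he _ hx.1)⟩

/-- A function of the counter of an iteration, in the context of its body. -/
theorem Comp.toIter {F : α × ℕ → ℕ} {P : α → ℕ → Prop} {P' : α → ℕ → ℕ → Prop}
    (hF : ∀ s, (Γ.ext s P).Comp F) (hP : ∀ a i v, Γ.dom a → P' a i v → P a i) (s : ℕ) :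
    (Γ.extIter s P').Comp (fun x => F x.1) :=
  (hF (s + 2)).reindex (fun x : (α × ℕ) × ℕ => x.1) (by simp only [Ctx.ext, Ctx.extIter]; omega)
    (fun _ h => ⟨h.1, hP _ _ _ h.1 h.2⟩) (fun _ => rfl) (fun _ _ h => ⟨h.1, h.2.1⟩)

theorem Comp.sum {F : α × ℕ → ℕ} {cnt : α → ℕ} (hcnt : Γ.Small cnt)
    (hF : ∀ s, (Γ.ext s fun a i => i < cnt a).Comp F) :
    Γ.Comp (fun a => ∑ i ∈ Finset.range (cnt a), F (a, i)) := by
  refine ((comp_const 0).iter (body := fun a i v => v + F (a, i)) hcnt fun s =>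
    comp_extIter_acc.add (Comp.toIter hF (fun _ _ _ _ h => h.1) s)).congr fun a _ => ?_
  induction cnt a with
  | zero => rfl
  | succ n ih => rw [Finset.sum_range_succ, ih]

theorem Small.sum {F : α × ℕ → ℕ} {cnt : α → ℕ} (hcnt : Γ.Small cnt)
    (hF : ∀ s, (Γ.ext s fun a i => i < cnt a).Small F) :
    Γ.Small (fun a => ∑ i ∈ Finset.range (cnt a), F (a, i)) := by
  refine ⟨.sum hcnt fun s => (hF s).1, ?_⟩
  obtain ⟨m, hm⟩ := hcnt.2
  obtain ⟨k, hk⟩ := (hF 0).2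
  refine ⟨m + k, fun a ha => ?_⟩
  calc ∑ i ∈ Finset.range (cnt a), F (a, i) ≤ ∑ i ∈ Finset.range (cnt a), Γ.base a ^ k :=
        Finset.sum_le_sum fun i hi => hk (a, i) ⟨ha, Finset.mem_range.1 hi⟩
    _ = cnt a * Γ.base a ^ k := by simp
    _ ≤ _ := mul_le_pow_of_le (hm a ha) le_rfl

theorem Comp.minUpTo {F : α × ℕ → ℕ} {cnt : α → ℕ} (hcnt : Γ.Small cnt)
    (hF : ∀ s, (Γ.ext s fun a i => i ≤ cnt a).Comp F) :
    Γ.Comp (fun a => _root_.minUpTo (fun i => F (a, i)) (cnt a)) := by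
  refine (Comp.bind (comp_const 0) hF fun a _ => Nat.zero_le _).iter
    (body := fun a i v => Min.min v (F (a, i + 1))) hcnt fun s =>
    comp_extIter_acc.min (Comp.toIter (P := fun a i => i < cnt a) (F := fun x => F (x.1, x.2 + 1))
      (fun s => ?_) (fun _ _ _ _ h => h.1) s)
  refine Comp.bind (Γ := Γ.ext s fun a i => i < cnt a) (g := fun x => x.2 + 1)
    (P := fun x i => i ≤ cnt x.1) (F := fun x => F (x.1.1, x.2))
    (comp_ext_var.add (comp_const 1)) (fun s' => ?_) fun x hx => hx.2
  refine (hF (s + 1 + s')).reindex (fun x : (α × ℕ) × ℕ => (x.1.1, x.2)) ?_ ?_ (fun _ => rfl) ?_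
  · simp only [Ctx.ext]; omega
  · exact fun x hx => ⟨hx.1.1, hx.2⟩
  · refine fun x σ h => ⟨h.1.1, ?_⟩
    rw [← h.2]; simp only [Ctx.ext]; congr 1; omega

theorem Comp.mul (hf : Γ.Comp f) (hg : Γ.Small g) : Γ.Comp (fun a => f a * g a) :=
  (Comp.sum (F := fun x => f x.1) hg fun _ => hf.ext).congr fun a _ => by
    simp [mul_comm]

theorem Small.mul (hf : Γ.Small f) (hg : Γ.Small g) : Γ.Small (fun a => f a * g a) :=
  ⟨hf.1.mul hg, hf.2.mul hg.2⟩

theorem Small.mod (hf : Γ.Small f) (hg : Γ.Small g) : Γ.Small (fun a => f a % g a) := by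
  refine ⟨?_, hf.2.mono fun a _ => Nat.mod_le _ _⟩
  -- subtracting `g a` as often as possible, at most `f a` times
  refine (hf.1.iter (body := fun a _ v => if g a ≤ v then v - g a else v) hf fun s =>
    Comp.ite_le hg.1.extIter comp_extIter_acc ((comp_extIter_acc.sub hg.1.extIter).restrict _)
      (comp_extIter_acc.restrict _)).congr fun a _ => ?_
  have key : ∀ k x, x ≤ k →
      (Nat.rec x (fun _ v => if g a ≤ v then v - g a else v) k : ℕ) = x % g a := by
    have hmod : ∀ k x,
        (Nat.rec x (fun _ v => if g a ≤ v then v - g a else v) k : ℕ) % g a = x % g a := by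
      intro k x
      induction k with
      | zero => rfl
      | succ k ih =>
        rw [← ih]
        simp only
        split_ifs with h
        · rw [Nat.mod_eq_sub_mod h]
        · rfl
    have hlt : ∀ k x, (Nat.rec x (fun _ v => if g a ≤ v then v - g a else v) k : ℕ) < g a ∨
        (Nat.rec x (fun _ v => if g a ≤ v then v - g a else v) k : ℕ) + k ≤ x ∨ g a = 0 := by
      intro k x
      induction k with
      | zero => right; left; exact le_rfl
      | succ k ih =>
        simp only
        split_ifs with h <;> omega
    intro k x hx
    rcases hlt k x with h | h | h
    · rw [← hmod k x, Nat.mod_eq_of_lt h]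
    · have h0 : (Nat.rec x (fun _ v => if g a ≤ v then v - g a else v) k : ℕ) = 0 := by omega
      rw [← hmod k x, h0, Nat.zero_mod]
    · simpa [h] using hmod k x
  exact (key _ _ le_rfl).symm

theorem Small.div (hf : Γ.Small f) (hg : Γ.Small g) (h0 : ∀ a, Γ.dom a → 0 < g a) :
    Γ.Small (fun a => f a / g a) := by
  refine ⟨?_, hf.2.mono fun a _ => Nat.div_le_self _ _⟩
  refine (Comp.sum (F := fun x => if (x.2 + 1) * g x.1 ≤ f x.1 then 1 else 0) hf fun s =>
    Comp.ite_le ((comp_ext_var.add (comp_const 1)).mul hg.ext) hf.1.ext (comp_const 1)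
      (comp_const 0)).congr fun a ha => ?_
  have : (Finset.range (f a)).filter (fun i => (i + 1) * g a ≤ f a) = Finset.range (f a / g a) := by
    ext i
    simp only [Finset.mem_filter, Finset.mem_range]
    rw [← Nat.le_div_iff_mul_le (h0 a ha)]
    have := Nat.div_le_self (f a) (g a)
    omega
  rw [← Finset.sum_filter, this]
  simp

theorem Comp.pow (hf : Γ.Small f) (hg : Γ.Small g) : Γ.Comp (fun a => f a ^ g a) := by
  refine ((comp_const 1).iter (body := fun a _ v => v * f a) hg fun s =>
    comp_extIter_acc.mul ?_).congr fun a _ => ?_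
  · exact hf.reindex (fun x : (α × ℕ) × ℕ => x.1.1) (by simp only [Ctx.extIter]; omega)
      (fun _ h => h.1) (fun _ => rfl) (fun _ _ h => h.1)
  · induction g a with
    | zero => rfl
    | succ n ih => rw [pow_succ, ih]

theorem Small.pow (hf : Γ.Small f) (hg : Γ.Small g) (hb : Γ.Bdd fun a => f a ^ g a) :
    Γ.Small (fun a => f a ^ g a) := ⟨.pow hf hg, hb⟩

end RAM.Ctx

/-! ### The geometry of the groups of segments -/

namespace CoverInstance

variable (I : CoverInstance)

/-- The release time of the job with number `j`. -/
def release (j : ℕ) : ℕ := if h : j < I.n then I.r ⟨j, h⟩ else 0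

/-- The processing time of the job with number `j`. -/
def proc (j : ℕ) : ℕ := if h : j < I.n then I.p ⟨j, h⟩ else 0

/-- The length of the cells of height `L`, where the height of a cell of level `ℓ` is
`depth - ℓ`. -/
def hlen (L : ℕ) : ℕ := I.leafLen * I.K ^ L

/-- The length of the segments of a group of height `L`. -/
def hseg (L : ℕ) : ℕ := if 2 ≤ L then I.hlen (L - 2) else 1

/-- The left endpoint of the group of height `L` of the job `j`. -/
def start (j : ℕ) : ℕ → ℕ
  | 0 => I.release j
  | L + 1 => min ((start j L / I.hlen L + 1) * I.hlen L) (I.hlen I.depth)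

/-- The number of segments in a cell of height `L`. -/
def slots (L : ℕ) : ℕ := I.hlen L / I.hseg L

/-- The number of segments of the cell that precede the group of height `L` of the job `j`. -/
def skip (j L : ℕ) : ℕ := I.start j L % I.hlen L / I.hseg L

/-- The number of segments in the group of height `L` of the job `j`. -/
def cnt (j L : ℕ) : ℕ := if I.start j L < I.hlen I.depth then I.slots L - I.skip j L else 0

/-- The number of rectangles that precede the group of height `L` of the job `j` in the list of all
rectangles. -/
def blockStart (j L : ℕ) : ℕ :=
  (∑ j' ∈ Finset.range j, ∑ L' ∈ Finset.range (I.depth + 1), I.cnt j' L') +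
    ∑ L' ∈ Finset.range L, I.cnt j L'

/-- The group of height `L` of the job `j` lies in the cell of this height at position `pos`. -/
def InCell (j L pos : ℕ) : Prop :=
  I.start j L < I.hlen I.depth ∧ I.start j L / I.hlen L = pos

instance (j L pos : ℕ) : Decidable (I.InCell j L pos) := by unfold InCell; infer_instance

variable {I}

theorem Valid.two_le_K (hI : I.Valid) : 2 ≤ I.K := by
  have := hI.invEps_pos
  calc 2 ≤ 2 * I.invEps := by omega
    _ ≤ I.K := Nat.le_self_pow (by omega) _

theorem Valid.hlen_pos (hI : I.Valid) (L : ℕ) : 0 < I.hlen L :=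
  Nat.mul_pos hI.leafLen_pos (Nat.pow_pos (by have := hI.two_le_K; omega))

theorem Valid.hseg_pos (hI : I.Valid) (L : ℕ) : 0 < I.hseg L := by
  unfold hseg; split_ifs
  · exact hI.hlen_pos _
  · exact one_pos

theorem hlen_zero : I.hlen 0 = I.leafLen := by simp [hlen]

theorem hlen_succ (L : ℕ) : I.hlen (L + 1) = I.hlen L * I.K := by
  simp [hlen, pow_succ, mul_assoc]

theorem hlen_dvd {L L' : ℕ} (h : L ≤ L') : I.hlen L ∣ I.hlen L' :=
  Nat.mul_dvd_mul_left _ (pow_dvd_pow _ h)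

theorem hseg_dvd_hlen (L : ℕ) : I.hseg L ∣ I.hlen L := by
  unfold hseg; split_ifs
  · exact hlen_dvd (by omega)
  · exact one_dvd _

theorem hseg_succ_dvd_hlen (L : ℕ) : I.hseg (L + 1) ∣ I.hlen L := by
  unfold hseg; split_ifs
  · exact hlen_dvd (by omega)
  · exact one_dvd _

theorem slots_mul (L : ℕ) : I.slots L * I.hseg L = I.hlen L := Nat.div_mul_cancel (hseg_dvd_hlen L)

theorem hseg_dvd_hseg_succ (L : ℕ) : I.hseg L ∣ I.hseg (L + 1) := by
  unfold hseg; split_ifs with h1 h2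
  · exact hlen_dvd (by omega)
  · omega
  · exact one_dvd _
  · exact one_dvd _

theorem hseg_dvd_start {j L : ℕ} (hL : L ≤ I.depth) : I.hseg L ∣ I.start j L := by
  rcases L with - | L
  · simp [hseg]
  · refine (hseg_succ_dvd_hlen L).trans ?_
    rw [start]
    rcases min_choice ((I.start j L / I.hlen L + 1) * I.hlen L) (I.hlen I.depth) with h | h
    · rw [h]; exact Dvd.intro_left _ rfl
    · rw [h]; exact hlen_dvd (by omega)

theorem start_succ_of_lt {j L : ℕ} (hI : I.Valid) (hL : L ≤ I.depth)
    (h : I.start j L < I.hlen I.depth) :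
    I.start j (L + 1) = (I.start j L / I.hlen L + 1) * I.hlen L := by
  rw [start, min_eq_left]
  obtain ⟨c, hc⟩ := hlen_dvd (I := I) hL
  rw [hc, mul_comm] at h ⊢
  refine Nat.mul_le_mul_left _ ?_
  rwa [Nat.succ_le_iff, Nat.div_lt_iff_lt_mul (hI.hlen_pos L)]

theorem start_succ_of_not_lt {j L : ℕ} (hI : I.Valid) (h : ¬ I.start j L < I.hlen I.depth) :
    I.start j (L + 1) = I.hlen I.depth := by
  rw [start, min_eq_right]
  have := Nat.lt_div_mul_add (a := I.start j L) (hI.hlen_pos L)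
  rw [add_mul]; omega

theorem release_le {j : ℕ} (hI : I.Valid) : I.release j ≤ I.hlen I.depth := by
  have h : I.hlen I.depth = I.len 0 := by simp [hlen, len]
  unfold release; split_ifs with hj
  · have h1 : I.r ⟨j, hj⟩ ≤ Finset.univ.sup I.r := Finset.le_sup (Finset.mem_univ _)
    have := hI.T_le
    unfold T at this
    omega
  · exact Nat.zero_le _

theorem start_le {j L : ℕ} (hI : I.Valid) : I.start j L ≤ I.hlen I.depth := by
  cases L with
  | zero => exact release_le hI
  | succ L => exact min_le_right _ _

theorem start_le_succ {j L : ℕ} (hI : I.Valid) : I.start j L ≤ I.start j (L + 1) := by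
  rw [start]
  refine le_min ?_ (start_le hI)
  have := Nat.lt_div_mul_add (a := I.start j L) (hI.hlen_pos L)
  rw [add_mul]; omega

theorem start_mono_right {j L L' : ℕ} (hI : I.Valid) (h : L ≤ L') : I.start j L ≤ I.start j L' :=
  monotone_nat_of_le_succ (f := I.start j) (fun _ => start_le_succ hI) h

theorem start_depth_succ {j : ℕ} (hI : I.Valid) : I.start j (I.depth + 1) = I.hlen I.depth := by
  by_cases h : I.start j I.depth < I.hlen I.depth
  · rw [start_succ_of_lt hI le_rfl h, Nat.div_eq_of_lt h]; simp
  · exact start_succ_of_not_lt hI h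

theorem release_strictMono {i j : ℕ} (hI : I.Valid) (h : i < j) (hj : j < I.n) :
    I.release i < I.release j := by
  simp only [release, hj, h.trans hj, dif_pos]
  exact hI.strictMono_r h

theorem release_le_release {i j : ℕ} (hI : I.Valid) (h : i ≤ j) (hj : j < I.n) :
    I.release i ≤ I.release j := by
  rcases h.lt_or_eq with h | rfl
  · exact (release_strictMono hI h hj).le
  · exact le_rfl

theorem start_mono_left {i j L : ℕ} (hI : I.Valid) (h : i ≤ j) (hj : j < I.n) :
    I.start i L ≤ I.start j L := by
  induction L with
  | zero => exact release_le_release hI h hj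
  | succ L ih =>
    rw [start, start]
    gcongr

/-- Every group ends where the next one begins. -/
theorem start_add_cnt {j L : ℕ} (hI : I.Valid) (hL : L ≤ I.depth) :
    I.start j L + I.cnt j L * I.hseg L = I.start j (L + 1) := by
  unfold cnt
  split_ifs with h
  · rw [start_succ_of_lt hI hL h, Nat.sub_mul, slots_mul, skip, Nat.div_mul_cancel
      ((Nat.dvd_mod_iff (hseg_dvd_hlen L)).2 (hseg_dvd_start hL)), add_mul, one_mul]
    have h1 := Nat.div_add_mod' (I.start j L) (I.hlen L)
    have h2 := Nat.mod_lt (I.start j L) (hI.hlen_pos L)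
    omega
  · rw [start_succ_of_not_lt hI h, zero_mul, add_zero]
    exact le_antisymm (start_le hI) (not_lt.1 h)

theorem start_lt_of_cnt_pos {j L : ℕ} (h : 0 < I.cnt j L) : I.start j L < I.hlen I.depth := by
  unfold cnt at h
  split_ifs at h with h'
  · exact h'
  · omega

variable (I)

/-! ### States of the dynamic program -/

/-- An upper bound on all sums of processing times, plus one. -/
def Q : ℕ := (∑ j ∈ Finset.range I.n, I.proc j) + 1

/-- The number of states of a segment. The state `j₀ * Q + a` stands for the time
`release j₀ + a`. -/
def B : ℕ := I.n * I.Q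

/-- The time that the state `e` of a segment stands for. -/
def time (e : ℕ) : ℕ := I.release (e / I.Q) + e % I.Q

/-- The state of a segment after a job `j` that is not selected there: if `e` stands for the
completion time of the preceding jobs, in the order of their release times, then `upd j e` stands
for the completion time of `j`. The minimum keeps the result in the range of states; it matters only
for states that do not occur. -/
def upd (j e : ℕ) : ℕ :=
  min (if I.time e ≤ I.release j then j * I.Q + I.proc j else e + I.proc j) (I.B - 1)

/-- The state `e` stands for a time later than `t`. The state `0` is excluded because it is the
initial one, when no job has been executed. It arises from a job only if this is the first job and
has processing time `0`, which is not late either. -/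
def Late (t e : ℕ) : Prop := t < I.time e ∧ e ≠ 0

instance (t e : ℕ) : Decidable (I.Late t e) := by unfold Late; infer_instance

/-- The state of the segment `d` in the code of a vector of states. -/
def dig (code d : ℕ) : ℕ := code / I.B ^ d % I.B

/-- The code of a vector of states. -/
def enc (N : ℕ) (g : ℕ → ℕ) : ℕ := ∑ d ∈ Finset.range N, g d * I.B ^ d

/-- The states of the segments of a cell of height `L` after the job `j`, if this is not selected in
the segments from `d₀` on. -/
def moveCode (L d₀ j code : ℕ) : ℕ :=
  I.enc (I.slots L) fun d => if d₀ ≤ d then I.upd j (I.dig code d) else I.dig code d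

/-- The states of the segments of the `q`-th child, of height `L`, of a cell. -/
def childCode (L q code : ℕ) : ℕ :=
  I.enc (I.slots L) fun d => I.dig code ((q * I.hlen L + d * I.hseg L) / I.hseg (L + 1))

/-- The minimum of the weight plus the penalty, `pen` for each late time, of the choices for the
cell of height `L` at position `pos` and its descendants, if the choices for all but the last `m`
jobs have already been made for the cell itself, with the states `code`. -/
def val (w : ℕ → ℕ) (pen : ℕ) : ℕ → ℕ → ℕ → ℕ → ℕ
  | 0, 0, pos, code =>
    ∑ d ∈ Finset.range I.leafLen, if I.Late (pos * I.leafLen + d) (I.dig code d) then pen else 0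
  | L + 1, 0, pos, code =>
    ∑ q ∈ Finset.range I.K, val w pen L I.n (pos * I.K + q) (I.childCode L q code)
  | L, m + 1, pos, code =>
    if I.InCell (I.n - (m + 1)) L pos then
      minUpTo (fun k => (∑ i ∈ Finset.range k, w (I.blockStart (I.n - (m + 1)) L + i)) +
        val w pen L m pos (I.moveCode L (I.skip (I.n - (m + 1)) L + k) (I.n - (m + 1)) code))
        (I.cnt (I.n - (m + 1)) L)
    else val w pen L m pos code
  termination_by L m => (L, m)

/-- The weight plus the penalty of the choices `κ`, where `κ L j` is the number of the selected
segments of the group of height `L` of the job `j`; otherwise as for `val`. -/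
def phi (w : ℕ → ℕ) (pen : ℕ) (κ : ℕ → ℕ → ℕ) : ℕ → ℕ → ℕ → ℕ → ℕ
  | 0, 0, pos, code =>
    ∑ d ∈ Finset.range I.leafLen, if I.Late (pos * I.leafLen + d) (I.dig code d) then pen else 0
  | L + 1, 0, pos, code =>
    ∑ q ∈ Finset.range I.K, phi w pen κ L I.n (pos * I.K + q) (I.childCode L q code)
  | L, m + 1, pos, code =>
    if I.InCell (I.n - (m + 1)) L pos then
      (∑ i ∈ Finset.range (κ L (I.n - (m + 1))), w (I.blockStart (I.n - (m + 1)) L + i)) +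
        phi w pen κ L m pos
          (I.moveCode L (I.skip (I.n - (m + 1)) L + κ L (I.n - (m + 1))) (I.n - (m + 1)) code)
    else phi w pen κ L m pos code
  termination_by L m => (L, m)

variable {I}

theorem val_le_phi (w : ℕ → ℕ) (pen : ℕ) {κ : ℕ → ℕ → ℕ} (hκ : ∀ L j, κ L j ≤ I.cnt j L) :
    ∀ L m pos code, I.val w pen L m pos code ≤ I.phi w pen κ L m pos code
  | 0, 0, pos, code => by rw [val, phi]
  | L + 1, 0, pos, code => by
    rw [val, phi]
    exact Finset.sum_le_sum fun q _ => val_le_phi w pen hκ L I.n _ _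
  | L, m + 1, pos, code => by
    rw [val, phi]
    split_ifs with h
    · exact (minUpTo_le (hκ _ _)).trans
        (Nat.add_le_add_left (val_le_phi w pen hκ L m _ _) _)
    · exact val_le_phi w pen hκ L m _ _
  termination_by L m => (L, m)

theorem start_div_hlen_succ {j L L' pos q : ℕ} (hq : q < I.K)
    (h : I.start j L' / I.hlen L = pos * I.K + q) : I.start j L' / I.hlen (L + 1) = pos := by
  rw [hlen_succ, ← Nat.div_div_eq_div_mul, h, mul_comm,
    Nat.mul_add_div (by omega), Nat.div_eq_of_lt hq, add_zero]

/-- The value of `phi` depends only on the choices for the cell and its descendants. -/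
theorem phi_congr (w : ℕ → ℕ) (pen : ℕ) {κ κ' : ℕ → ℕ → ℕ} : ∀ L m pos code, m ≤ I.n →
    (∀ L' j, L' < L ∨ (L' = L ∧ I.n - m ≤ j) → I.start j L' / I.hlen L = pos → κ L' j = κ' L' j) →
    I.phi w pen κ L m pos code = I.phi w pen κ' L m pos code
  | 0, 0, pos, code, _, _ => by rw [phi, phi]
  | L + 1, 0, pos, code, _, h => by
    rw [phi, phi]
    refine Finset.sum_congr rfl fun q hq => phi_congr w pen L I.n _ _ le_rfl fun L' j hL hj => ?_
    exact h L' j (by omega) (start_div_hlen_succ (Finset.mem_range.1 hq) hj)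
  | L, m + 1, pos, code, hm, h => by
    rw [phi, phi]
    split_ifs with hc
    · rw [h L _ (Or.inr ⟨rfl, le_rfl⟩) hc.2, phi_congr w pen L m pos _ (by omega)]
      exact fun L' j hL => h L' j (by omega)
    · exact phi_congr w pen L m pos _ (by omega) fun L' j hL => h L' j (by omega)
  termination_by L m => (L, m)

theorem exists_phi_eq_val (w : ℕ → ℕ) (pen : ℕ) : ∀ L m pos code, m ≤ I.n →
    ∃ κ : ℕ → ℕ → ℕ, (∀ L j, κ L j ≤ I.cnt j L) ∧
      I.phi w pen κ L m pos code = I.val w pen L m pos code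
  | 0, 0, pos, code, _ => ⟨fun _ _ => 0, fun _ _ => Nat.zero_le _, by rw [val, phi]⟩
  | L + 1, 0, pos, code, _ => by
    choose κ hκ h using fun q =>
      exists_phi_eq_val w pen L I.n (pos * I.K + q) (I.childCode L q code) le_rfl
    -- each group uses the choices for the child that contains it
    refine ⟨fun L' j => κ (I.start j L' / I.hlen L % I.K) L' j, fun L' j => hκ _ _ _, ?_⟩
    rw [val, phi]
    refine Finset.sum_congr rfl fun q hq => ?_
    rw [← h q]
    refine phi_congr w pen L I.n _ _ le_rfl fun L' j _ hj => ?_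
    rw [hj, mul_comm, Nat.mul_add_mod, Nat.mod_eq_of_lt (Finset.mem_range.1 hq)]
  | L, m + 1, pos, code, hm => by
    by_cases hc : I.InCell (I.n - (m + 1)) L pos
    · obtain ⟨k, hk, hk'⟩ := exists_minUpTo_eq (fun k =>
        (∑ i ∈ Finset.range k, w (I.blockStart (I.n - (m + 1)) L + i)) + I.val w pen L m pos
          (I.moveCode L (I.skip (I.n - (m + 1)) L + k) (I.n - (m + 1)) code))
        (I.cnt (I.n - (m + 1)) L)
      obtain ⟨κ, hκ, h⟩ := exists_phi_eq_val w pen L m pos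
        (I.moveCode L (I.skip (I.n - (m + 1)) L + k) (I.n - (m + 1)) code) (by omega)
      refine ⟨fun L' j => if L' = L ∧ j = I.n - (m + 1) then k else κ L' j, fun L' j => ?_, ?_⟩
      · dsimp only
        split_ifs with h'
        · rw [h'.1, h'.2]; exact hk
        · exact hκ _ _
      · rw [val, phi, if_pos hc, if_pos hc, hk']
        simp only [and_self, if_true]
        rw [← h]
        congr 1
        refine phi_congr w pen L m pos _ (by omega) fun L' j hL _ => if_neg ?_
        omega
    · obtain ⟨κ, hκ, h⟩ := exists_phi_eq_val w pen L m pos code (by omega)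
      exact ⟨κ, hκ, by rw [val, phi, if_neg hc, if_neg hc, h]⟩
  termination_by L m => (L, m)

end CoverInstance

/-! ### The weight and the penalty of a choice -/

theorem sum_mul_pow_div_pow_mod {b : ℕ} : ∀ {N : ℕ} {g : ℕ → ℕ} {d : ℕ}, d < N →
    (∀ i < N, g i < b) → (∑ i ∈ Finset.range N, g i * b ^ i) / b ^ d % b = g d
  | 0, _, _, h, _ => absurd h (by omega)
  | N + 1, g, d, h, hg => by
    have h0 := hg 0 (by omega)
    have hs : ∑ i ∈ Finset.range (N + 1), g i * b ^ i =
        b * (∑ i ∈ Finset.range N, g (i + 1) * b ^ i) + g 0 := by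
      rw [Finset.sum_range_succ', Finset.mul_sum, pow_zero, mul_one]
      congr 1
      exact Finset.sum_congr rfl fun i _ => by ring
    rw [hs]
    cases d with
    | zero => rw [pow_zero, Nat.div_one, Nat.mul_add_mod, Nat.mod_eq_of_lt h0]
    | succ d =>
      rw [pow_succ', ← Nat.div_div_eq_div_mul, Nat.mul_add_div (by omega), Nat.div_eq_of_lt h0,
        add_zero]
      exact sum_mul_pow_div_pow_mod (g := fun i => g (i + 1)) (by omega)
        fun i hi => hg _ (by omega)

theorem sum_range_mul_eq (f : ℕ → ℕ) (a b : ℕ) :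
    ∑ u ∈ Finset.range (a * b), f u =
      ∑ q ∈ Finset.range b, ∑ u ∈ Finset.range a, f (q * a + u) := by
  induction b with
  | zero => simp
  | succ b ih => rw [Nat.mul_succ, Finset.sum_range_add, ih, Finset.sum_range_succ, mul_comm]

namespace CoverInstance

variable {I : CoverInstance}

theorem Valid.n_mul_P_pos (hI : I.Valid) : 0 < I.n * I.P := by
  by_contra h
  have h1 := hI.len_le
  have h2 := hI.hlen_pos I.depth
  rw [show I.n * I.P = 0 by omega, show I.len 0 = I.hlen I.depth by simp [hlen, len]] at h1
  omega

theorem Valid.n_pos (hI : I.Valid) : 0 < I.n := pos_of_mul_pos_left hI.n_mul_P_pos (Nat.zero_le _)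

theorem Q_pos : 0 < I.Q := Nat.succ_pos _

theorem Valid.B_pos (hI : I.Valid) : 0 < I.B := Nat.mul_pos hI.n_pos Q_pos

theorem dig_lt (hI : I.Valid) (code d : ℕ) : I.dig code d < I.B := Nat.mod_lt _ hI.B_pos

theorem upd_lt (hI : I.Valid) (j e : ℕ) : I.upd j e < I.B := by
  have := hI.B_pos
  unfold upd
  omega

theorem dig_enc {N d : ℕ} {g : ℕ → ℕ} (hd : d < N) (hg : ∀ i < N, g i < I.B) :
    I.dig (I.enc N g) d = g d := sum_mul_pow_div_pow_mod hd hg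

theorem dig_moveCode (hI : I.Valid) {L d₀ j code d : ℕ} (hd : d < I.slots L) :
    I.dig (I.moveCode L d₀ j code) d =
      if d₀ ≤ d then I.upd j (I.dig code d) else I.dig code d :=
  dig_enc hd fun _ _ => by split_ifs; exacts [upd_lt hI _ _, dig_lt hI _ _]

theorem dig_childCode (hI : I.Valid) {L q code d : ℕ} (hd : d < I.slots L) :
    I.dig (I.childCode L q code) d =
      I.dig code ((q * I.hlen L + d * I.hseg L) / I.hseg (L + 1)) :=
  dig_enc hd fun _ _ => dig_lt hI _ _

variable (I)

/-- The total weight of the segments that are selected from the group of height `L` of the job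
`j`. -/
def groupWeight (w : ℕ → ℕ) (κ : ℕ → ℕ → ℕ) (j L : ℕ) : ℕ :=
  ∑ i ∈ Finset.range (κ L j), w (I.blockStart j L + i)

/-- The time `t` lies in the group of height `L` of the job `j`, but not in a selected segment. -/
def Unsel (κ : ℕ → ℕ → ℕ) (t L j : ℕ) : Prop :=
  I.start j L ≤ t ∧ t < I.start j (L + 1) ∧ I.start j L + κ L j * I.hseg L ≤ t

instance (κ : ℕ → ℕ → ℕ) (t L j : ℕ) : Decidable (I.Unsel κ t L j) := by
  unfold Unsel; infer_instance

/-- The final state of the segments that contain the time `t`, if the state is `e` when the last `m`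
jobs remain at height `L`. -/
def run (κ : ℕ → ℕ → ℕ) (t : ℕ) : ℕ → ℕ → ℕ → ℕ
  | 0, 0, e => e
  | L + 1, 0, e => run κ t L I.n e
  | L, m + 1, e =>
    run κ t L m (if I.Unsel κ t L (I.n - (m + 1)) then I.upd (I.n - (m + 1)) e else e)
  termination_by L m => (L, m)

variable {I}

theorem unsel_iff_of_inCell (hI : I.Valid) {κ : ℕ → ℕ → ℕ} {L j pos u : ℕ} (hL : L ≤ I.depth)
    (hc : I.InCell j L pos) (hu : u < I.hlen L) :
    I.Unsel κ (pos * I.hlen L + u) L j ↔ I.skip j L + κ L j ≤ u / I.hseg L := by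
  have h1 : I.start j L = pos * I.hlen L + I.skip j L * I.hseg L := by
    rw [skip, Nat.div_mul_cancel ((Nat.dvd_mod_iff (hseg_dvd_hlen L)).2 (hseg_dvd_start hL)),
      ← hc.2, Nat.div_add_mod']
  have h2 : I.start j (L + 1) = pos * I.hlen L + I.hlen L := by
    rw [start_succ_of_lt hI hL hc.1, hc.2, add_mul, one_mul]
  rw [Nat.le_div_iff_mul_le (hI.hseg_pos L), add_mul, Unsel, h1, h2]
  constructor
  · rintro ⟨-, -, h⟩; omega
  · intro h; refine ⟨?_, ?_, ?_⟩ <;> omega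

theorem inCell_of_unsel (hI : I.Valid) {κ : ℕ → ℕ → ℕ} {L j pos u : ℕ} (hL : L ≤ I.depth)
    (ht : pos * I.hlen L + u < I.hlen I.depth) (hu : u < I.hlen L)
    (h : I.Unsel κ (pos * I.hlen L + u) L j) : I.InCell j L pos := by
  have h0 : I.start j L < I.hlen I.depth := h.1.trans_lt ht
  refine ⟨h0, le_antisymm ?_ ?_⟩
  · rw [← Nat.lt_succ_iff, Nat.div_lt_iff_lt_mul (hI.hlen_pos L), Nat.succ_mul]
    exact h.1.trans_lt (by omega)
  · have h2 := h.2.1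
    rw [start_succ_of_lt hI hL h0] at h2
    by_contra hlt
    have := Nat.mul_le_mul_right (I.hlen L) (show I.start j L / I.hlen L + 1 ≤ pos by omega)
    omega

/-- Summing over the children a value that is counted for the child that contains the point `x`. -/
theorem sum_indicator_children (hI : I.Valid) (c : Prop) [Decidable c] (x L pos v : ℕ) :
    ∑ q ∈ Finset.range I.K, (if c ∧ x / I.hlen L = pos * I.K + q then v else 0) =
      if c ∧ x / I.hlen (L + 1) = pos then v else 0 := by
  have hK := hI.two_le_K
  rw [hlen_succ, ← Nat.div_div_eq_div_mul]
  set y := x / I.hlen L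
  by_cases h : c ∧ y / I.K = pos
  · rw [if_pos h, Finset.sum_eq_single (y % I.K)]
    · rw [if_pos ⟨h.1, by rw [← h.2, Nat.div_add_mod']⟩]
    · intro q hqK hq
      rw [if_neg]
      rintro ⟨-, h'⟩
      rw [h', mul_comm, Nat.mul_add_mod, Nat.mod_eq_of_lt (Finset.mem_range.1 hqK)] at hq
      exact hq rfl
    · exact fun h' => absurd (Finset.mem_range.2 (Nat.mod_lt _ (by omega))) h'
  · rw [if_neg h]
    refine Finset.sum_eq_zero fun q hq => if_neg fun h' => h ⟨h'.1, ?_⟩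
    rw [h'.2, mul_comm, Nat.mul_add_div (by omega), Nat.div_eq_of_lt (Finset.mem_range.1 hq),
      add_zero]

/-- A segment of a child is contained in one segment of its parent, so that the latter may be
located by the left endpoint of the former. -/
theorem child_slot_eq (hI : I.Valid) (L q u : ℕ) :
    (q * I.hlen L + u / I.hseg L * I.hseg L) / I.hseg (L + 1) =
      (q * I.hlen L + u) / I.hseg (L + 1) := by
  obtain ⟨c, hc⟩ := hseg_dvd_hseg_succ (I := I) L
  obtain ⟨c', hc'⟩ := hseg_dvd_hlen (I := I) L
  have h0 := hI.hseg_pos L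
  rw [hc, ← Nat.div_div_eq_div_mul, ← Nat.div_div_eq_div_mul, hc',
    show q * (I.hseg L * c') = I.hseg L * (q * c') by ring, Nat.mul_add_div h0,
    Nat.mul_add_div h0, Nat.mul_div_cancel _ h0]

/-- The recursively defined value `phi` as a sum of weights and penalties. -/
theorem phi_eq (hI : I.Valid) (w : ℕ → ℕ) (pen : ℕ) (κ : ℕ → ℕ → ℕ) : ∀ L m pos code,
    L ≤ I.depth → pos < I.K ^ (I.depth - L) → m ≤ I.n →
    I.phi w pen κ L m pos code =
      (∑ j ∈ Finset.Ico (I.n - m) I.n, if I.InCell j L pos then I.groupWeight w κ j L else 0) +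
      (∑ L' ∈ Finset.range L, ∑ j ∈ Finset.range I.n,
        if I.start j L' < I.hlen I.depth ∧ I.start j L' / I.hlen L = pos
          then I.groupWeight w κ j L' else 0) +
      ∑ u ∈ Finset.range (I.hlen L), if I.Late (pos * I.hlen L + u)
        (I.run κ (pos * I.hlen L + u) L m (I.dig code (u / I.hseg L))) then pen else 0
  | 0, 0, pos, code, _, _, _ => by
    simp [phi, run, hlen_zero, hseg]
  | L + 1, 0, pos, code, hL, hpos, _ => by
    have hK := hI.two_le_K
    have hpos' : ∀ q < I.K, pos * I.K + q < I.K ^ (I.depth - L) := by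
      intro q hq
      rw [show I.depth - L = I.depth - (L + 1) + 1 by omega, pow_succ]
      have := Nat.mul_le_mul_right I.K (show pos + 1 ≤ _ from hpos)
      rw [add_mul] at this
      omega
    rw [phi, Finset.sum_congr rfl fun q hq => phi_eq hI w pen κ L I.n (pos * I.K + q)
      (I.childCode L q code) (by omega) (hpos' q (Finset.mem_range.1 hq)) le_rfl]
    rw [Finset.sum_add_distrib, Finset.sum_add_distrib]
    congr 1
    · rw [Nat.sub_self, Nat.sub_zero, Finset.Ico_self, Finset.sum_empty, zero_add,
        Finset.sum_range_succ, add_comm]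
      congr 1
      · rw [Finset.sum_comm]
        refine Finset.sum_congr rfl fun L' _ => ?_
        rw [Finset.sum_comm]
        exact Finset.sum_congr rfl fun j _ => sum_indicator_children hI _ _ _ _ _
      · rw [Finset.sum_comm, ← Finset.range_eq_Ico]
        exact Finset.sum_congr rfl fun j _ => sum_indicator_children hI _ _ _ _ _
    · rw [hlen_succ, sum_range_mul_eq]
      refine Finset.sum_congr rfl fun q _ => Finset.sum_congr rfl fun u hu => ?_
      have hd : u / I.hseg L < I.slots L := by
        rw [Nat.div_lt_iff_lt_mul (hI.hseg_pos L), slots_mul]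
        exact Finset.mem_range.1 hu
      rw [dig_childCode hI hd, child_slot_eq hI, run,
        show (pos * I.K + q) * I.hlen L + u = pos * (I.hlen L * I.K) + (q * I.hlen L + u) by ring]
  | L, m + 1, pos, code, hL, hpos, hm => by
    have hIco : Finset.Ico (I.n - (m + 1)) I.n =
        insert (I.n - (m + 1)) (Finset.Ico (I.n - m) I.n) := by
      ext x
      simp only [Finset.mem_Ico, Finset.mem_insert]
      omega
    rw [hIco, Finset.sum_insert (by simp only [Finset.mem_Ico]; omega), phi]
    set j := I.n - (m + 1) with hj
    have ht : ∀ u < I.hlen L, pos * I.hlen L + u < I.hlen I.depth := by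
      intro u hu
      have h1 : I.hlen I.depth = I.K ^ (I.depth - L) * I.hlen L := by
        rw [hlen, hlen, show I.K ^ I.depth = I.K ^ L * I.K ^ (I.depth - L) by
          rw [← pow_add]; congr 1; omega]
        ring
      have := Nat.mul_le_mul_right (I.hlen L) (show pos + 1 ≤ _ from hpos)
      rw [add_mul] at this
      omega
    by_cases hc : I.InCell j L pos
    · rw [if_pos hc, if_pos hc, phi_eq hI w pen κ L m pos _ hL hpos (by omega), groupWeight]
      have : ∀ u ∈ Finset.range (I.hlen L),
          (if I.Late (pos * I.hlen L + u) (I.run κ (pos * I.hlen L + u) L m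
            (I.dig (I.moveCode L (I.skip j L + κ L j) j code) (u / I.hseg L))) then pen else 0) =
          if I.Late (pos * I.hlen L + u) (I.run κ (pos * I.hlen L + u) L (m + 1)
            (I.dig code (u / I.hseg L))) then pen else 0 := by
        intro u hu
        rw [Finset.mem_range] at hu
        have hd : u / I.hseg L < I.slots L := by
          rw [Nat.div_lt_iff_lt_mul (hI.hseg_pos L), slots_mul]; exact hu
        rw [dig_moveCode hI hd, run, ← hj]
        simp only [unsel_iff_of_inCell hI hL hc hu]
      rw [Finset.sum_congr rfl this]
      ring
    · rw [if_neg hc, if_neg hc, phi_eq hI w pen κ L m pos _ hL hpos (by omega), zero_add]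
      congr 1
      refine Finset.sum_congr rfl fun u hu => ?_
      rw [Finset.mem_range] at hu
      rw [run, ← hj, if_neg fun h => hc (inCell_of_unsel hI hL (ht u hu) hu h)]
  termination_by L m => (L, m)

theorem phi_root (hI : I.Valid) (w : ℕ → ℕ) (pen : ℕ) {κ : ℕ → ℕ → ℕ}
    (hκ : ∀ L j, κ L j ≤ I.cnt j L) :
    I.phi w pen κ I.depth I.n 0 0 =
      (∑ L ∈ Finset.range (I.depth + 1), ∑ j ∈ Finset.range I.n, I.groupWeight w κ j L) +
      ∑ t ∈ Finset.range (I.hlen I.depth),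
        if I.Late t (I.run κ t I.depth I.n 0) then pen else 0 := by
  have hdig : ∀ d, I.dig 0 d = 0 := fun d => by simp [dig]
  have h0 : ∀ j L, (if I.start j L < I.hlen I.depth ∧ I.start j L / I.hlen I.depth = 0 then
      I.groupWeight w κ j L else 0) = I.groupWeight w κ j L := by
    intro j L
    by_cases h : I.start j L < I.hlen I.depth
    · rw [if_pos ⟨h, Nat.div_eq_of_lt h⟩]
    · rw [if_neg fun h' => h h'.1]
      have : κ L j = 0 := by
        have := hκ L j
        rw [cnt, if_neg h] at this
        omega
      simp [groupWeight, this]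
  rw [phi_eq hI w pen κ I.depth I.n 0 0 le_rfl (by simp) le_rfl]
  simp only [h0, InCell, hdig, zero_mul, zero_add, Nat.sub_self]
  rw [Finset.sum_range_succ, ← Finset.range_eq_Ico]
  ring

end CoverInstance

/-! ### Completion times and demands -/

namespace CoverInstance

variable (I : CoverInstance)

/-- The state after those of the jobs `0, …, m - 1` that belong to `S`. -/
def fold (S : ℕ → Prop) [DecidablePred S] (m : ℕ) : ℕ :=
  Nat.rec 0 (fun j e => if S j then I.upd j e else e) m

variable {I}

theorem fold_succ (S : ℕ → Prop) [DecidablePred S] (m : ℕ) :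
    I.fold S (m + 1) = if S m then I.upd m (I.fold S m) else I.fold S m := rfl

theorem fold_congr {S S' : ℕ → Prop} [DecidablePred S] [DecidablePred S'] {m : ℕ}
    (h : ∀ j < m, S j ↔ S' j) : I.fold S m = I.fold S' m := by
  induction m with
  | zero => rfl
  | succ m ih =>
    rw [fold_succ, fold_succ, ih fun j hj => h j (by omega)]
    simp only [h m (by omega)]

theorem fold_eq_of_forall_not {S : ℕ → Prop} [DecidablePred S] {m k : ℕ} (hk : m ≤ k)
    (h : ∀ j, m ≤ j → j < k → ¬ S j) : I.fold S k = I.fold S m := by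
  induction k, hk using Nat.le_induction with
  | base => rfl
  | succ k hk ih =>
    rw [fold_succ, if_neg (h k hk (by omega)), ih fun j hj hj' => h j hj (by omega)]

/-- The groups of one time are traversed in the order of the jobs: among the jobs that are not
selected at a given time, those with groups of greater height come first. -/
theorem lt_of_unsel (hI : I.Valid) {κ : ℕ → ℕ → ℕ} {t L L' i j : ℕ} (hL : L < L') (hi : i < I.n)
    (h : I.Unsel κ t L j) (h' : I.Unsel κ t L' i) : i < j := by
  by_contra hij
  have h1 : I.start j (L + 1) ≤ I.start i (L + 1) := start_mono_left hI (by omega) hi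
  have h2 : I.start i (L + 1) ≤ I.start i L' := start_mono_right hI (by omega)
  have := h.2.1
  have := h'.1
  omega

/-- The state that results from `run` is obtained from all jobs that are not selected at the time
`t`, in the order of their release times. -/
theorem run_fold (hI : I.Valid) (κ : ℕ → ℕ → ℕ) (t : ℕ) : ∀ L m, L ≤ I.depth → m ≤ I.n →
    I.run κ t L m (I.fold (fun j => ∃ L' ≤ I.depth, I.Unsel κ t L' j ∧
      (L < L' ∨ L = L' ∧ j < I.n - m)) I.n) =
    I.fold (fun j => ∃ L' ≤ I.depth, I.Unsel κ t L' j) I.n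
  | 0, 0, _, _ => by
    rw [run]
    refine fold_congr fun j hj => ?_
    refine exists_congr fun L' => and_congr_right fun _ => ⟨fun h => h.1, fun h => ⟨h, by omega⟩⟩
  | L + 1, 0, hL, hm => by
    rw [run, ← run_fold hI κ t L I.n (by omega) le_rfl]
    congr 1
    refine fold_congr fun j hj => ?_
    refine exists_congr fun L' => and_congr_right fun _ => and_congr_right fun _ => ?_
    omega
  | L, m + 1, hL, hm => by
    rw [run, ← run_fold hI κ t L m hL (by omega)]
    congr 1
    set j := I.n - (m + 1) with hj
    have hjm : I.n - m = j + 1 := by omega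
    have hcongr : I.fold (fun i => ∃ L' ≤ I.depth, I.Unsel κ t L' i ∧
        (L < L' ∨ L = L' ∧ i < I.n - m)) j = I.fold (fun i => ∃ L' ≤ I.depth, I.Unsel κ t L' i ∧
        (L < L' ∨ L = L' ∧ i < j)) j := by
      refine fold_congr fun i hi => ?_
      refine exists_congr fun L' => and_congr_right fun _ => and_congr_right fun _ => ?_
      omega
    split_ifs with h
    · symm
      rw [fold_eq_of_forall_not (m := j + 1) (k := I.n) (by omega), fold_succ, if_pos, hcongr]
      · congr 1
        symm
        refine fold_eq_of_forall_not (by omega) ?_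
        rintro i hi hi' ⟨L', -, hu, hor⟩
        rcases hor with hor | hor
        · have := lt_of_unsel hI hor hi' h hu; omega
        · omega
      · exact ⟨L, hL, h, Or.inr ⟨rfl, by omega⟩⟩
      · rintro i hi hi' ⟨L', -, hu, hor⟩
        rcases hor with hor | hor
        · have := lt_of_unsel hI hor hi' h hu; omega
        · omega
    · refine fold_congr fun i hi => ?_
      refine exists_congr fun L' => and_congr_right fun _ => and_congr_right fun hu => ?_
      constructor
      · omega
      · rintro (hor | ⟨rfl, hlt⟩)
        · exact Or.inl hor
        · refine Or.inr ⟨rfl, ?_⟩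
          rcases Nat.lt_or_eq_of_le (show i ≤ j by omega) with h' | rfl
          · exact h'
          · exact absurd hu h
  termination_by L m => (L, m)

theorem time_mul_add {j a : ℕ} (ha : a < I.Q) : I.time (j * I.Q + a) = I.release j + a := by
  rw [time, mul_comm, Nat.mul_add_div Q_pos, Nat.mul_add_mod, Nat.div_eq_of_lt ha,
    Nat.mod_eq_of_lt ha, add_zero]

/-- The state after the first `m` jobs of a set `S` stands for their completion time, which is the
maximum of `release j` plus the processing times of `j` and the later jobs. -/
theorem fold_spec (hI : I.Valid) (S : ℕ → Prop) [DecidablePred S] : ∀ m ≤ I.n,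
    (∃ j a, j < I.n ∧ a ≤ ∑ i ∈ Finset.range m, I.proc i ∧ I.fold S m = j * I.Q + a) ∧
    (∀ j < m, S j → I.release j + ∑ i ∈ (Finset.Ico j m).filter S, I.proc i ≤
      I.time (I.fold S m)) ∧
    (((∀ j < m, ¬ S j) ∧ I.fold S m = 0) ∨ ∃ j < m, S j ∧
      I.time (I.fold S m) = I.release j + ∑ i ∈ (Finset.Ico j m).filter S, I.proc i) := by
  intro m
  induction m with
  | zero =>
    exact fun _ => ⟨⟨0, 0, hI.n_pos, by simp, by simp [fold]⟩, by simp, Or.inl ⟨by simp, rfl⟩⟩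
  | succ m ih =>
    intro hm
    obtain ⟨⟨j₀, a, hj₀, ha, he⟩, hle, hor⟩ := ih (by omega)
    have hQ : ∀ k ≤ I.n, ∑ i ∈ Finset.range k, I.proc i < I.Q := fun k hk =>
      Nat.lt_succ_of_le (Finset.sum_le_sum_of_subset (Finset.range_mono hk))
    have hIco : ∀ j ≤ m, (Finset.Ico j (m + 1)) = insert m (Finset.Ico j m) := by
      intro j hj
      ext x
      simp only [Finset.mem_Ico, Finset.mem_insert]
      omega
    rw [fold_succ]
    by_cases hS : S m
    · have hsum : ∀ j ≤ m, ∑ i ∈ (Finset.Ico j (m + 1)).filter S, I.proc i =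
          (∑ i ∈ (Finset.Ico j m).filter S, I.proc i) + I.proc m := by
        intro j hj
        rw [hIco j hj, Finset.filter_insert, if_pos hS, Finset.sum_insert (by simp), add_comm]
      have hs := Finset.sum_range_succ I.proc m
      have hQ1 := hQ (m + 1) hm
      have ht := time_mul_add (I := I) (j := j₀) (a := a) (by omega)
      have hB : ∀ j < I.n, ∀ b < I.Q, j * I.Q + b ≤ I.B - 1 := by
        intro j hj b hb
        have := Nat.mul_le_mul_right I.Q (show j + 1 ≤ I.n from hj)
        rw [add_mul, one_mul] at this
        unfold B
        omega
      rw [if_pos hS, upd]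
      by_cases hlt : I.time (I.fold S m) ≤ I.release m
      · rw [if_pos hlt, min_eq_left (hB m (by omega) _ (by omega))]
        refine ⟨⟨m, I.proc m, by omega, by omega, rfl⟩, ?_, Or.inr ⟨m, by omega, hS, ?_⟩⟩
        · intro j hj hSj
          rw [hsum j (by omega), time_mul_add (by omega)]
          rcases Nat.lt_or_eq_of_le (show j ≤ m by omega) with hj | rfl
          · have := hle j hj hSj; omega
          · simp
        · rw [hsum m le_rfl, time_mul_add (by omega)]
          simp
      · have hb : j₀ * I.Q + a + I.proc m = j₀ * I.Q + (a + I.proc m) := by ring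
        rw [if_neg hlt, he, hb, min_eq_left (hB j₀ hj₀ _ (by omega))]
        have ht' := time_mul_add (I := I) (j := j₀) (a := a + I.proc m) (by omega)
        rw [he, ht] at hlt
        refine ⟨⟨j₀, a + I.proc m, by omega, by omega, rfl⟩, ?_, ?_⟩
        · intro j hj hSj
          rw [hsum j (by omega), ht']
          rcases Nat.lt_or_eq_of_le (show j ≤ m by omega) with hj | rfl
          · have := hle j hj hSj
            rw [he, ht] at this
            omega
          · simp; omega
        · right
          rcases hor with ⟨hno, h0⟩ | ⟨j, hj, hSj, hj'⟩
          · -- with no job before, the state stands for the first release time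
            exfalso
            rw [he] at h0
            have ha0 : a = 0 := by omega
            have hj0 : j₀ = 0 := by
              have : j₀ * I.Q = 0 := by omega
              rcases Nat.mul_eq_zero.1 this with h | h
              · exact h
              · have := Q_pos (I := I); omega
            subst ha0 hj0
            exact hlt (release_le_release hI (Nat.zero_le _) (by omega))
          · refine ⟨j, by omega, hSj, ?_⟩
            rw [hsum j (by omega), ht']
            rw [he, ht] at hj'
            omega
    · have hsum : ∀ j ≤ m, ∑ i ∈ (Finset.Ico j (m + 1)).filter S, I.proc i =
          ∑ i ∈ (Finset.Ico j m).filter S, I.proc i := by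
        intro j hj
        rw [hIco j hj, Finset.filter_insert, if_neg hS]
      have hs := Finset.sum_range_succ I.proc m
      have hne : ∀ j < m + 1, S j → j < m := by
        intro j hj hSj
        rcases Nat.lt_or_eq_of_le (show j ≤ m by omega) with hj | rfl
        · exact hj
        · exact absurd hSj hS
      rw [if_neg hS]
      refine ⟨⟨j₀, a, hj₀, by omega, he⟩, fun j hj hSj => ?_, ?_⟩
      · rw [hsum j (by omega)]; exact hle j (hne j hj hSj) hSj
      · rcases hor with ⟨hno, h0⟩ | ⟨j, hj, hSj, hj'⟩
        · exact Or.inl ⟨fun j hj hSj => hno j (hne j hj hSj) hSj, h0⟩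
        · exact Or.inr ⟨j, by omega, hSj, by rw [hsum j (by omega)]; exact hj'⟩

/-- The jobs of `S`, all released until the time `t`, are completed until `t` if and only if the
processing time of those released from `s` on is at most `t - s` for all `s`. -/
theorem not_late_fold_iff (hI : I.Valid) (S : ℕ → Prop) [DecidablePred S] (t : ℕ)
    (hS : ∀ j < I.n, S j → I.release j ≤ t) :
    ¬ I.Late t (I.fold S I.n) ↔ ∀ s ≤ t,
      ∑ j ∈ (Finset.range I.n).filter (fun j => S j ∧ s ≤ I.release j), I.proc j ≤ t - s := by
  obtain ⟨-, hle, hor⟩ := fold_spec hI S I.n le_rfl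
  -- the jobs of `S` released from the release time of `j` on are those from `j` on
  have hset : ∀ j < I.n, (Finset.range I.n).filter (fun i => S i ∧ I.release j ≤ I.release i) =
      (Finset.Ico j I.n).filter S := by
    intro j hj
    ext i
    simp only [Finset.mem_filter, Finset.mem_range, Finset.mem_Ico]
    constructor
    · rintro ⟨hi, hSi, h⟩
      refine ⟨⟨?_, hi⟩, hSi⟩
      by_contra hij
      have := release_strictMono hI (show i < j by omega) hj
      omega
    · rintro ⟨⟨hji, hi⟩, hSi⟩
      exact ⟨hi, hSi, release_le_release hI hji hi⟩
  constructor
  · intro h s hs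
    rcases Finset.eq_empty_or_nonempty
      ((Finset.range I.n).filter (fun j => S j ∧ s ≤ I.release j)) with hem | hne
    · rw [hem]; simp
    · -- the first job of `S` that is released at `s` or later
      set j := ((Finset.range I.n).filter (fun j => S j ∧ s ≤ I.release j)).min' hne with hj
      have hmem := Finset.min'_mem _ hne
      rw [← hj] at hmem
      simp only [Finset.mem_filter, Finset.mem_range] at hmem
      obtain ⟨hjn, hSj, hsj⟩ := hmem
      have h1 := hle j hjn hSj
      have hsub : (Finset.range I.n).filter (fun j => S j ∧ s ≤ I.release j) ⊆
          (Finset.Ico j I.n).filter S := by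
        intro i hi
        have := Finset.min'_le _ i hi
        rw [← hj] at this
        simp only [Finset.mem_filter, Finset.mem_range, Finset.mem_Ico] at hi ⊢
        exact ⟨⟨this, hi.1⟩, hi.2.1⟩
      have h2 := Finset.sum_le_sum_of_subset (f := I.proc) hsub
      have h3 : I.time (I.fold S I.n) ≤ t := by
        rcases hor with ⟨hno, -⟩ | ⟨i, hi, hSi, hi'⟩
        · exact absurd hSj (hno j hjn)
        · by_contra hlt
          refine h ⟨not_le.1 hlt, fun h0 => ?_⟩
          have h4 : I.time (I.fold S I.n) = I.release 0 := by rw [h0]; simp [time]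
          have h5 := release_le_release hI (Nat.zero_le i) hi
          have h6 := hS i hi hSi
          omega
      omega
  · rintro h ⟨hlt, h0⟩
    rcases hor with ⟨-, h0'⟩ | ⟨j, hj, hSj, hj'⟩
    · exact h0 h0'
    · have h1 := hS j hj hSj
      have h2 := h (I.release j) h1
      rw [hset j hj] at h2
      omega

/-- The time `t` is not late if and only if the jobs that are not selected at `t` leave no demand
`d([s, t])` unsatisfied. -/
theorem not_late_run_iff (hI : I.Valid) (κ : ℕ → ℕ → ℕ) (t : ℕ) :
    ¬ I.Late t (I.run κ t I.depth I.n 0) ↔ ∀ s ≤ t,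
      ∑ j ∈ (Finset.range I.n).filter (fun j => (∃ L ≤ I.depth, I.Unsel κ t L j) ∧
        s ≤ I.release j), I.proc j ≤ t - s := by
  have h0 : I.fold (fun j => ∃ L' ≤ I.depth, I.Unsel κ t L' j ∧
      (I.depth < L' ∨ I.depth = L' ∧ j < I.n - I.n)) I.n = 0 := by
    rw [fold_eq_of_forall_not (Nat.zero_le _)]
    · rfl
    · rintro j - - ⟨L', hL', -, h | h⟩ <;> omega
  have := run_fold hI κ t I.depth I.n le_rfl le_rfl
  rw [h0] at this
  rw [this, not_late_fold_iff hI]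
  rintro j - ⟨L, -, h⟩
  exact (start_mono_right hI (Nat.zero_le L)).trans h.1

end CoverInstance

/-! ### The list of rectangles -/

theorem length_flatMap_range {α : Type*} (f : ℕ → List α) (m : ℕ) :
    ((List.range m).flatMap f).length = ∑ x ∈ Finset.range m, (f x).length := by
  induction m with
  | zero => simp
  | succ m ih => simp [List.range_succ, List.flatMap_append, ih, Finset.sum_range_succ]

theorem getElem?_flatMap_range {α : Type*} (f : ℕ → List α) {m k i : ℕ} (hk : k < m)
    (hi : i < (f k).length) :
    ((List.range m).flatMap f)[(∑ x ∈ Finset.range k, (f x).length) + i]? = (f k)[i]? := by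
  have hlen := length_flatMap_range f
  induction m with
  | zero => omega
  | succ m ih =>
    rw [List.range_succ, List.flatMap_append]
    rcases Nat.lt_or_eq_of_le (Nat.le_of_lt_succ hk) with h | rfl
    · rw [List.getElem?_append_left, ih h]
      rw [hlen]
      have := Finset.sum_le_sum_of_subset (f := fun x => (f x).length)
        (Finset.range_mono (show k + 1 ≤ m from h))
      rw [Finset.sum_range_succ] at this
      omega
    · rw [List.getElem?_append_right (by rw [hlen]; omega), hlen, Nat.add_sub_cancel_left]
      simp

theorem flatMap_finRange_eq {α : Type*} {n : ℕ} (f : Fin n → List α) :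
    (List.finRange n).flatMap f =
      (List.range n).flatMap fun j => if h : j < n then f ⟨j, h⟩ else [] := by
  rw [← List.map_coe_finRange_eq_range, List.flatMap_map]
  simp

theorem flatMap_range_ite_eq {α : Type*} (l : List α) (c m : ℕ) :
    ((List.range m).flatMap fun i => if c = i then l else []) = if c < m then l else [] := by
  induction m with
  | zero => simp
  | succ m ih =>
    rw [List.range_succ, List.flatMap_append, ih]
    by_cases h : c < m
    · simp [h, show c ≠ m by omega, show c < m + 1 by omega]
    · by_cases h' : c = m
      · simp [h']
      · simp [h, h', show ¬ c < m + 1 by omega]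

namespace CoverInstance

variable (I : CoverInstance)

/-- The `i`-th rectangle of the group of height `L` of the job `j`. -/
def rect (j : Fin I.n) (L i : ℕ) : Rect I.n :=
  ⟨j, I.start j L + i * I.hseg L, I.start j L + (i + 1) * I.hseg L⟩

/-- The rectangles of the group of height `L` of the job `j`. -/
def block (j : Fin I.n) (L : ℕ) : List (Rect I.n) := (List.range (I.cnt j L)).map (I.rect j L)

variable {I}

theorem len_eq (ℓ : ℕ) : I.len ℓ = I.hlen (I.depth - ℓ) := rfl

theorem len_zero_eq : I.len 0 = I.hlen I.depth := rfl

theorem segLen_eq {ℓ : ℕ} (h : ℓ ≤ I.depth) : I.segLen ℓ = I.hseg (I.depth - ℓ) := by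
  unfold segLen hseg
  by_cases h2 : ℓ + 2 ≤ I.depth
  · rw [if_pos h2, if_pos (by omega), len_eq, Nat.sub_sub]
  · rw [if_neg h2, if_neg (by omega)]

theorem release_val (j : Fin I.n) : I.release j = I.r j := by simp [release]

theorem proc_val (j : Fin I.n) : I.proc j = I.p j := by simp [proc]

theorem front_eq (j : Fin I.n) {d : ℕ} (hd : d ≤ I.depth) : I.front j d = I.start j d := by
  induction d with
  | zero => rw [front, start, release_val]
  | succ d ih =>
    rw [front, start, ih (by omega), len_eq, len_zero_eq, Nat.sub_sub_self (by omega)]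

theorem mem_cells {C : GridCell} : C ∈ I.cells ↔ C.level ≤ I.depth ∧ C.idx < I.K ^ C.level := by
  simp only [cells, List.mem_flatMap, List.mem_reverse, List.mem_range, List.mem_map]
  constructor
  · rintro ⟨ℓ, hℓ, i, hi, rfl⟩
    exact ⟨by simpa using Nat.lt_succ_iff.1 hℓ, hi⟩
  · rintro ⟨h1, h2⟩
    exact ⟨C.level, by omega, C.idx, h2, rfl⟩

theorem hlen_depth_eq {L : ℕ} (h : L ≤ I.depth) :
    I.hlen I.depth = I.K ^ (I.depth - L) * I.hlen L := by
  rw [hlen, hlen, show I.K ^ I.depth = I.K ^ L * I.K ^ (I.depth - L) by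
    rw [← pow_add]; congr 1; omega]
  ring

theorem start_div_lt_iff (hI : I.Valid) {j L : ℕ} (h : L ≤ I.depth) :
    I.start j L / I.hlen L < I.K ^ (I.depth - L) ↔ I.start j L < I.hlen I.depth := by
  rw [Nat.div_lt_iff_lt_mul (hI.hlen_pos L), hlen_depth_eq h]

theorem rectsOf_eq (hI : I.Valid) (j : Fin I.n) {ℓ : ℕ} (hℓ : ℓ ≤ I.depth) {i : ℕ}
    (hi : i < I.K ^ ℓ) : I.rectsOf j ⟨ℓ, i⟩ =
      if I.start j (I.depth - ℓ) / I.hlen (I.depth - ℓ) = i then I.block j (I.depth - ℓ)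
      else [] := by
  unfold rectsOf
  simp only [front_eq j (Nat.sub_le I.depth ℓ), segLen_eq hℓ, cellBeg, cellEnd, len_eq]
  set L := I.depth - ℓ with hL
  have hL' : L ≤ I.depth := Nat.sub_le _ _
  have hiff : (i * I.hlen L ≤ I.start j L ∧ I.start j L < (i + 1) * I.hlen L) ↔
      I.start j L / I.hlen L = i := by
    rw [← Nat.le_div_iff_mul_le (hI.hlen_pos L), ← Nat.div_lt_iff_lt_mul (hI.hlen_pos L)]
    omega
  simp only [hiff]
  split_ifs with h
  · have hlt : I.start j L < I.hlen I.depth := by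
      rw [← start_div_lt_iff hI hL', h, hL, Nat.sub_sub_self hℓ]; exact hi
    have h1 : ((i + 1) * I.hlen L - I.start j L) / I.hseg L = I.cnt j L := by
      rw [← h, ← start_succ_of_lt hI hL' hlt, ← start_add_cnt hI hL', Nat.add_sub_cancel_left,
        Nat.mul_div_cancel _ (hI.hseg_pos L)]
    rw [h1]
    rfl
  · rfl

theorem flatMap_cells (hI : I.Valid) (j : Fin I.n) :
    (I.cells.flatMap fun C => I.rectsOf j C) =
      (List.range (I.depth + 1)).flatMap (I.block j) := by
  have hrev : (List.range (I.depth + 1)).reverse =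
      (List.range (I.depth + 1)).map fun L => I.depth - L := by
    refine List.ext_getElem (by simp) fun i h1 h2 => ?_
    simp
  rw [cells, List.flatMap_assoc, hrev, List.flatMap_map]
  refine List.flatMap_congr fun L hL => ?_
  have hL : L ≤ I.depth := Nat.lt_succ_iff.1 (List.mem_range.1 hL)
  rw [List.flatMap_map]
  rw [List.flatMap_congr (g := fun i => if I.start j L / I.hlen L = i then I.block j L else [])]
  · simp only [flatMap_range_ite_eq, start_div_lt_iff hI hL]
    split_ifs with h
    · rfl
    · rw [block, cnt, if_neg h]; rfl
  · intro i hi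
    rw [rectsOf_eq hI j (Nat.sub_le _ _) (List.mem_range.1 hi), Nat.sub_sub_self hL]

theorem rects_eq (hI : I.Valid) : I.rects =
    (List.finRange I.n).flatMap fun j => (List.range (I.depth + 1)).flatMap (I.block j) := by
  unfold rects
  exact List.flatMap_congr fun j _ => flatMap_cells hI j

variable (I) in
/-- The number of all rectangles. -/
def numRects : ℕ := I.blockStart I.n 0

theorem length_flatMap_block (j : Fin I.n) :
    ((List.range (I.depth + 1)).flatMap (I.block j)).length =
      ∑ L ∈ Finset.range (I.depth + 1), I.cnt j L := by
  rw [length_flatMap_range]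
  simp [block]

theorem length_rects (hI : I.Valid) : I.rects.length = I.numRects := by
  rw [rects_eq hI, List.length_flatMap, numRects, blockStart, Finset.sum_range_zero, add_zero,
    Finset.sum_range]
  simp only [length_flatMap_block]
  exact (List.sum_ofFn (f := fun j : Fin I.n => ∑ L ∈ Finset.range (I.depth + 1), I.cnt j L)) ▸ by
    rw [List.ofFn_eq_map]

theorem getElem?_rects (hI : I.Valid) (j : Fin I.n) {L i : ℕ} (hL : L ≤ I.depth)
    (hi : i < I.cnt j L) : I.rects[I.blockStart j L + i]? = some (I.rect j L i) := by
  have hblock : (I.block j L)[i]? = some (I.rect j L i) := by simp [block, hi]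
  have h1 : ∀ j' : ℕ, j' ≤ I.n → (∑ j'' ∈ Finset.range j', (if h : j'' < I.n then
      (List.range (I.depth + 1)).flatMap (I.block ⟨j'', h⟩) else []).length) =
      ∑ j'' ∈ Finset.range j', ∑ L ∈ Finset.range (I.depth + 1), I.cnt j'' L := by
    intro j' hj'
    refine Finset.sum_congr rfl fun j'' h => ?_
    rw [dif_pos (by rw [Finset.mem_range] at h; omega), length_flatMap_block]
  have h2 := getElem?_flatMap_range (I.block j) (k := L) (m := I.depth + 1) (by omega)
    (by simpa [block] using hi)
  rw [hblock] at h2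
  have h3 : (∑ x ∈ Finset.range L, (I.block j x).length) = ∑ x ∈ Finset.range L, I.cnt j x := by
    simp [block]
  rw [h3] at h2
  rw [rects_eq hI, flatMap_finRange_eq, blockStart, ← h1 j j.2.le, add_assoc,
    getElem?_flatMap_range _ j.2]
  · simpa using h2
  · rw [dif_pos j.2]
    exact (List.getElem?_eq_some_iff.1 h2).1

theorem mem_rects (hI : I.Valid) {R : Rect I.n} :
    R ∈ I.rects ↔ ∃ j : Fin I.n, ∃ L ≤ I.depth, ∃ i < I.cnt j L, R = I.rect j L i := by
  rw [rects_eq hI]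
  simp [block, eq_comm]

theorem rect_inj (hI : I.Valid) {j j' : Fin I.n} {L L' i i' : ℕ} (hL : L ≤ I.depth)
    (hL' : L' ≤ I.depth) (hi : i < I.cnt j L) (hi' : i' < I.cnt j' L')
    (h : I.rect j L i = I.rect j' L' i') : j = j' ∧ L = L' ∧ i = i' := by
  simp only [rect, Rect.mk.injEq] at h
  obtain ⟨rfl, h, -⟩ := h
  have hlt : ∀ {L i}, L ≤ I.depth → i < I.cnt j L →
      I.start j L + i * I.hseg L < I.start j (L + 1) := by
    intro L i hL hi
    rw [← start_add_cnt hI hL]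
    have := Nat.mul_lt_mul_of_pos_right hi (hI.hseg_pos L)
    omega
  have h1 := hlt hL hi
  have h2 := hlt hL' hi'
  have hLL : L = L' := by
    rcases lt_trichotomy L L' with hlt' | rfl | hlt'
    · have := start_mono_right (j := j) hI (show L + 1 ≤ L' from hlt'); omega
    · rfl
    · have := start_mono_right (j := j) hI (show L' + 1 ≤ L from hlt'); omega
  subst hLL
  exact ⟨rfl, rfl, Nat.eq_of_mul_eq_mul_right (hI.hseg_pos L) (by omega)⟩

/-! ### Solutions and choices -/

variable (I) in
/-- The triples of a job, a height and a number that describe the selected rectangles. -/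
def choiceIndex (κ : ℕ → ℕ → ℕ) : Finset (Σ _ : Fin I.n, Σ _ : ℕ, ℕ) :=
  Finset.univ.sigma fun j => (Finset.range (I.depth + 1)).sigma fun L => Finset.range (κ L j)

variable (I) in
/-- The set of rectangles that consists of the first `κ L j` rectangles of the group of height `L`
of the job `j`, for all `L` and `j`. -/
noncomputable def sol (κ : ℕ → ℕ → ℕ) : Finset (Rect I.n) :=
  (I.choiceIndex κ).image fun x => I.rect x.1 x.2.1 x.2.2

theorem mem_sol {κ : ℕ → ℕ → ℕ} {R : Rect I.n} :
    R ∈ I.sol κ ↔ ∃ j : Fin I.n, ∃ L ≤ I.depth, ∃ i < κ L j, R = I.rect j L i := by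
  simp only [sol, choiceIndex, Finset.mem_image, Finset.mem_sigma, Finset.mem_univ, true_and,
    Finset.mem_range, Nat.lt_succ_iff, Sigma.exists]
  constructor
  · rintro ⟨j, L, i, ⟨hL, hi⟩, rfl⟩; exact ⟨j, L, hL, i, hi, rfl⟩
  · rintro ⟨j, L, hL, i, hi, rfl⟩; exact ⟨j, L, i, ⟨hL, hi⟩, rfl⟩

theorem injOn_rect (hI : I.Valid) {κ : ℕ → ℕ → ℕ} (hκ : ∀ L j, κ L j ≤ I.cnt j L) :
    Set.InjOn (fun x : Σ _ : Fin I.n, Σ _ : ℕ, ℕ => I.rect x.1 x.2.1 x.2.2)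
      (I.choiceIndex κ) := by
  rintro ⟨j, L, i⟩ hx ⟨j', L', i'⟩ hx' h
  simp only [choiceIndex, Finset.coe_sigma, Finset.mem_coe, Finset.mem_univ,
    true_and, Finset.mem_range, Nat.lt_succ_iff, Set.mem_sigma_iff] at hx hx'
  obtain ⟨rfl, rfl, rfl⟩ := rect_inj hI hx.1 hx'.1 (hx.2.trans_le (hκ _ _))
    (hx'.2.trans_le (hκ _ _)) h
  rfl

theorem sum_sol {M : Type*} [AddCommMonoid M] (hI : I.Valid) {κ : ℕ → ℕ → ℕ}
    (hκ : ∀ L j, κ L j ≤ I.cnt j L) (f : Rect I.n → M) :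
    ∑ R ∈ I.sol κ, f R = ∑ j : Fin I.n, ∑ L ∈ Finset.range (I.depth + 1),
      ∑ i ∈ Finset.range (κ L j), f (I.rect j L i) := by
  rw [sol, Finset.sum_image (injOn_rect hI hκ), choiceIndex, Finset.sum_sigma]
  refine Finset.sum_congr rfl fun j _ => ?_
  rw [Finset.sum_sigma]

theorem rect_mem_sol (hI : I.Valid) {κ : ℕ → ℕ → ℕ} (hκ : ∀ L j, κ L j ≤ I.cnt j L) {j : Fin I.n}
    {L i : ℕ} (hL : L ≤ I.depth) (hi : i < I.cnt j L) : I.rect j L i ∈ I.sol κ ↔ i < κ L j := by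
  rw [mem_sol]
  constructor
  · rintro ⟨j', L', hL', i', hi', h⟩
    obtain ⟨rfl, rfl, rfl⟩ := rect_inj hI hL hL' hi (hi'.trans_le (hκ _ _)) h
    exact hi'
  · exact fun h => ⟨j, L, hL, i, h, rfl⟩

theorem take_block (j : Fin I.n) (L k : ℕ) :
    (I.block j L).take k = (List.range (min k (I.cnt j L))).map (I.rect j L) := by
  rw [block, ← List.map_take, List.take_range]

/-- Every feasible solution is given by a choice of prefixes. -/
theorem exists_eq_sol (hI : I.Valid) {Y : Finset (Rect I.n)} (hY : I.IsFeasible Y) :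
    ∃ κ : ℕ → ℕ → ℕ, (∀ L j, κ L j ≤ I.cnt j L) ∧ Y = I.sol κ := by
  have h : ∀ (j : Fin I.n) (L : ℕ), ∃ k ≤ I.cnt j L, L ≤ I.depth →
      ∀ i < I.cnt j L, I.rect j L i ∈ Y ↔ i < k := by
    intro j L
    by_cases hL : L ≤ I.depth ∧ 0 < I.cnt j L
    · obtain ⟨hL, hpos⟩ := hL
      have hC := (start_div_lt_iff hI (j := j) hL).2 (start_lt_of_cnt_pos hpos)
      obtain ⟨k, hk⟩ := hY.isPrefix j ⟨I.depth - L, I.start j L / I.hlen L⟩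
        (mem_cells.2 ⟨Nat.sub_le _ _, hC⟩)
      rw [rectsOf_eq hI j (Nat.sub_le _ _) hC, Nat.sub_sub_self hL, if_pos rfl, take_block] at hk
      refine ⟨min k (I.cnt j L), min_le_right _ _, fun _ i hi => ?_⟩
      rw [hk _ (by simpa [block] using ⟨i, hi, rfl⟩)]
      simp only [List.mem_map, List.mem_range]
      constructor
      · rintro ⟨i', hi', h⟩
        obtain ⟨-, -, rfl⟩ := rect_inj hI hL hL (by omega) hi h
        exact hi'
      · exact fun h => ⟨i, h, rfl⟩
    · exact ⟨0, Nat.zero_le _, fun hL' i hi => absurd ⟨hL', by omega⟩ hL⟩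
  choose κ hκ hκ' using h
  have hle : ∀ L j, (if h : j < I.n then κ ⟨j, h⟩ L else 0) ≤ I.cnt j L := by
    intro L j
    split_ifs with h
    · exact hκ ⟨j, h⟩ L
    · exact Nat.zero_le _
  refine ⟨fun L j => if h : j < I.n then κ ⟨j, h⟩ L else 0, hle, ?_⟩
  ext R
  constructor
  · intro hR
    obtain ⟨j, L, hL, i, hi, rfl⟩ := (mem_rects hI).1 (hY.subset R hR)
    refine (rect_mem_sol hI hle hL hi).2 ?_
    simpa using (hκ' j L hL i hi).1 hR
  · intro hR
    obtain ⟨j, L, hL, i, hi, rfl⟩ := mem_sol.1 hR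
    have hi' : i < κ j L := by simpa using hi
    exact (hκ' j L hL i (hi'.trans_le (hκ j L))).2 hi'

theorem sol_subset_rects (hI : I.Valid) {κ : ℕ → ℕ → ℕ} (hκ : ∀ L j, κ L j ≤ I.cnt j L) :
    ∀ R ∈ I.sol κ, R ∈ I.rects := by
  intro R hR
  obtain ⟨j, L, hL, i, hi, rfl⟩ := mem_sol.1 hR
  exact (mem_rects hI).2 ⟨j, L, hL, i, hi.trans_le (hκ _ _), rfl⟩

theorem sol_isPrefix (hI : I.Valid) {κ : ℕ → ℕ → ℕ} (hκ : ∀ L j, κ L j ≤ I.cnt j L) (j : Fin I.n)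
    {C : GridCell} (hC : C ∈ I.cells) :
    ∃ k, ∀ R ∈ I.rectsOf j C, R ∈ I.sol κ ↔ R ∈ (I.rectsOf j C).take k := by
  obtain ⟨h1, h2⟩ := mem_cells.1 hC
  rw [show C = ⟨C.level, C.idx⟩ from rfl, rectsOf_eq hI j h1 h2]
  refine ⟨κ (I.depth - C.level) j, fun R hR => ?_⟩
  split_ifs at hR ⊢
  · rw [take_block, min_eq_left (hκ _ _)]
    simp only [block, List.mem_map, List.mem_range] at hR ⊢
    obtain ⟨i, hi, rfl⟩ := hR
    rw [rect_mem_sol hI hκ (Nat.sub_le _ _) hi]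
    constructor
    · exact fun h => ⟨i, h, rfl⟩
    · rintro ⟨i', hi', h⟩
      obtain ⟨-, -, rfl⟩ := rect_inj hI (Nat.sub_le _ _) (Nat.sub_le _ _)
        (hi'.trans_le (hκ _ _)) hi h
      exact hi'
  · simp at hR

theorem firstJob_le_iff (hI : I.Valid) (s : ℕ) (j : Fin I.n) : I.firstJob s ≤ j ↔ s ≤ I.r j := by
  unfold firstJob
  constructor
  · intro h
    by_contra hlt
    have : Finset.Iic j ⊆ Finset.univ.filter fun j => I.r j < s := by
      intro i hi
      simp only [Finset.mem_filter, Finset.mem_univ, true_and]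
      exact (hI.strictMono_r.monotone (Finset.mem_Iic.1 hi)).trans_lt (not_le.1 hlt)
    have := Finset.card_le_card this
    rw [Fin.card_Iic] at this
    omega
  · intro h
    have : (Finset.univ.filter fun j => I.r j < s) ⊆ Finset.Iio j := by
      intro i hi
      simp only [Finset.mem_filter, Finset.mem_univ, true_and] at hi
      exact Finset.mem_Iio.2 (hI.strictMono_r.lt_iff_lt.1 (hi.trans_le h))
    simpa using Finset.card_le_card this

theorem region_inter_ray_nonempty_iff (hI : I.Valid) (R : Rect I.n) (s t : ℕ) :
    (R.region ∩ I.ray s t).Nonempty ↔ s ≤ I.r R.job ∧ R.lo ≤ t ∧ t < R.hi := by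
  rw [← firstJob_le_iff hI]
  constructor
  · rintro ⟨⟨x, y⟩, ⟨⟨h1, h2⟩, -, h3⟩, h4, h5⟩
    simp only [Set.mem_singleton_iff, Set.mem_Ici] at h1 h2 h3 h4 h5
    subst h4
    have a1 : (R.lo : ℝ) < ((t + 1 : ℕ) : ℝ) := by push_cast; linarith
    have a2 : (t : ℝ) < R.hi := by linarith
    have a3 : (I.firstJob s : ℝ) < (((R.job : ℕ) + 1 : ℕ) : ℝ) := by push_cast; linarith
    have b1 := Nat.cast_lt.1 a1
    have b2 := Nat.cast_lt.1 a2
    have b3 := Nat.cast_lt.1 a3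
    omega
  · rintro ⟨h1, h2, h3⟩
    have a1 : (I.firstJob s : ℝ) ≤ ((R.job : ℕ) : ℝ) := Nat.cast_le.2 h1
    have a2 : (R.lo : ℝ) ≤ t := Nat.cast_le.2 h2
    have a3 : (((t + 1 : ℕ) : ℕ) : ℝ) ≤ R.hi := Nat.cast_le.2 h3
    push_cast at a3
    refine ⟨((t : ℝ) + 1 / 2, ((R.job : ℕ) : ℝ) + 1 / 2), ⟨⟨?_, ?_⟩, ?_, ?_⟩, rfl, ?_⟩ <;>
      simp only [Set.mem_Ici] <;> linarith

end CoverInstance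

/-! ### Feasibility -/

namespace CoverInstance

variable {I : CoverInstance}

theorem sum_indicator_Ico (a w k t : ℕ) :
    ∑ i ∈ Finset.range k, (if a + i * w ≤ t ∧ t < a + (i + 1) * w then 1 else 0) =
      if a ≤ t ∧ t < a + k * w then 1 else 0 := by
  induction k with
  | zero => simp
  | succ k ih =>
    rw [Finset.sum_range_succ, ih, add_mul, one_mul]
    split_ifs <;> first | rfl | omega

/-- At each time after its release a job has exactly one group. -/
theorem sum_indicator_groups (hI : I.Valid) (j m t : ℕ) :
    ∑ L ∈ Finset.range m, (if I.start j L ≤ t ∧ t < I.start j (L + 1) then 1 else 0) =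
      if I.release j ≤ t ∧ t < I.start j m then 1 else 0 := by
  induction m with
  | zero =>
    rw [Finset.sum_range_zero, if_neg]
    rw [start]; omega
  | succ m ih =>
    have h1 : I.release j ≤ I.start j m := start_mono_right hI (Nat.zero_le m)
    have h2 := start_le_succ (j := j) (L := m) hI
    rw [Finset.sum_range_succ, ih]
    split_ifs <;> first | rfl | omega

/-- A job that is released until the time `t` is either selected or not. -/
theorem sum_sel_add_unsel (hI : I.Valid) {κ : ℕ → ℕ → ℕ} (hκ : ∀ L j, κ L j ≤ I.cnt j L) (j : ℕ)
    {t : ℕ} (ht : t < I.hlen I.depth) :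
    (∑ L ∈ Finset.range (I.depth + 1), ∑ i ∈ Finset.range (κ L j),
      if I.start j L + i * I.hseg L ≤ t ∧ t < I.start j L + (i + 1) * I.hseg L then 1 else 0) +
      (if ∃ L ≤ I.depth, I.Unsel κ t L j then 1 else 0) = if I.release j ≤ t then 1 else 0 := by
  simp only [sum_indicator_Ico]
  have h1 := sum_indicator_groups hI j (I.depth + 1) t
  rw [start_depth_succ hI] at h1
  simp only [ht, and_true] at h1
  have h2 : ∀ L ∈ Finset.range (I.depth + 1),
      (if I.start j L ≤ t ∧ t < I.start j (L + 1) then 1 else 0) =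
      (if I.start j L ≤ t ∧ t < I.start j L + κ L j * I.hseg L then 1 else 0) +
      (if I.Unsel κ t L j then 1 else 0) := by
    intro L hL
    have h3 := start_add_cnt (j := j) hI (Nat.lt_succ_iff.1 (Finset.mem_range.1 hL))
    have h4 := Nat.mul_le_mul_right (I.hseg L) (hκ L j)
    by_cases hu : I.Unsel κ t L j
    · rw [if_pos hu]
      unfold Unsel at hu
      split_ifs <;> omega
    · rw [if_neg hu]
      unfold Unsel at hu
      split_ifs <;> omega
  rw [Finset.sum_congr rfl h2, Finset.sum_add_distrib] at h1
  rw [← h1]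
  congr 1
  by_cases h : ∃ L ≤ I.depth, I.Unsel κ t L j
  · rw [if_pos h]
    obtain ⟨L, hL, h⟩ := h
    have h5 : (if I.Unsel κ t L j then 1 else 0) ≤
        ∑ L ∈ Finset.range (I.depth + 1), if I.Unsel κ t L j then 1 else 0 :=
      Finset.single_le_sum (f := fun L => if I.Unsel κ t L j then 1 else 0)
        (fun _ _ => Nat.zero_le _) (Finset.mem_range.2 (Nat.lt_succ_of_le hL))
    rw [if_pos h] at h5
    have h6 : (if I.release j ≤ t then 1 else 0) ≤ 1 := by split_ifs <;> omega
    omega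
  · rw [if_neg h]
    refine (Finset.sum_eq_zero fun L hL => if_neg fun h' => h ⟨L, ?_, h'⟩).symm
    exact Nat.lt_succ_iff.1 (Finset.mem_range.1 hL)

theorem covered_add_unsel (hI : I.Valid) {κ : ℕ → ℕ → ℕ} (hκ : ∀ L j, κ L j ≤ I.cnt j L) (s : ℕ)
    {t : ℕ} (ht : t < I.hlen I.depth) :
    I.covered (I.sol κ) s t + ∑ j ∈ (Finset.range I.n).filter (fun j =>
      (∃ L ≤ I.depth, I.Unsel κ t L j) ∧ s ≤ I.release j), I.proc j =
    ∑ j ∈ Finset.univ.filter (fun j => s ≤ I.r j ∧ I.r j ≤ t), I.p j := by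
  classical
  rw [covered, Finset.sum_filter, sum_sol hI hκ, Finset.sum_filter, Finset.sum_filter,
    Finset.sum_range, ← Finset.sum_add_distrib]
  refine Finset.sum_congr rfl fun j _ => ?_
  simp only [region_inter_ray_nonempty_iff hI, rect, release_val, proc_val]
  by_cases hs : s ≤ I.r j
  · have h := congrArg (fun x => x * I.p j) (sum_sel_add_unsel hI hκ j ht)
    rw [add_mul] at h
    simp only [Finset.sum_mul, ite_mul, one_mul, zero_mul, release_val] at h
    simpa [hs] using h
  · simp [hs]

theorem demand_nonpos (I : CoverInstance) {s t : ℕ} (hs : s ≤ t) (ht : I.T ≤ t) :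
    I.demand s t ≤ 0 := by
  have h1 : ∑ j ∈ Finset.univ.filter (fun j => s ≤ I.r j ∧ I.r j ≤ t), I.p j ≤ ∑ j, I.p j :=
    Finset.sum_le_sum_of_subset (Finset.filter_subset _ _)
  rw [demand, ← Nat.cast_sum]
  unfold T at ht
  rcases Finset.eq_empty_or_nonempty (Finset.univ.filter (fun j => s ≤ I.r j ∧ I.r j ≤ t)) with
    h | ⟨j, hj⟩
  · rw [h]; simp; omega
  · simp only [Finset.mem_filter, Finset.mem_univ, true_and] at hj
    have := Finset.le_sup (f := I.r) (Finset.mem_univ j)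
    omega

/-- A choice of prefixes is feasible if and only if no time is late. -/
theorem isFeasible_sol_iff (hI : I.Valid) {κ : ℕ → ℕ → ℕ} (hκ : ∀ L j, κ L j ≤ I.cnt j L) :
    I.IsFeasible (I.sol κ) ↔ ∀ t < I.hlen I.depth, ¬ I.Late t (I.run κ t I.depth I.n 0) := by
  have key : ∀ s t, s ≤ t → t < I.hlen I.depth → (I.demand s t ≤ (I.covered (I.sol κ) s t : ℤ) ↔
      ∑ j ∈ (Finset.range I.n).filter (fun j => (∃ L ≤ I.depth, I.Unsel κ t L j) ∧
        s ≤ I.release j), I.proc j ≤ t - s) := by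
    intro s t hs ht
    have h := covered_add_unsel hI hκ s ht
    rw [demand, ← Nat.cast_sum, ← h]
    omega
  constructor
  · intro h t ht
    rw [not_late_run_iff hI]
    intro s hs
    rw [← key s t hs ht]
    by_cases htT : t ≤ I.T
    · exact h.covers s t hs htT
    · exact (demand_nonpos I hs (by omega)).trans (Nat.cast_nonneg _)
  · intro h
    refine ⟨sol_subset_rects hI hκ, fun j C hC => sol_isPrefix hI hκ j hC, fun s t hs ht => ?_⟩
    rcases Nat.lt_or_ge t I.T with htT | htT
    · have ht' : t < I.hlen I.depth := htT.trans_le hI.T_le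
      exact (key s t hs ht').2 ((not_late_run_iff hI κ t).1 (h t ht') s hs)
    · exact (demand_nonpos I hs htT).trans (Nat.cast_nonneg _)

/-! ### Optimality -/

variable (I) in
/-- The total weight of a choice. -/
def weight (w : ℕ → ℕ) (κ : ℕ → ℕ → ℕ) : ℕ :=
  ∑ j : Fin I.n, ∑ L ∈ Finset.range (I.depth + 1), ∑ i ∈ Finset.range (κ L j),
    w (I.blockStart j L + i)

variable (I) in
/-- The minimum of weight plus penalty over all choices, with a penalty that exceeds all weights. -/
def optVal (w : ℕ → ℕ) : ℕ :=
  I.val w (1 + ∑ i ∈ Finset.range I.numRects, w i) I.depth I.n 0 0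

theorem blockStart_add_lt (hI : I.Valid) (j : Fin I.n) {L i : ℕ} (hL : L ≤ I.depth)
    (hi : i < I.cnt j L) : I.blockStart j L + i < I.numRects := by
  rw [← length_rects hI]
  exact (List.getElem?_eq_some_iff.1 (getElem?_rects hI j hL hi)).1

theorem injOn_blockStart (hI : I.Valid) {κ : ℕ → ℕ → ℕ} (hκ : ∀ L j, κ L j ≤ I.cnt j L) :
    Set.InjOn (fun x : Σ _ : Fin I.n, Σ _ : ℕ, ℕ => I.blockStart x.1 x.2.1 + x.2.2)
      (I.choiceIndex κ) := by
  rintro ⟨j, L, i⟩ hx ⟨j', L', i'⟩ hx' h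
  refine injOn_rect hI hκ hx hx' ?_
  simp only [choiceIndex, Finset.coe_sigma, Finset.mem_coe, Finset.mem_univ,
    true_and, Finset.mem_range, Nat.lt_succ_iff, Set.mem_sigma_iff] at hx hx' h
  have h1 := getElem?_rects hI j hx.1 (hx.2.trans_le (hκ _ _))
  have h2 := getElem?_rects hI j' hx'.1 (hx'.2.trans_le (hκ _ _))
  rw [h, h2] at h1
  exact (Option.some.inj h1).symm

variable (I) in
/-- The positions, in the list of all rectangles, of the rectangles selected by a choice. -/
def selIndex (κ : ℕ → ℕ → ℕ) : Finset ℕ :=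
  (I.choiceIndex κ).image fun x => I.blockStart x.1 x.2.1 + x.2.2

theorem weight_eq_sum_selIndex (hI : I.Valid) {κ : ℕ → ℕ → ℕ} (hκ : ∀ L j, κ L j ≤ I.cnt j L)
    (w : ℕ → ℕ) : I.weight w κ = ∑ i ∈ I.selIndex κ, w i := by
  rw [selIndex, Finset.sum_image (injOn_blockStart hI hκ), choiceIndex, Finset.sum_sigma, weight]
  refine Finset.sum_congr rfl fun j _ => ?_
  rw [Finset.sum_sigma]

theorem mem_selIndex {κ : ℕ → ℕ → ℕ} {x : ℕ} : x ∈ I.selIndex κ ↔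
    ∃ j : Fin I.n, ∃ L ≤ I.depth, ∃ i < κ L j, x = I.blockStart j L + i := by
  simp only [selIndex, choiceIndex, Finset.mem_image, Finset.mem_sigma, Finset.mem_univ, true_and,
    Finset.mem_range, Nat.lt_succ_iff, Sigma.exists]
  constructor
  · rintro ⟨j, L, i, ⟨hL, hi⟩, rfl⟩; exact ⟨j, L, hL, i, hi, rfl⟩
  · rintro ⟨j, L, hL, i, hi, rfl⟩; exact ⟨j, L, i, ⟨hL, hi⟩, rfl⟩

theorem selIndex_subset (hI : I.Valid) {κ : ℕ → ℕ → ℕ} (hκ : ∀ L j, κ L j ≤ I.cnt j L) :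
    I.selIndex κ ⊆ Finset.range I.numRects := by
  intro x hx
  obtain ⟨j, L, hL, i, hi, rfl⟩ := mem_selIndex.1 hx
  exact Finset.mem_range.2 (blockStart_add_lt hI j hL (hi.trans_le (hκ _ _)))

/-- An output that flags the positions of the rectangles selected by a choice describes the
corresponding solution. -/
theorem selected_eq_sol (hI : I.Valid) {κ : ℕ → ℕ → ℕ} (hκ : ∀ L j, κ L j ≤ I.cnt j L)
    {out : ℕ → ℕ} (hout : ∀ i < I.numRects, out i ≠ 0 ↔ i ∈ I.selIndex κ) :
    I.selected out = I.sol κ := by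
  have hget : ∀ (j : Fin I.n) (L i : ℕ), L ≤ I.depth → i < κ L j →
      ∀ h : I.blockStart j L + i < I.rects.length,
      I.rects.get ⟨I.blockStart j L + i, h⟩ = I.rect j L i := by
    intro j L i hL hi h
    have := getElem?_rects hI j hL (hi.trans_le (hκ _ _))
    rw [List.getElem?_eq_getElem h] at this
    exact Option.some.inj this
  ext R
  simp only [selected, Finset.mem_image, Finset.mem_filter, Finset.mem_univ, true_and]
  rw [mem_sol]
  constructor
  · rintro ⟨⟨x, hx⟩, h, rfl⟩
    obtain ⟨j, L, hL, i, hi, rfl⟩ := mem_selIndex.1 ((hout x (by rwa [← length_rects hI])).1 h)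
    exact ⟨j, L, hL, i, hi, hget j L i hL hi _⟩
  · rintro ⟨j, L, hL, i, hi, rfl⟩
    have hlt := blockStart_add_lt hI j hL (hi.trans_le (hκ _ _))
    refine ⟨⟨I.blockStart j L + i, by rwa [length_rects hI]⟩, ?_, hget j L i hL hi _⟩
    exact (hout _ hlt).2 (mem_selIndex.2 ⟨j, L, hL, i, hi, rfl⟩)

theorem phi_root_eq (hI : I.Valid) (w : ℕ → ℕ) (pen : ℕ) {κ : ℕ → ℕ → ℕ}
    (hκ : ∀ L j, κ L j ≤ I.cnt j L) :
    I.phi w pen κ I.depth I.n 0 0 = I.weight w κ + ∑ t ∈ Finset.range (I.hlen I.depth),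
      if I.Late t (I.run κ t I.depth I.n 0) then pen else 0 := by
  rw [phi_root hI w pen hκ, Finset.sum_comm, Finset.sum_range]
  rfl

theorem optVal_le (hI : I.Valid) (w : ℕ → ℕ) {κ : ℕ → ℕ → ℕ} (hκ : ∀ L j, κ L j ≤ I.cnt j L)
    (hf : I.IsFeasible (I.sol κ)) : I.optVal w ≤ I.weight w κ := by
  refine (val_le_phi w _ hκ _ _ _ _).trans ?_
  rw [phi_root_eq hI w _ hκ, Finset.sum_eq_zero, add_zero]
  exact fun t ht => if_neg ((isFeasible_sol_iff hI hκ).1 hf t (Finset.mem_range.1 ht))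

theorem isFeasible_sol_cnt (hI : I.Valid) : I.IsFeasible (I.sol fun L j => I.cnt j L) := by
  rw [isFeasible_sol_iff hI fun _ _ => le_rfl]
  intro t _
  rw [not_late_run_iff hI]
  intro s _
  rw [Finset.sum_eq_zero]
  · exact Nat.zero_le _
  · intro j hj
    obtain ⟨-, ⟨L, hL, h1, h2, h3⟩, -⟩ := Finset.mem_filter.1 hj
    rw [start_add_cnt hI hL] at h3
    omega

/-- The minimum is attained by a feasible solution, because selecting all rectangles incurs no
penalty. -/
theorem exists_weight_eq_optVal (hI : I.Valid) (w : ℕ → ℕ) :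
    ∃ κ : ℕ → ℕ → ℕ, (∀ L j, κ L j ≤ I.cnt j L) ∧ I.IsFeasible (I.sol κ) ∧
      I.weight w κ = I.optVal w := by
  obtain ⟨κ, hκ, h⟩ := exists_phi_eq_val (I := I) w (1 + ∑ i ∈ Finset.range I.numRects, w i)
    I.depth I.n 0 0 le_rfl
  have hmax : I.optVal w ≤ ∑ i ∈ Finset.range I.numRects, w i := by
    refine (optVal_le hI w (fun _ _ => le_rfl) (isFeasible_sol_cnt hI)).trans ?_
    rw [weight_eq_sum_selIndex hI fun _ _ => le_rfl]
    exact Finset.sum_le_sum_of_subset (selIndex_subset hI fun _ _ => le_rfl)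
  rw [phi_root_eq hI w _ hκ] at h
  have hnot : ∀ t < I.hlen I.depth, ¬ I.Late t (I.run κ t I.depth I.n 0) := by
    intro t ht hl
    have := Finset.single_le_sum (f := fun t => if I.Late t (I.run κ t I.depth I.n 0) then
      (1 + ∑ i ∈ Finset.range I.numRects, w i) else 0) (fun _ _ => Nat.zero_le _)
      (Finset.mem_range.2 ht)
    simp only [if_pos hl] at this
    unfold optVal at hmax
    omega
  refine ⟨κ, hκ, (isFeasible_sol_iff hI hκ).2 hnot, ?_⟩
  rw [Finset.sum_eq_zero fun t ht => if_neg (hnot t (Finset.mem_range.1 ht)), add_zero] at h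
  exact h

variable (I) in
/-- The cost of the rectangle with number `i` in the list of all rectangles. -/
def costAt (i : ℕ) : ℕ := (I.rects.map I.cost).getD i 0

variable (I) in
/-- Weights that order the solutions by their costs, and distinguish the solutions of equal cost by
the binary number whose digits flag the selected rectangles. -/
def codedCost (i : ℕ) : ℕ := 2 ^ I.numRects * I.costAt i + 2 ^ i

theorem weight_costAt (hI : I.Valid) {κ : ℕ → ℕ → ℕ} (hκ : ∀ L j, κ L j ≤ I.cnt j L) :
    I.weight I.costAt κ = ∑ R ∈ I.sol κ, I.cost R := by
  rw [sum_sol hI hκ, weight]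
  refine Finset.sum_congr rfl fun j _ => Finset.sum_congr rfl fun L hL =>
    Finset.sum_congr rfl fun i hi => ?_
  have := getElem?_rects hI j (Nat.lt_succ_iff.1 (Finset.mem_range.1 hL))
    ((Finset.mem_range.1 hi).trans_le (hκ _ _))
  simp [costAt, List.getD, this]

/-- The optimal value for `codedCost` encodes an optimal solution. -/
theorem exists_optimal (hI : I.Valid) : ∃ κ : ℕ → ℕ → ℕ, (∀ L j, κ L j ≤ I.cnt j L) ∧
    I.IsOptimal (I.sol κ) ∧
    I.optVal I.codedCost - 2 ^ I.numRects * I.optVal I.costAt = ∑ i ∈ I.selIndex κ, 2 ^ i := by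
  obtain ⟨κ, hκ, hf, h⟩ := exists_weight_eq_optVal hI I.codedCost
  obtain ⟨κ', hκ', hf', h'⟩ := exists_weight_eq_optVal hI I.costAt
  have hcoded : ∀ κ : ℕ → ℕ → ℕ, (∀ L j, κ L j ≤ I.cnt j L) → I.weight I.codedCost κ =
      2 ^ I.numRects * I.weight I.costAt κ + ∑ i ∈ I.selIndex κ, 2 ^ i := by
    intro κ hκ
    rw [weight_eq_sum_selIndex hI hκ, weight_eq_sum_selIndex hI hκ, Finset.mul_sum,
      ← Finset.sum_add_distrib]
    rfl
  have hlt : ∑ i ∈ I.selIndex κ', 2 ^ i < 2 ^ I.numRects :=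
    (Finset.sum_le_sum_of_subset (selIndex_subset hI hκ')).trans_lt
      (Nat.geomSum_lt le_rfl fun i hi => Finset.mem_range.1 hi)
  have h1 := optVal_le hI I.codedCost hκ' hf'
  have h2 := optVal_le hI I.costAt hκ hf
  rw [← h, hcoded κ hκ, hcoded κ' hκ', h'] at h1
  have h3 : I.weight I.costAt κ = I.optVal I.costAt := by
    refine le_antisymm ?_ h2
    by_contra hlt'
    have := Nat.mul_le_mul_left (2 ^ I.numRects) (show I.optVal I.costAt + 1 ≤ _ from not_le.1 hlt')
    rw [mul_add, mul_one] at this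
    omega
  refine ⟨κ, hκ, ⟨hf, fun Y hY => ?_⟩, ?_⟩
  · obtain ⟨κY, hκY, rfl⟩ := exists_eq_sol hI hY
    rw [← weight_costAt hI hκ, ← weight_costAt hI hκY, h3]
    exact optVal_le hI I.costAt hκY hY
  · rw [← h, hcoded κ hκ, h3, Nat.add_sub_cancel_left]

end CoverInstance

/-! ### The input -/

namespace CoverInstance

variable (I : CoverInstance)

/-- The base for running times: the bound `max 2 (n * P) ^ (c * K ^ 2)` is its `c`-th power. -/
def timeBase : ℕ := max 2 (I.n * I.P) ^ I.K ^ 2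

variable {I}

theorem encode_getD_prefix : I.encode.getD 0 0 = I.n ∧ I.encode.getD 1 0 = I.K ∧
    I.encode.getD 2 0 = I.depth ∧ I.encode.getD 3 0 = I.leafLen := by
  simp [encode]

theorem length_flatMap_jobs :
    ((List.finRange I.n).flatMap fun j => [I.r j, I.p j]).length = 2 * I.n := by
  simp [List.length_flatMap, mul_comm]

theorem flatMap_jobs_getElem? {j k : ℕ} (hj : j < I.n) (hk : k < 2) :
    ((List.finRange I.n).flatMap fun j => [I.r j, I.p j])[2 * j + k]? =
      some (if k = 0 then I.release j else I.proc j) := by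
  have hsum : ∑ x ∈ Finset.range j, (if h : x < I.n then [I.r ⟨x, h⟩, I.p ⟨x, h⟩] else []).length =
      2 * j := by
    rw [Finset.sum_congr rfl (g := fun _ => 2)]
    · simp [mul_comm]
    · intro x hx
      have : x < I.n := (Finset.mem_range.1 hx).trans hj
      simp [this]
  rw [flatMap_finRange_eq, ← hsum, getElem?_flatMap_range _ hj (by simpa [hj] using hk)]
  interval_cases k <;> simp [hj, release, proc]

theorem encode_getD_job {j k : ℕ} (hj : j < I.n) (hk : k < 2) :
    I.encode.getD (4 + (2 * j + k)) 0 = if k = 0 then I.release j else I.proc j := by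
  rw [encode, List.getD, List.append_assoc, List.getElem?_append_right (by simp),
    List.getElem?_append_left (by rw [length_flatMap_jobs]; simp; omega)]
  have := flatMap_jobs_getElem? hj hk
  simp only [List.length_cons, List.length_nil, Nat.add_sub_cancel_left, this, Option.getD_some]

theorem encode_getD_cost (i : ℕ) : I.encode.getD (4 + 2 * I.n + i) 0 = I.costAt i := by
  rw [encode, List.getD, List.getElem?_append_right (by
    rw [List.length_append, length_flatMap_jobs]; simp), List.length_append, length_flatMap_jobs]
  simp [costAt, List.getD]

theorem Valid.two_le_timeBase (hI : I.Valid) : 2 ≤ I.timeBase :=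
  (le_max_left _ _).trans (Nat.le_self_pow (by have := hI.two_le_K; positivity) _)

theorem Valid.n_mul_P_le (hI : I.Valid) : I.n * I.P ≤ I.timeBase :=
  (le_max_right _ _).trans (Nat.le_self_pow (by have := hI.two_le_K; positivity) _)

theorem Valid.K_sq_le (_ : I.Valid) : I.K ^ 2 ≤ I.timeBase :=
  Nat.lt_two_pow_self.le.trans (Nat.pow_le_pow_left (le_max_left _ _) _)

theorem Valid.K_le (hI : I.Valid) : I.K ≤ I.timeBase :=
  (Nat.le_self_pow two_ne_zero _).trans hI.K_sq_le

theorem Valid.n_le (hI : I.Valid) : I.n ≤ I.timeBase :=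
  (Nat.le_mul_of_pos_right _ (pos_of_mul_pos_right hI.n_mul_P_pos (Nat.zero_le _))).trans
    hI.n_mul_P_le

theorem Valid.hlen_depth_le (hI : I.Valid) : I.hlen I.depth ≤ I.timeBase ^ 2 := by
  rw [← len_zero_eq, sq]
  exact hI.len_le.trans (Nat.mul_le_mul hI.K_sq_le hI.n_mul_P_le)

theorem hlen_le_hlen_depth (hI : I.Valid) {L : ℕ} (hL : L ≤ I.depth) :
    I.hlen L ≤ I.hlen I.depth :=
  Nat.le_of_dvd (hI.hlen_pos _) (hlen_dvd hL)

theorem K_pow_le (hI : I.Valid) {L : ℕ} (hL : L ≤ I.depth) : I.K ^ L ≤ I.timeBase ^ 2 :=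
  (Nat.le_mul_of_pos_left _ hI.leafLen_pos).trans
    ((hlen_le_hlen_depth hI hL).trans hI.hlen_depth_le)

theorem Valid.depth_le (hI : I.Valid) : I.depth ≤ I.timeBase ^ 2 :=
  (Nat.lt_two_pow_self.le.trans (Nat.pow_le_pow_left hI.two_le_K _)).trans (K_pow_le hI le_rfl)

theorem Valid.leafLen_le_timeBase (hI : I.Valid) : I.leafLen ≤ I.timeBase :=
  hI.leafLen_le.trans hI.K_le

theorem proc_le (j : ℕ) : I.proc j ≤ I.P := by
  unfold proc; split_ifs
  · exact Finset.le_sup (Finset.mem_univ _)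
  · exact Nat.zero_le _

theorem Valid.P_le (hI : I.Valid) : I.P ≤ I.timeBase :=
  (Nat.le_mul_of_pos_left _ hI.n_pos).trans hI.n_mul_P_le

/-- The number of vectors of states of a cell is polynomial in the measure of running times. -/
theorem B_pow_le (hI : I.Valid) {d : ℕ} (hd : d ≤ I.K ^ 2) : I.B ^ d ≤ I.timeBase ^ 3 := by
  have hQ : I.Q ≤ I.n * I.P + 1 := by
    refine Nat.succ_le_succ ((Finset.sum_le_sum fun j _ => proc_le j).trans ?_)
    simp
  have hP : 0 < I.P := pos_of_mul_pos_right hI.n_mul_P_pos (Nat.zero_le _)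
  set m := max 2 (I.n * I.P) with hm
  have h2 : 2 ≤ m := le_max_left _ _
  have hnP : I.n * I.P ≤ m := le_max_right _ _
  have hn : I.n ≤ m := (Nat.le_mul_of_pos_right _ hP).trans hnP
  have hB : I.B ≤ m ^ 3 :=
    calc I.B ≤ m * (m + 1) := Nat.mul_le_mul hn (hQ.trans (by omega))
      _ ≤ m * (m * m) := Nat.mul_le_mul_left _ (by nlinarith)
      _ = m ^ 3 := by ring
  calc I.B ^ d ≤ I.B ^ I.K ^ 2 := Nat.pow_le_pow_right hI.B_pos hd
    _ ≤ (m ^ 3) ^ I.K ^ 2 := Nat.pow_le_pow_left hB _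
    _ = I.timeBase ^ 3 := by rw [timeBase, ← hm, ← pow_mul, ← pow_mul, mul_comm]

theorem slots_le (hI : I.Valid) (L : ℕ) : I.slots L ≤ I.K ^ 2 := by
  have h1 : I.K ≤ I.K ^ 2 := Nat.le_self_pow two_ne_zero _
  unfold slots hseg
  split_ifs with h
  · obtain ⟨L, rfl⟩ := Nat.exists_eq_add_of_le h
    rw [Nat.add_sub_cancel_left, hlen, hlen, add_comm, pow_add, ← mul_assoc,
      Nat.mul_div_cancel_left _ (show 0 < I.leafLen * I.K ^ L from hI.hlen_pos L)]
  · rw [Nat.div_one, hlen]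
    have h2 := hI.leafLen_le
    obtain rfl | rfl : L = 0 ∨ L = 1 := by omega
    · simpa using h2.trans h1
    · rw [pow_one, sq]; exact Nat.mul_le_mul_right _ h2

end CoverInstance

/-! ### Evaluation of the geometric quantities -/

open CoverInstance

namespace RAM.Ctx

variable {α : Type} {Γ : Ctx α} {ι : α → CoverInstance}

/-- In the states of the context the array `0` holds the input for the instance `ι a`. -/
structure Reads (Γ : Ctx α) (ι : α → CoverInstance) : Prop where
  valid : ∀ a, Γ.dom a → (ι a).Valid
  base : ∀ a, Γ.base a = (ι a).timeBase
  input : ∀ a σ, Γ.rel a σ → ∀ i, σ.arr 0 i = (ι a).encode.getD i 0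

theorem Reads.restrict (h : Γ.Reads ι) {P : α → Prop} : (Γ.restrict P).Reads ι :=
  ⟨fun _ ha => h.valid _ ha.1, h.base, h.input⟩

theorem Reads.ext (h : Γ.Reads ι) {s : ℕ} {P : α → ℕ → Prop} :
    (Γ.ext s P).Reads fun x => ι x.1 :=
  ⟨fun _ ha => h.valid _ ha.1, fun _ => h.base _, fun _ _ hσ => h.input _ _ hσ.1⟩

theorem Reads.extIter (h : Γ.Reads ι) {s : ℕ} {P : α → ℕ → ℕ → Prop} :
    (Γ.extIter s P).Reads fun x => ι x.1.1 :=
  ⟨fun _ ha => h.valid _ ha.1, fun _ => h.base _, fun _ _ hσ => h.input _ _ hσ.1⟩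

theorem Reads.withArr (h : Γ.Reads ι) {b : ℕ} {A : α → ℕ → ℕ} {len : α → ℕ} :
    (Γ.withArr b A len).Reads ι :=
  ⟨h.valid, h.base, fun a σ hσ => h.input a σ hσ.1⟩

theorem Reads.extFill (h : Γ.Reads ι) {b : ℕ} {A : α → ℕ → ℕ} {len : α → ℕ} :
    (Γ.extFill b A len).Reads fun x => ι x.1 :=
  ⟨fun _ ha => h.valid _ ha.1, fun _ => h.base _, fun _ _ hσ => h.input _ _ hσ.1⟩

theorem Reads.bdd (h : Γ.Reads ι) {f : α → ℕ} (e : ℕ)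
    (hf : ∀ a, (ι a).Valid → f a ≤ (ι a).timeBase ^ e) : Γ.Bdd f :=
  ⟨e, fun a ha => by rw [h.base]; exact hf a (h.valid a ha)⟩

theorem Reads.bdd_of_dom (h : Γ.Reads ι) {f : α → ℕ} (e : ℕ)
    (hf : ∀ a, Γ.dom a → (ι a).Valid → f a ≤ (ι a).timeBase ^ e) : Γ.Bdd f :=
  ⟨e, fun a ha => by rw [h.base]; exact hf a ha (h.valid a ha)⟩

theorem Reads.comp_input (h : Γ.Reads ι) {f : α → ℕ} (hf : Γ.Comp f) :
    Γ.Comp fun a => (ι a).encode.getD (f a) 0 :=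
  hf.get 0 (A := fun a i => (ι a).encode.getD i 0) fun a σ _ hσ => h.input a σ hσ _

theorem Reads.small_n (h : Γ.Reads ι) : Γ.Small fun a => (ι a).n :=
  ⟨(h.comp_input (comp_const 0)).congr fun _ _ => encode_getD_prefix.1.symm,
    h.bdd 1 fun _ hI => by rw [pow_one]; exact hI.n_le⟩

theorem Reads.small_K (h : Γ.Reads ι) : Γ.Small fun a => (ι a).K :=
  ⟨(h.comp_input (comp_const 1)).congr fun _ _ => encode_getD_prefix.2.1.symm,
    h.bdd 1 fun _ hI => by rw [pow_one]; exact hI.K_le⟩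

theorem Reads.small_depth (h : Γ.Reads ι) : Γ.Small fun a => (ι a).depth :=
  ⟨(h.comp_input (comp_const 2)).congr fun _ _ => encode_getD_prefix.2.2.1.symm,
    h.bdd 2 fun _ hI => hI.depth_le⟩

theorem Reads.small_leafLen (h : Γ.Reads ι) : Γ.Small fun a => (ι a).leafLen :=
  ⟨(h.comp_input (comp_const 3)).congr fun _ _ => encode_getD_prefix.2.2.2.symm,
    h.bdd 1 fun _ hI => by rw [pow_one]; exact hI.leafLen_le_timeBase⟩

theorem Reads.small_release (h : Γ.Reads ι) {j : α → ℕ} (hj : Γ.Small j) :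
    Γ.Small fun a => (ι a).release (j a) := by
  refine ⟨(Comp.ite_lt hj.1 h.small_n.1 (h.restrict.comp_input
    ((((small_const 4).add ((small_const 2).mul hj)).restrict _).1)) (comp_const 0)).congr
    fun a _ => ?_, h.bdd 2 fun _ hI => (release_le hI).trans hI.hlen_depth_le⟩
  split_ifs with hlt
  · exact (encode_getD_job hlt (k := 0) (by omega)).symm
  · simp [release, hlt]

theorem Reads.small_proc (h : Γ.Reads ι) {j : α → ℕ} (hj : Γ.Small j) :
    Γ.Small fun a => (ι a).proc (j a) := by
  refine ⟨(Comp.ite_lt hj.1 h.small_n.1 (h.restrict.comp_input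
    ((((small_const 4).add (((small_const 2).mul hj).add (small_const 1))).restrict _).1))
    (comp_const 0)).congr
    fun a _ => ?_, h.bdd 1 fun _ hI => by rw [pow_one]; exact (proc_le _).trans hI.P_le⟩
  split_ifs with hlt
  · exact (encode_getD_job hlt (k := 1) (by omega)).symm
  · simp [proc, hlt]

theorem Reads.comp_costAt (h : Γ.Reads ι) {i : α → ℕ} (hi : Γ.Comp i) :
    Γ.Comp fun a => (ι a).costAt (i a) :=
  (h.comp_input (((comp_const 4).add ((small_const 2).mul h.small_n).1).add hi)).congr
    fun _ _ => (encode_getD_cost _).symm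

theorem Reads.small_K_pow (h : Γ.Reads ι) {L : α → ℕ} (hL : Γ.Small L)
    (hle : ∀ a, Γ.dom a → L a ≤ (ι a).depth) : Γ.Small fun a => (ι a).K ^ L a :=
  h.small_K.pow hL (h.bdd_of_dom 2 fun a ha hI => K_pow_le hI (hle a ha))

theorem Reads.small_hlen (h : Γ.Reads ι) {L : α → ℕ} (hL : Γ.Small L)
    (hle : ∀ a, Γ.dom a → L a ≤ (ι a).depth) : Γ.Small fun a => (ι a).hlen (L a) :=
  h.small_leafLen.mul (h.small_K_pow hL hle)

theorem Reads.small_hlen_depth (h : Γ.Reads ι) : Γ.Small fun a => (ι a).hlen (ι a).depth :=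
  h.small_hlen h.small_depth fun _ _ => le_rfl

theorem Reads.small_hseg (h : Γ.Reads ι) {L : α → ℕ} (hL : Γ.Small L)
    (hle : ∀ a, Γ.dom a → L a ≤ (ι a).depth) : Γ.Small fun a => (ι a).hseg (L a) :=
  Small.ite_le (comp_const 2) hL.1
    (h.restrict.small_hlen ((hL.sub (small_const 2)).restrict _)
      fun a ha => (Nat.sub_le _ _).trans (hle a ha.1)) (small_const 1)

theorem Reads.small_start (h : Γ.Reads ι) {j L : α → ℕ} (hj : Γ.Small j) (hL : Γ.Small L)
    (hle : ∀ a, Γ.dom a → L a ≤ (ι a).depth + 1) : Γ.Small fun a => (ι a).start (j a) (L a) := by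
  have hrec : ∀ (a : α) (m : ℕ), (ι a).start (j a) m = Nat.rec ((ι a).release (j a))
      (fun L v => min ((v / (ι a).hlen L + 1) * (ι a).hlen L) ((ι a).hlen (ι a).depth)) m := by
    intro a m
    induction m with
    | zero => rfl
    | succ m ih => rw [start, ih]
  refine ⟨((h.small_release hj).1.iter (body := fun a L v =>
    min ((v / (ι a).hlen L + 1) * (ι a).hlen L) ((ι a).hlen (ι a).depth)) hL
    fun s => ?_).congr fun a _ => hrec a _,
    h.bdd 2 fun _ hI => (start_le hI).trans hI.hlen_depth_le⟩
  set Δ := Γ.extIter s fun a i v => i < L a ∧ v = Nat.rec ((ι a).release (j a)) (fun L v =>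
    min ((v / (ι a).hlen L + 1) * (ι a).hlen L) ((ι a).hlen (ι a).depth)) i
  have hΔ : Δ.Reads fun x => ι x.1.1 := h.extIter
  have hv : Δ.Small fun x => x.2 := ⟨comp_extIter_acc, hΔ.bdd_of_dom 2 fun x hx hI => by
    rw [hx.2.2, ← hrec]; exact (start_le hI).trans hI.hlen_depth_le⟩
  have hi : Δ.Small fun x => x.1.2 := ⟨comp_var (k := Γ.size + s + 2) fun _ _ _ h => h.2.1,
    hΔ.bdd_of_dom 3 fun x hx hI => by
      have h1 : x.1.2 < L x.1.1 := hx.2.1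
      have h2 := hle x.1.1 hx.1
      have h3 := hI.depth_le
      have h4 := Nat.pow_le_pow_right (Nat.pos_of_ne_zero (by have := hI.two_le_timeBase; omega))
        (show 2 ≤ 3 by omega) (n := (ι x.1.1).timeBase)
      omega⟩
  have hlen : Δ.Small fun x => (ι x.1.1).hlen x.1.2 := hΔ.small_hlen hi fun x hx => by
    have h1 : x.1.2 < L x.1.1 := hx.2.1
    have h2 := hle x.1.1 hx.1
    omega
  exact ((((hv.div hlen fun x hx => (hΔ.valid x hx).hlen_pos _).add (small_const 1)).mul hlen).min
    hΔ.small_hlen_depth).1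

theorem Reads.small_slots (h : Γ.Reads ι) {L : α → ℕ} (hL : Γ.Small L)
    (hle : ∀ a, Γ.dom a → L a ≤ (ι a).depth) : Γ.Small fun a => (ι a).slots (L a) :=
  (h.small_hlen hL hle).div (h.small_hseg hL hle) fun a ha => (h.valid a ha).hseg_pos _

theorem Reads.small_skip (h : Γ.Reads ι) {j L : α → ℕ} (hj : Γ.Small j) (hL : Γ.Small L)
    (hle : ∀ a, Γ.dom a → L a ≤ (ι a).depth) : Γ.Small fun a => (ι a).skip (j a) (L a) :=
  ((h.small_start hj hL fun a ha => (hle a ha).trans (Nat.le_succ _)).mod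
    (h.small_hlen hL hle)).div (h.small_hseg hL hle) fun a ha => (h.valid a ha).hseg_pos _

theorem Reads.small_cnt (h : Γ.Reads ι) {j L : α → ℕ} (hj : Γ.Small j) (hL : Γ.Small L)
    (hle : ∀ a, Γ.dom a → L a ≤ (ι a).depth) : Γ.Small fun a => (ι a).cnt (j a) (L a) :=
  Small.ite_lt (h.small_start hj hL fun a ha => (hle a ha).trans (Nat.le_succ _)).1
    h.small_hlen_depth.1 (((h.small_slots hL hle).sub (h.small_skip hj hL hle)).restrict _)
    (small_const 0)

theorem Reads.small_blockStart (h : Γ.Reads ι) {j L : α → ℕ} (hj : Γ.Small j) (hL : Γ.Small L)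
    (hle : ∀ a, Γ.dom a → L a ≤ (ι a).depth) : Γ.Small fun a => (ι a).blockStart (j a) (L a) := by
  refine Small.add (Small.sum (F := fun x => ∑ L' ∈ Finset.range ((ι x.1).depth + 1),
    (ι x.1).cnt x.2 L') hj fun s => ?_) (Small.sum (F := fun x => (ι x.1).cnt (j x.1) x.2) hL
    fun s => ?_)
  · have hj' : (Γ.ext s fun a i => i < j a).Small fun x => x.2 :=
      small_ext_var hj.2 fun _ _ _ h => le_of_lt h
    have hd := h.ext.small_depth.add (small_const (Γ := Γ.ext s fun a i => i < j a) 1)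
    exact Small.sum (F := fun x => (ι x.1.1).cnt x.1.2 x.2) hd fun s' =>
      h.ext.ext.small_cnt hj'.ext (small_ext_var hd.2 fun _ _ _ h => le_of_lt h)
        fun x hx => Nat.lt_succ_iff.1 hx.2
  · refine h.ext.small_cnt hj.ext (small_ext_var hL.2 fun _ _ _ h => le_of_lt h) fun x hx => ?_
    exact (le_of_lt hx.2).trans (hle _ hx.1)

theorem Reads.small_numRects (h : Γ.Reads ι) : Γ.Small fun a => (ι a).numRects :=
  h.small_blockStart h.small_n (small_const 0) fun _ _ => Nat.zero_le _

theorem Reads.small_Q (h : Γ.Reads ι) : Γ.Small fun a => (ι a).Q :=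
  (Small.sum (F := fun x => (ι x.1).proc x.2) h.small_n fun _ =>
    h.ext.small_proc (small_ext_var h.small_n.2 fun _ _ _ h => le_of_lt h)).add (small_const 1)

theorem Reads.small_B (h : Γ.Reads ι) : Γ.Small fun a => (ι a).B := h.small_n.mul h.small_Q

theorem Reads.small_time (h : Γ.Reads ι) {e : α → ℕ} (he : Γ.Small e) :
    Γ.Small fun a => (ι a).time (e a) :=
  (h.small_release (he.div h.small_Q fun _ _ => Q_pos)).add (he.mod h.small_Q)

theorem Reads.small_upd (h : Γ.Reads ι) {j e : α → ℕ} (hj : Γ.Small j) (he : Γ.Small e) :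
    Γ.Small fun a => (ι a).upd (j a) (e a) :=
  Small.min (Small.ite_le (h.small_time he).1 (h.small_release hj).1
    (((hj.mul h.small_Q).add (h.small_proc hj)).restrict _) ((he.add (h.small_proc hj)).restrict _))
    (h.small_B.sub (small_const 1))

theorem Reads.small_B_pow (h : Γ.Reads ι) {d : α → ℕ} (hd : Γ.Small d)
    (hle : ∀ a, Γ.dom a → d a ≤ (ι a).K ^ 2) : Γ.Small fun a => (ι a).B ^ d a :=
  h.small_B.pow hd (h.bdd_of_dom 3 fun a ha hI => B_pow_le hI (hle a ha))

theorem Reads.small_dig (h : Γ.Reads ι) {code d : α → ℕ} (hc : Γ.Small code) (hd : Γ.Small d)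
    (hle : ∀ a, Γ.dom a → d a ≤ (ι a).K ^ 2) : Γ.Small fun a => (ι a).dig (code a) (d a) :=
  (hc.div (h.small_B_pow hd hle) fun a ha => Nat.pow_pos (h.valid a ha).B_pos).mod h.small_B

theorem Reads.small_moveCode (h : Γ.Reads ι) {L d₀ j code : α → ℕ} (hL : Γ.Small L)
    (hle : ∀ a, Γ.dom a → L a ≤ (ι a).depth) (hd₀ : Γ.Small d₀) (hj : Γ.Small j)
    (hc : Γ.Small code) : Γ.Small fun a => (ι a).moveCode (L a) (d₀ a) (j a) (code a) := by
  have hs := h.small_slots hL hle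
  refine Small.sum (F := fun x => (if d₀ x.1 ≤ x.2 then (ι x.1).upd (j x.1)
    ((ι x.1).dig (code x.1) x.2) else (ι x.1).dig (code x.1) x.2) * (ι x.1).B ^ x.2) hs fun s => ?_
  have hd : (Γ.ext s fun a i => i < (ι a).slots (L a)).Small fun x => x.2 :=
    small_ext_var hs.2 fun _ _ _ h => le_of_lt h
  have hd' : ∀ x, (Γ.ext s fun a i => i < (ι a).slots (L a)).dom x → x.2 ≤ (ι x.1).K ^ 2 :=
    fun x hx => (le_of_lt hx.2).trans (slots_le (h.valid _ hx.1) _)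
  have hdig := h.ext.small_dig hc.ext hd hd'
  exact (Small.ite_le hd₀.ext.1 hd.1 ((h.ext.small_upd hj.ext hdig).restrict _)
    (hdig.restrict _)).mul (h.ext.small_B_pow hd hd')

theorem Reads.small_childCode (h : Γ.Reads ι) {L q code : α → ℕ} (hL : Γ.Small L)
    (hle : ∀ a, Γ.dom a → L a + 1 ≤ (ι a).depth) (hq : Γ.Small q)
    (hqK : ∀ a, Γ.dom a → q a < (ι a).K) (hc : Γ.Small code) :
    Γ.Small fun a => (ι a).childCode (L a) (q a) (code a) := by
  have hle' : ∀ a, Γ.dom a → L a ≤ (ι a).depth := fun a ha => (Nat.le_succ _).trans (hle a ha)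
  have hs := h.small_slots hL hle'
  refine Small.sum (F := fun x => ((ι x.1).dig (code x.1) ((q x.1 * (ι x.1).hlen (L x.1) +
    x.2 * (ι x.1).hseg (L x.1)) / (ι x.1).hseg (L x.1 + 1))) * (ι x.1).B ^ x.2) hs fun s => ?_
  have hd : (Γ.ext s fun a i => i < (ι a).slots (L a)).Small fun x => x.2 :=
    small_ext_var hs.2 fun _ _ _ h => le_of_lt h
  refine (h.ext.small_dig hc.ext ((((hq.mul (h.small_hlen hL hle')).ext).add
    (hd.mul (h.small_hseg hL hle').ext)).div
    (h.small_hseg (hL.add (small_const 1)) hle).ext fun x hx => (h.valid _ hx.1).hseg_pos _)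
    fun x hx => ?_).mul (h.ext.small_B_pow hd
    fun x hx => (le_of_lt hx.2).trans (slots_le (h.valid _ hx.1) _))
  -- the segment of the parent that contains the given segment of the child
  have hI := h.valid _ hx.1
  refine le_trans (le_of_lt ?_) (slots_le hI (L x.1 + 1))
  rw [Nat.div_lt_iff_lt_mul (hI.hseg_pos _), slots_mul, hlen_succ]
  have h1 : x.2 * (ι x.1).hseg (L x.1) < (ι x.1).hlen (L x.1) := by
    rw [← slots_mul]
    exact Nat.mul_lt_mul_of_pos_right hx.2 (hI.hseg_pos _)
  have h2 := Nat.mul_le_mul_right ((ι x.1).hlen (L x.1)) (show q x.1 + 1 ≤ _ from hqK _ hx.1)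
  rw [add_mul, mul_comm (ι x.1).K] at h2
  omega

end RAM.Ctx

/-! ### The table of the dynamic program -/

namespace CoverInstance

variable (I : CoverInstance)

/-- The position in the table of the value `val L m pos code`. -/
def tableIndex (L m pos code : ℕ) : ℕ :=
  ((L * I.K ^ I.depth + pos) * (I.n + 1) + m) * I.B ^ I.K ^ 2 + code

/-- The length of the table. -/
def tableSize : ℕ := (I.depth + 1) * I.K ^ I.depth * (I.n + 1) * I.B ^ I.K ^ 2

/-- The entries of the table. They are `0` at the indices that do not belong to a cell. -/
def tableEntry (w : ℕ → ℕ) (pen i : ℕ) : ℕ :=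
  if i / I.B ^ I.K ^ 2 / (I.n + 1) % I.K ^ I.depth <
      I.K ^ (I.depth - i / I.B ^ I.K ^ 2 / (I.n + 1) / I.K ^ I.depth) then
    I.val w pen (i / I.B ^ I.K ^ 2 / (I.n + 1) / I.K ^ I.depth) (i / I.B ^ I.K ^ 2 % (I.n + 1))
      (i / I.B ^ I.K ^ 2 / (I.n + 1) % I.K ^ I.depth) (i % I.B ^ I.K ^ 2)
  else 0

variable {I}

theorem mul_add_div_mod {x y b : ℕ} (h : y < b) : (x * b + y) / b = x ∧ (x * b + y) % b = y := by
  rw [mul_comm, Nat.mul_add_div (by omega), Nat.div_eq_of_lt h, Nat.mul_add_mod,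
    Nat.mod_eq_of_lt h]
  exact ⟨rfl, rfl⟩

theorem tableEntry_tableIndex (hI : I.Valid) (w : ℕ → ℕ) (pen : ℕ) {L m pos code : ℕ}
    (hpos : pos < I.K ^ (I.depth - L)) (hm : m ≤ I.n) (hcode : code < I.B ^ I.K ^ 2) :
    I.tableEntry w pen (I.tableIndex L m pos code) = I.val w pen L m pos code := by
  have hW : pos < I.K ^ I.depth := hpos.trans_le
    (Nat.pow_le_pow_right (by have := hI.two_le_K; omega) (Nat.sub_le _ _))
  obtain ⟨h1, h2⟩ := mul_add_div_mod (x := (L * I.K ^ I.depth + pos) * (I.n + 1) + m) hcode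
  obtain ⟨h3, h4⟩ := mul_add_div_mod (x := L * I.K ^ I.depth + pos) (Nat.lt_succ_of_le hm)
  obtain ⟨h5, h6⟩ := mul_add_div_mod (x := L) hW
  simp only [tableEntry, tableIndex, h1, h2, h3, h4, h5, h6, if_pos hpos]

theorem tableIndex_lt {L m pos code : ℕ} (hL : L ≤ I.depth)
    (hpos : pos < I.K ^ I.depth) (hm : m ≤ I.n) (hcode : code < I.B ^ I.K ^ 2) :
    I.tableIndex L m pos code < I.tableSize := by
  have h1 := Nat.mul_le_mul_right (I.K ^ I.depth) (show L + 1 ≤ I.depth + 1 by omega)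
  rw [add_mul, one_mul] at h1
  have h2 := Nat.mul_le_mul_right (I.n + 1)
    (show L * I.K ^ I.depth + pos + 1 ≤ (I.depth + 1) * I.K ^ I.depth by omega)
  rw [add_mul, one_mul] at h2
  have h3 := Nat.mul_le_mul_right (I.B ^ I.K ^ 2)
    (show (L * I.K ^ I.depth + pos) * (I.n + 1) + m + 1 ≤
      (I.depth + 1) * I.K ^ I.depth * (I.n + 1) by omega)
  rw [add_mul, one_mul] at h3
  unfold tableIndex tableSize
  omega

/-- The values with fewer remaining jobs come first in the table. -/
theorem tableIndex_lt_of_lt {L m m' pos code code' : ℕ} (hm : m' < m)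
    (hcode : code' < I.B ^ I.K ^ 2) : I.tableIndex L m' pos code' < I.tableIndex L m pos code := by
  have := Nat.mul_le_mul_right (I.B ^ I.K ^ 2)
    (show (L * I.K ^ I.depth + pos) * (I.n + 1) + m' + 1 ≤
      (L * I.K ^ I.depth + pos) * (I.n + 1) + m by omega)
  rw [add_mul, one_mul] at this
  unfold tableIndex
  omega

/-- The values of smaller height come first in the table. -/
theorem tableIndex_lt_of_height_lt {L L' m m' pos pos' code code' : ℕ} (hL : L' < L)
    (hpos : pos' < I.K ^ I.depth) (hm : m' ≤ I.n) (hcode : code' < I.B ^ I.K ^ 2) :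
    I.tableIndex L' m' pos' code' < I.tableIndex L m pos code := by
  have h1 := Nat.mul_le_mul_right (I.K ^ I.depth) (show L' + 1 ≤ L from hL)
  rw [add_mul, one_mul] at h1
  have h2 := Nat.mul_le_mul_right (I.n + 1)
    (show L' * I.K ^ I.depth + pos' + 1 ≤ L * I.K ^ I.depth + pos by omega)
  rw [add_mul, one_mul] at h2
  have h3 := Nat.mul_le_mul_right (I.B ^ I.K ^ 2)
    (show (L' * I.K ^ I.depth + pos') * (I.n + 1) + m' + 1 ≤
      (L * I.K ^ I.depth + pos) * (I.n + 1) + m by omega)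
  rw [add_mul, one_mul] at h3
  unfold tableIndex
  omega

theorem enc_lt (hI : I.Valid) {N : ℕ} (hN : N ≤ I.K ^ 2) {g : ℕ → ℕ} (hg : ∀ d < N, g d < I.B) :
    I.enc N g < I.B ^ I.K ^ 2 := by
  refine lt_of_lt_of_le ?_ (Nat.pow_le_pow_right hI.B_pos hN)
  clear hN
  induction N with
  | zero => simp [enc]
  | succ N ih =>
    have h1 := ih fun d hd => hg d (by omega)
    have h2 := Nat.mul_le_mul_right (I.B ^ N) (show g N + 1 ≤ I.B from hg N (by omega))
    unfold enc at h1 ⊢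
    rw [Finset.sum_range_succ, pow_succ']
    rw [add_mul, one_mul] at h2
    omega

theorem moveCode_lt (hI : I.Valid) (L d₀ j code : ℕ) :
    I.moveCode L d₀ j code < I.B ^ I.K ^ 2 :=
  enc_lt hI (slots_le hI L) fun _ _ => by split_ifs; exacts [upd_lt hI _ _, dig_lt hI _ _]

theorem childCode_lt (hI : I.Valid) (L q code : ℕ) : I.childCode L q code < I.B ^ I.K ^ 2 :=
  enc_lt hI (slots_le hI L) fun _ _ => dig_lt hI _ _

theorem child_pos_lt {L q pos : ℕ} (hL : L + 1 ≤ I.depth) (hq : q < I.K)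
    (hpos : pos < I.K ^ (I.depth - (L + 1))) : pos * I.K + q < I.K ^ (I.depth - L) := by
  rw [show I.depth - L = I.depth - (L + 1) + 1 by omega, pow_succ]
  have := Nat.mul_le_mul_right I.K (show pos + 1 ≤ _ from hpos)
  rw [add_mul] at this
  omega

/-- The recursion for `val`, in terms of preceding entries of the table. -/
theorem val_eq_table (hI : I.Valid) (w : ℕ → ℕ) (pen : ℕ) {L m pos code : ℕ} (hL : L ≤ I.depth)
    (hpos : pos < I.K ^ (I.depth - L)) (hm : m ≤ I.n) (hcode : code < I.B ^ I.K ^ 2) :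
    I.val w pen L m pos code =
      if m = 0 then
        if L = 0 then
          ∑ d ∈ Finset.range I.leafLen, if pos * I.leafLen + d < I.time (I.dig code d) then
            (if I.dig code d = 0 then 0 else pen) else 0
        else ∑ q ∈ Finset.range I.K, I.tableEntry w pen (I.tableIndex (L - 1) I.n (pos * I.K + q)
          (I.childCode (L - 1) q code))
      else if I.start (I.n - m) L < I.hlen I.depth then
        if I.start (I.n - m) L / I.hlen L = pos then
          minUpTo (fun k => (∑ i ∈ Finset.range k, w (I.blockStart (I.n - m) L + i)) +
            I.tableEntry w pen (I.tableIndex L (m - 1) pos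
              (I.moveCode L (I.skip (I.n - m) L + k) (I.n - m) code))) (I.cnt (I.n - m) L)
        else I.tableEntry w pen (I.tableIndex L (m - 1) pos code)
      else I.tableEntry w pen (I.tableIndex L (m - 1) pos code) := by
  rcases m with - | m
  · rcases L with - | L
    · rw [val, if_pos rfl, if_pos rfl]
      refine Finset.sum_congr rfl fun d _ => ?_
      by_cases h1 : pos * I.leafLen + d < I.time (I.dig code d) <;>
        by_cases h2 : I.dig code d = 0 <;> simp [Late, h1, h2]
    · rw [val, if_pos rfl, if_neg (by omega)]
      refine Finset.sum_congr rfl fun q hq => ?_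
      rw [Nat.add_sub_cancel, tableEntry_tableIndex hI w pen
        (child_pos_lt hL (Finset.mem_range.1 hq) hpos) le_rfl (childCode_lt hI _ _ _)]
  · have hm' : m ≤ I.n := by omega
    rw [val, if_neg (Nat.succ_ne_zero m)]
    simp only [Nat.add_sub_cancel, tableEntry_tableIndex hI w pen hpos hm' hcode,
      tableEntry_tableIndex hI w pen hpos hm' (moveCode_lt hI _ _ _ _)]
    by_cases hc : I.InCell (I.n - (m + 1)) L pos
    · rw [if_pos hc, if_pos hc.1, if_pos hc.2]
    · rw [if_neg hc]
      by_cases h1 : I.start (I.n - (m + 1)) L < I.hlen I.depth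
      · rw [if_pos h1, if_neg fun h2 => hc ⟨h1, h2⟩]
      · rw [if_neg h1]

end CoverInstance

namespace RAM.Ctx

variable {α : Type} {Γ : Ctx α} {ι : α → CoverInstance}

/-- In the states of the context the array `b` holds the values of `A` at the indices below
`len`. -/
def HasArr (Γ : Ctx α) (b : ℕ) (A : α → ℕ → ℕ) (len : α → ℕ) : Prop :=
  ∀ a σ, Γ.dom a → Γ.rel a σ → ∀ i < len a, σ.arr b i = A a i

variable {b b' : ℕ} {A A' : α → ℕ → ℕ} {len len' : α → ℕ}

theorem HasArr.restrict (h : Γ.HasArr b A len) {P : α → Prop} : (Γ.restrict P).HasArr b A len :=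
  fun a σ ha hσ => h a σ ha.1 hσ

theorem HasArr.ext (h : Γ.HasArr b A len) {s : ℕ} {P : α → ℕ → Prop} :
    (Γ.ext s P).HasArr b (fun x => A x.1) fun x => len x.1 :=
  fun x σ hx hσ => h x.1 σ hx.1 hσ.1

theorem HasArr.extFill (h : Γ.HasArr b A len) :
    (Γ.extFill b' A' len').HasArr b (fun x => A x.1) fun x => len x.1 :=
  fun x σ hx hσ => h x.1 σ hx.1 hσ.1

theorem hasArr_extFill : (Γ.extFill b A len).HasArr b (fun x => A x.1) fun x => x.2 :=
  fun _ _ _ hσ => hσ.2.2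

theorem hasArr_withArr : (Γ.withArr b A len).HasArr b A len := fun _ _ _ hσ => hσ.2

theorem HasArr.comp (h : Γ.HasArr b A len) {i : α → ℕ} (hi : Γ.Comp i)
    (hlt : ∀ a, Γ.dom a → i a < len a) : Γ.Comp fun a => A a (i a) :=
  hi.get b fun a σ ha hσ => h a σ ha hσ _ (hlt a ha)

theorem Reads.small_tableIndex (h : Γ.Reads ι) {L m pos code : α → ℕ} (hL : Γ.Small L)
    (hm : Γ.Small m) (hpos : Γ.Small pos) (hcode : Γ.Small code) :
    Γ.Small fun a => (ι a).tableIndex (L a) (m a) (pos a) (code a) :=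
  ((((((hL.mul (h.small_K_pow h.small_depth fun _ _ => le_rfl)).add hpos).mul
    (h.small_n.add (small_const 1))).add hm).mul
    (h.small_B_pow (h.small_K.pow (small_const 2) (h.small_K.2.pow_const 2)) fun _ _ => le_rfl)).add
    hcode)

/-- The value `val` can be computed from the preceding entries of the table. -/
theorem Reads.comp_val (h : Γ.Reads ι) {w : CoverInstance → ℕ → ℕ} {pen : CoverInstance → ℕ}
    (hw : Γ.HasArr b (fun a => w (ι a)) fun a => (ι a).numRects)
    (hpen : Γ.Comp fun a => pen (ι a)) {ix : α → ℕ}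
    (ht : Γ.HasArr b' (fun a => (ι a).tableEntry (w (ι a)) (pen (ι a))) ix) {L m pos code : α → ℕ}
    (hL : Γ.Small L) (hm : Γ.Small m) (hpos : Γ.Small pos) (hcode : Γ.Small code)
    (hle : ∀ a, Γ.dom a → L a ≤ (ι a).depth ∧ pos a < (ι a).K ^ ((ι a).depth - L a) ∧
      m a ≤ (ι a).n ∧ code a < (ι a).B ^ (ι a).K ^ 2 ∧
      (ι a).tableIndex (L a) (m a) (pos a) (code a) ≤ ix a) :
    Γ.Comp fun a => (ι a).val (w (ι a)) (pen (ι a)) (L a) (m a) (pos a) (code a) := by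
  have hLd : ∀ a, Γ.dom a → L a ≤ (ι a).depth := fun a ha => (hle a ha).1
  refine Comp.congr ?_ fun a ha => val_eq_table (h.valid a ha) _ _ (hle a ha).1 (hle a ha).2.1
    (hle a ha).2.2.1 (hle a ha).2.2.2.1
  refine Comp.ite_eq hm.1 (comp_const 0) ?_ ?_
  · refine Comp.ite_eq (hL.restrict _).1 (comp_const 0) ?_ ?_
    · refine Comp.sum (F := fun x => if pos x.1 * (ι x.1).leafLen + x.2 <
        (ι x.1).time ((ι x.1).dig (code x.1) x.2) then
          (if (ι x.1).dig (code x.1) x.2 = 0 then 0 else pen (ι x.1)) else 0)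
        h.restrict.restrict.small_leafLen fun s => ?_
      have hr := (h.restrict (P := fun a => m a = 0)).restrict (P := fun a => L a = 0)
      have hd := small_ext_var (s := s) (P := fun a i => i < (ι a).leafLen) hr.small_leafLen.2
        fun _ _ _ h => le_of_lt h
      have hdig := hr.ext.small_dig ((hcode.restrict _).restrict _).ext hd
        fun x hx => ((le_of_lt hx.2).trans (h.valid _ hx.1.1.1).leafLen_le).trans
          (Nat.le_self_pow two_ne_zero _)
      exact Comp.ite_lt (((((hpos.restrict _).restrict _).ext).mul
        hr.small_leafLen.ext).add hd).1 (hr.ext.small_time hdig).1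
        (Comp.ite_eq (hdig.restrict _).1 (comp_const 0) (comp_const 0)
          ((((hpen.restrict _).restrict _).ext.restrict _).restrict _)) (comp_const 0)
    · refine Comp.sum (F := fun x => (ι x.1).tableEntry (w (ι x.1)) (pen (ι x.1))
        ((ι x.1).tableIndex (L x.1 - 1) (ι x.1).n (pos x.1 * (ι x.1).K + x.2)
          ((ι x.1).childCode (L x.1 - 1) x.2 (code x.1)))) h.restrict.restrict.small_K fun s => ?_
      have hr := (h.restrict (P := fun a => m a = 0)).restrict (P := fun a => ¬ L a = 0)
      have hq := small_ext_var (s := s) (P := fun a i => i < (ι a).K) hr.small_K.2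
        fun _ _ _ h => le_of_lt h
      have hL' := (((hL.restrict fun a => m a = 0).restrict fun a => ¬ L a = 0).ext (s := s)
        (P := fun a i => i < (ι a).K)).sub (small_const 1)
      have hLpos : ∀ x : α × ℕ, (((Γ.restrict fun a => m a = 0).restrict fun a => ¬ L a = 0).ext s
          fun a i => i < (ι a).K).dom x → L x.1 - 1 + 1 = L x.1 :=
        fun x hx => Nat.succ_pred_eq_of_ne_zero hx.1.2
      refine ht.restrict.restrict.ext.comp (hr.ext.small_tableIndex hL' hr.ext.small_n
        ((((hpos.restrict _).restrict _).ext.mul hr.small_K.ext).add hq)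
        (hr.ext.small_childCode hL' (fun x hx => ?_) hq (fun x hx => hx.2)
          ((hcode.restrict _).restrict _).ext)).1 fun x hx => ?_
      · rw [hLpos x hx]; exact hLd x.1 hx.1.1.1
      · have hI := h.valid _ hx.1.1.1
        obtain ⟨h1, h2, h3, h4, h5⟩ := hle x.1 hx.1.1.1
        rw [← hLpos x hx] at h1 h2
        refine lt_of_lt_of_le (tableIndex_lt_of_height_lt (by have := hLpos x hx; omega) ?_ le_rfl
          (childCode_lt hI _ _ _)) h5
        exact (child_pos_lt h1 hx.2 h2).trans_le
          (Nat.pow_le_pow_right (by have := hI.two_le_K; omega) (Nat.sub_le _ _))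
  · have hr := h.restrict (P := fun a => ¬ m a = 0)
    have hj := hr.small_n.sub (hm.restrict fun a => ¬ m a = 0)
    have hm' := (hm.restrict fun a => ¬ m a = 0).sub (small_const 1)
    have hLr := hL.restrict fun a => ¬ m a = 0
    have hposr := hpos.restrict fun a => ¬ m a = 0
    have hcoder := hcode.restrict fun a => ¬ m a = 0
    have hstart := hr.small_start hj hLr fun a ha => (hLd a ha.1).trans (Nat.le_succ _)
    have hnext : (Γ.restrict fun a => ¬ m a = 0).Comp fun a =>
        (ι a).tableEntry (w (ι a)) (pen (ι a))
          ((ι a).tableIndex (L a) (m a - 1) (pos a) (code a)) := by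
      refine ht.restrict.comp (hr.small_tableIndex hLr hm' hposr hcoder).1 fun a ha => ?_
      obtain ⟨-, -, -, h4, h5⟩ := hle a ha.1
      exact lt_of_lt_of_le (tableIndex_lt_of_lt (by have := ha.2; omega) h4) h5
    refine Comp.ite_lt hstart.1 hr.small_hlen_depth.1 (Comp.ite_eq ?_ ?_ ?_ ?_) (hnext.restrict _)
    · exact ((hstart.div (hr.small_hlen hLr fun a ha => hLd a ha.1)
        fun a ha => (h.valid a ha.1).hlen_pos _).restrict _).1
    · exact (hposr.restrict _).1
    · -- the minimum over the prefixes of the group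
      refine Comp.restrict (Comp.restrict ?_ _) _
      have hcnt := hr.small_cnt hj hLr fun a ha => hLd a ha.1
      refine Comp.minUpTo (F := fun x => (∑ i ∈ Finset.range x.2,
        w (ι x.1) ((ι x.1).blockStart ((ι x.1).n - m x.1) (L x.1) + i)) +
        (ι x.1).tableEntry (w (ι x.1)) (pen (ι x.1)) ((ι x.1).tableIndex (L x.1) (m x.1 - 1)
          (pos x.1) ((ι x.1).moveCode (L x.1) ((ι x.1).skip ((ι x.1).n - m x.1) (L x.1) + x.2)
            ((ι x.1).n - m x.1) (code x.1)))) hcnt fun s => ?_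
      have hk := small_ext_var (s := s) (P := fun a i => i ≤ (ι a).cnt ((ι a).n - m a) (L a))
        hcnt.2 fun _ _ _ h => h
      refine Comp.add ?_ ?_
      · refine Comp.sum (F := fun x => w (ι x.1.1)
          ((ι x.1.1).blockStart ((ι x.1.1).n - m x.1.1) (L x.1.1) + x.2)) hk fun s' => ?_
        refine hw.restrict.ext.ext.comp ((hr.small_blockStart hj hLr
          fun a ha => hLd a ha.1).1.ext.ext.add comp_ext_var) fun x hx => ?_
        obtain ⟨h1, -, h3, -⟩ := hle x.1.1 hx.1.1.1
        have hmx : ¬ m x.1.1 = 0 := hx.1.1.2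
        exact blockStart_add_lt (h.valid _ hx.1.1.1) ⟨(ι x.1.1).n - m x.1.1, by omega⟩ h1
          (lt_of_lt_of_le hx.2 hx.1.2)
      · refine ht.restrict.ext.comp (hr.ext.small_tableIndex hLr.ext hm'.ext hposr.ext
          (hr.ext.small_moveCode hLr.ext (fun x hx => hLd x.1 hx.1.1)
            ((hr.small_skip hj hLr fun a ha => hLd a ha.1).ext.add hk) hj.ext hcoder.ext)).1
          fun x hx => ?_
        obtain ⟨-, -, -, -, h5⟩ := hle x.1 hx.1.1
        have hmx : ¬ m x.1 = 0 := hx.1.2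
        exact lt_of_lt_of_le (tableIndex_lt_of_lt (by omega)
          (moveCode_lt (h.valid _ hx.1.1) _ _ _ _)) h5
    · exact (hnext.restrict _).restrict _

theorem Reads.small_tableSize (h : Γ.Reads ι) : Γ.Small fun a => (ι a).tableSize :=
  (((h.small_depth.add (small_const 1)).mul (h.small_K_pow h.small_depth fun _ _ => le_rfl)).mul
    (h.small_n.add (small_const 1))).mul
    (h.small_B_pow (h.small_K.pow (small_const 2) (h.small_K.2.pow_const 2)) fun _ _ => le_rfl)

/-- The table can be computed. -/
theorem Reads.reach_table {Γ : Ctx CoverInstance} (h : Γ.Reads id) {w : CoverInstance → ℕ → ℕ}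
    {pen : CoverInstance → ℕ} (hw : Γ.HasArr b w fun I => I.numRects) (hpen : Γ.Comp pen)
    (hb : Γ.Indep b') : Γ.Reach (Γ.withArr b' (fun I => I.tableEntry (w I) (pen I)) tableSize) := by
  refine reach_withArr hb h.small_tableSize ?_
  set Δ := Γ.extFill b' (fun I => I.tableEntry (w I) (pen I)) tableSize
  have hr : Δ.Reads Prod.fst := h.extFill
  have hi : Δ.Small fun x => x.2 := by
    obtain ⟨e, he⟩ := h.small_tableSize.2
    exact ⟨comp_var (k := Γ.size + 1) fun _ _ _ h => h.2.1, e,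
      fun x hx => (le_of_lt hx.2).trans (he x.1 hx.1)⟩
  have hpenΔ : Δ.Comp fun x => pen x.1 := hpen.reindex Prod.fst (show Γ.size ≤ Γ.size + 2 by omega)
    (fun _ h => h.1) (fun _ => rfl) fun _ _ h => h.1
  have hΩ := hr.small_B_pow (hr.small_K.pow (small_const 2) (hr.small_K.2.pow_const 2))
    fun _ _ => le_rfl
  have hW := hr.small_K_pow hr.small_depth fun _ _ => le_rfl
  have hn1 := hr.small_n.add (small_const 1)
  have hΩ0 : ∀ x, Δ.dom x → 0 < x.1.B ^ x.1.K ^ 2 := fun x hx => Nat.pow_pos (hr.valid x hx).B_pos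
  have hW0 : ∀ x, Δ.dom x → 0 < x.1.K ^ x.1.depth :=
    fun x hx => Nat.pow_pos (by have := (hr.valid x hx).two_le_K; omega)
  have hcell := (hi.div hΩ hΩ0).div hn1 fun _ _ => Nat.succ_pos _
  have hL := hcell.div hW hW0
  have hpos := hcell.mod hW
  have hm := (hi.div hΩ hΩ0).mod hn1
  have hcode := hi.mod hΩ
  refine Comp.ite_lt hpos.1 (hr.small_K_pow (hr.small_depth.sub hL) fun _ _ => Nat.sub_le _ _).1 ?_
    (comp_const 0)
  refine hr.restrict.comp_val (b := b) (b' := b') (ix := fun x => x.2) hw.extFill.restrict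
    (hpenΔ.restrict _) hasArr_extFill.restrict (hL.restrict _) (hm.restrict _) (hpos.restrict _)
    (hcode.restrict _) fun x hx => ?_
  have hI := h.valid _ hx.1.1
  refine ⟨?_, hx.2, Nat.lt_succ_iff.1 (Nat.mod_lt _ (Nat.succ_pos _)),
    Nat.mod_lt _ (hΩ0 x hx.1), ?_⟩
  · have hlt : x.2 < x.1.tableSize := hx.1.2
    rw [← Nat.lt_succ_iff, Nat.div_lt_iff_lt_mul (hW0 x hx.1), Nat.div_lt_iff_lt_mul
      (Nat.succ_pos _), Nat.div_lt_iff_lt_mul (hΩ0 x hx.1)]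
    exact hlt
  · simp only [tableIndex]
    rw [Nat.div_add_mod', Nat.div_add_mod', Nat.div_add_mod']

end RAM.Ctx

/-! ### The program -/

/-- A number that is nonzero if and only if the `i`-th of the `R` binary digits of `V` is `1`: the
powers of two above `2 ^ i` are subtracted from `V` where possible, from the highest one on, and the
remainder is compared with `2 ^ i`. -/
def bitFlag (R V i : ℕ) : ℕ :=
  Nat.rec V (fun q v => if 2 ^ (R - 1 - q) ≤ v then v - 2 ^ (R - 1 - q) else v) (R - 1 - i) + 1 -
    2 ^ i

theorem sum_two_pow_lt {S : Finset ℕ} {k : ℕ} (h : ∀ i ∈ S, i < k) : ∑ i ∈ S, 2 ^ i < 2 ^ k :=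
  Nat.geomSum_lt le_rfl h

theorem filter_lt_succ_sum (S : Finset ℕ) (x : ℕ) :
    ∑ i ∈ S.filter (· < x + 1), 2 ^ i =
      (if x ∈ S then 2 ^ x else 0) + ∑ i ∈ S.filter (· < x), 2 ^ i := by
  split_ifs with h
  · rw [← Finset.sum_insert (a := x) (f := fun i => 2 ^ i) (by simp)]
    congr 1
    ext i
    simp only [Finset.mem_filter, Finset.mem_insert]
    constructor
    · rintro ⟨h1, h2⟩
      rcases Nat.lt_succ_iff_lt_or_eq.1 h2 with h3 | h3
      · exact Or.inr ⟨h1, h3⟩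
      · exact Or.inl h3
    · rintro (rfl | ⟨h1, h2⟩)
      · exact ⟨h, Nat.lt_succ_self _⟩
      · exact ⟨h1, h2.trans (Nat.lt_succ_self _)⟩
  · rw [zero_add]
    congr 1
    ext i
    simp only [Finset.mem_filter]
    refine and_congr_right fun hi => ⟨fun h' => ?_, fun h' => by omega⟩
    have : i ≠ x := fun hx => h (hx ▸ hi)
    omega

theorem bitFlag_ne_zero_iff {R : ℕ} {S : Finset ℕ} (hS : S ⊆ Finset.range R) {i : ℕ} (hi : i < R) :
    bitFlag R (∑ i ∈ S, 2 ^ i) i ≠ 0 ↔ i ∈ S := by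
  have key : ∀ k ≤ R, (Nat.rec (∑ i ∈ S, 2 ^ i) (fun q v => if 2 ^ (R - 1 - q) ≤ v then
      v - 2 ^ (R - 1 - q) else v) k : ℕ) = ∑ i ∈ S.filter (· < R - k), 2 ^ i := by
    intro k hk
    induction k with
    | zero =>
      rw [Finset.filter_true_of_mem fun i hi => by simpa using hS hi]
      rfl
    | succ k ih =>
      have hlt : ∑ i ∈ S.filter (· < R - (k + 1)), 2 ^ i < 2 ^ (R - (k + 1)) :=
        sum_two_pow_lt fun i hi => (Finset.mem_filter.1 hi).2
      have h1 := filter_lt_succ_sum S (R - (k + 1))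
      rw [show R - (k + 1) + 1 = R - k by omega] at h1
      simp only [ih (by omega), show R - 1 - k = R - (k + 1) by omega]
      rw [h1]
      split_ifs <;> omega
  have hlt : ∑ j ∈ S.filter (· < i), 2 ^ j < 2 ^ i :=
    sum_two_pow_lt fun i hi => (Finset.mem_filter.1 hi).2
  rw [bitFlag, key _ (by omega), show R - (R - 1 - i) = i + 1 by omega, filter_lt_succ_sum]
  split_ifs with h
  · simp only [h, iff_true]; omega
  · simp only [h, iff_false]; omega

namespace RAM.Ctx

variable {α : Type} {Γ : Ctx α}

theorem Comp.two_pow_mul {f g : α → ℕ} (hf : Γ.Small f) (hg : Γ.Comp g) :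
    Γ.Comp fun a => 2 ^ f a * g a := by
  refine (hg.iter (body := fun _ _ v => v + v) hf fun s =>
    comp_extIter_acc.add comp_extIter_acc).congr fun a _ => ?_
  induction f a with
  | zero => simp
  | succ n ih => rw [pow_succ, mul_comm _ 2, mul_assoc, ih, two_mul]

theorem Comp.two_pow {f : α → ℕ} (hf : Γ.Small f) : Γ.Comp fun a => 2 ^ f a :=
  (Comp.two_pow_mul hf (comp_const 1)).congr fun _ _ => (mul_one _).symm

theorem comp_bitFlag {R V i : α → ℕ} (hR : Γ.Small R) (hV : Γ.Comp V) (hi : Γ.Small i) :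
    Γ.Comp fun a => bitFlag (R a) (V a) (i a) := by
  have hcnt : Γ.Small fun a => R a - 1 - i a := (hR.sub (small_const 1)).sub hi
  refine Comp.sub (Comp.add (hV.iter (body := fun a q v => if 2 ^ (R a - 1 - q) ≤ v then
    v - 2 ^ (R a - 1 - q) else v) hcnt fun s => ?_) (comp_const 1)) (.two_pow hi)
  obtain ⟨e, he⟩ := hR.2
  have hpow : ∀ s, (Γ.ext s fun _ _ => True).Comp fun x => 2 ^ (R x.1 - 1 - x.2) := fun s =>
    Comp.two_pow ⟨(hR.sub (small_const 1)).1.ext.sub comp_ext_var, e, fun x hx =>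
      ((Nat.sub_le _ _).trans (Nat.sub_le _ _)).trans (he x.1 hx.1)⟩
  have hpow' := Comp.toIter (P' := fun a q v => q < R a - 1 - i a ∧ v = Nat.rec (V a)
    (fun q v => if 2 ^ (R a - 1 - q) ≤ v then v - 2 ^ (R a - 1 - q) else v) q)
    hpow (fun _ _ _ _ _ => trivial) s
  exact Comp.ite_le hpow' comp_extIter_acc ((comp_extIter_acc.sub hpow').restrict _)
    (comp_extIter_acc.restrict _)

/-- The context at the beginning: the memory holds the input. -/
def input : Ctx CoverInstance where
  size := 0
  dom := Valid
  base := timeBase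
  rel I σ := ∀ i, σ.arr 0 i = I.encode.getD i 0
  two_le _ hI := hI.two_le_timeBase
  stable _ _ _ h ha := by rw [ha.2]; exact h

theorem reads_input : input.Reads id := ⟨fun _ h => h, fun _ => rfl, fun _ _ h => h⟩

theorem indep_input {b : ℕ} (hb : b ≠ 0) : input.Indep b := fun I σ τ h _ harr i => by
  rw [harr 0 hb.symm]; exact h i

theorem Indep.withArr {b b' : ℕ} {A : α → ℕ → ℕ} {len : α → ℕ} (h : Γ.Indep b) (hb : b' ≠ b) :
    (Γ.withArr b' A len).Indep b := fun a σ τ hσ hreg harr =>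
  ⟨h a σ τ hσ.1 hreg harr, fun i hi => by rw [harr b' hb]; exact hσ.2 i hi⟩

/-- After storing the weights `w` in the array `b` and the table for them in the array `b'`, the
optimal value for `w` can be evaluated, while all that was available before remains so. -/
theorem Reads.reach_optVal {Γ : Ctx CoverInstance} (h : Γ.Reads id) {w : CoverInstance → ℕ → ℕ}
    {b b' : ℕ} (hb : b ≠ b') (hi : Γ.Indep b) (hi' : Γ.Indep b')
    (hw : (Γ.extFill b w numRects).Comp fun x => w x.1 x.2) :
    ∃ Δ : Ctx CoverInstance, Γ.Reach Δ ∧ Δ.Reads id ∧ Δ.dom = Γ.dom ∧ Δ.base = Γ.base ∧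
      Δ.Comp (fun I => I.optVal (w I)) ∧
      (∀ c, c ≠ b → c ≠ b' → Γ.Indep c → Δ.Indep c) ∧
      (∀ f, Γ.Comp f → Δ.Comp f) := by
  have hw' : (Γ.withArr b w numRects).HasArr b w numRects := hasArr_withArr
  have hr : (Γ.withArr b w numRects).Reads id := h.withArr
  have hpen : (Γ.withArr b w numRects).Comp fun I => 1 + ∑ i ∈ Finset.range I.numRects, w I i :=
    (comp_const 1).add (Comp.sum (F := fun x => w x.1 x.2) hr.small_numRects fun s =>
      hw'.ext.comp comp_ext_var fun x hx => hx.2)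
  refine ⟨_, (reach_withArr hi h.small_numRects hw).trans
    (hr.reach_table (b' := b') hw' hpen (hi'.withArr hb)) (fun _ h => h) (fun _ => rfl),
    hr.withArr, rfl, rfl, ?_, fun c hc hc' hcΓ => (hcΓ.withArr hc.symm).withArr hc'.symm,
    fun f hf => hf.reindex id le_rfl (fun _ h => h) (fun _ => rfl) fun _ _ h => h.1.1⟩
  refine Comp.congr (hasArr_withArr.comp (hr.withArr.small_tableIndex hr.withArr.small_depth
    hr.withArr.small_n (small_const 0) (small_const 0)).1 fun I hI => ?_) fun I hI => ?_
  · have hI := h.valid I hI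
    exact tableIndex_lt le_rfl (Nat.pow_pos (by have := hI.two_le_K; omega)) le_rfl
      (Nat.pow_pos hI.B_pos)
  · have hI := h.valid I hI
    exact (tableEntry_tableIndex hI _ _ (by simp) le_rfl (Nat.pow_pos hI.B_pos)).symm

/-- The digits of the number that encodes an optimal solution can be computed into the output
array. The tables for the costs and for the coded costs are stored in separate arrays. -/
theorem reach_output : input.Reach (input.withArr 1 (fun I i => bitFlag I.numRects
    (I.optVal I.codedCost - 2 ^ I.numRects * I.optVal I.costAt) i) numRects) := by
  have hvar : ∀ {Γ : Ctx CoverInstance} {b : ℕ} {A : CoverInstance → ℕ → ℕ}, Γ.Reads id →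
      (Γ.extFill b A numRects).Small fun x => x.2 := by
    intro Γ b A h
    obtain ⟨e, he⟩ := h.small_numRects.2
    exact ⟨comp_var (k := Γ.size + 1) fun _ _ _ h => h.2.1, e,
      fun x hx => (le_of_lt hx.2).trans (he x.1 hx.1)⟩
  obtain ⟨Γ₁, hreach₁, hr₁, hd₁, hb₁, hval₁, hind₁, -⟩ := reads_input.reach_optVal
    (w := costAt) (b := 2) (b' := 3) (by omega) (indep_input (by omega)) (indep_input (by omega))
    (reads_input.extFill.comp_costAt (hvar reads_input).1)
  have hI₁ : ∀ c, c ≠ 0 → c ≠ 2 → c ≠ 3 → Γ₁.Indep c := fun c h0 h2 h3 =>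
    hind₁ c h2 h3 (indep_input h0)
  obtain ⟨Γ₂, hreach₂, hr₂, hd₂, hb₂, hval₂, hind₂, hext₂⟩ := hr₁.reach_optVal
    (w := codedCost) (b := 4) (b' := 5) (by omega) (hI₁ 4 (by omega) (by omega) (by omega))
    (hI₁ 5 (by omega) (by omega) (by omega))
    ((Comp.two_pow_mul hr₁.extFill.small_numRects (hr₁.extFill.comp_costAt (hvar hr₁).1)).add
      (Comp.two_pow (hvar hr₁)))
  have hV : Γ₂.Comp fun I => I.optVal I.codedCost - 2 ^ I.numRects * I.optVal I.costAt :=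
    hval₂.sub (Comp.two_pow_mul hr₂.small_numRects (hext₂ _ hval₁))
  have hout := reach_withArr (Γ := Γ₂) (b := 1) (A := fun I i => bitFlag I.numRects
    (I.optVal I.codedCost - 2 ^ I.numRects * I.optVal I.costAt) i) (len := numRects)
    (hind₂ 1 (by omega) (by omega) (hI₁ 1 (by omega) (by omega) (by omega))) hr₂.small_numRects
    (comp_bitFlag hr₂.extFill.small_numRects (hV.reindex Prod.fst
      (show Γ₂.size ≤ Γ₂.size + 2 by omega) (fun _ h => h.1) (fun _ => rfl) fun _ _ h => h.1)
      (hvar hr₂))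
  obtain ⟨c, e, H⟩ := (hreach₁.trans hreach₂ (fun I h => by rwa [hd₁])
    fun I => by rw [hb₁]).trans hout (fun I h => by rwa [hd₂, hd₁]) fun I => by rw [hb₂, hb₁]
  refine ⟨c, e, fun I σ hI hσ => ?_⟩
  obtain ⟨t, τ, hrun, hτ, ht⟩ := H I σ hI hσ
  exact ⟨t, τ, hrun, ⟨fun i => hr₂.input I τ hτ.1 i, hτ.2⟩, ht⟩

end RAM.Ctx

/-- There are a single program and an absolute constant `c` such that on every instance (for every
`ε`) the program outputs, in array `1`, an optimal solution in at most `(n P) ^ (c K²)` steps, where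
`n P` is replaced by `2` if `n P = 1`. -/
theorem mainTheorem2 :
    ∃ (prog : RAM.Cmd) (c : ℕ), ∀ I : CoverInstance, I.Valid →
      ∃ (t : ℕ) (σ : RAM.State),
        RAM.Run prog (RAM.State.ofInput I.encode) t σ ∧
        t ≤ (max 2 (I.n * I.P)) ^ (c * I.K ^ 2) ∧
        I.IsOptimal (I.selected (σ.arr 1)) := by
  obtain ⟨prog, c, H⟩ := RAM.Ctx.reach_output
  refine ⟨prog, c, fun I hI => ?_⟩
  obtain ⟨t, σ, hrun, hσ, ht⟩ := H I (RAM.State.ofInput I.encode) hI fun i => by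
    simp [RAM.State.ofInput]
  refine ⟨t, σ, hrun, ?_, ?_⟩
  · rw [mul_comm c, pow_mul]
    exact ht
  · obtain ⟨κ, hκ, hopt, hV⟩ := exists_optimal hI
    rwa [selected_eq_sol hI hκ fun i hi => ?_]
    rw [hσ.2 i hi]
    dsimp only
    rw [hV]
    exact bitFlag_ne_zero_iff (selIndex_subset hI hκ) hi
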